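/- Let $\Omega\subset\mathbb R^2$ be a bounded polygonal domain, partitioned by a finite mesh $\mathcal T_h$ into pairwise disjoint open connected polygons $K$ (not necessarily convex), with edges $e$ of length $h_e$ and mesh size $h=\max_K h_K$, $h_K=\operatorname{diam}K$. Assume that the mesh has a compatible (conforming) sub-decomposition into triangles, whose vertices include all end points of mesh edges, such that every $K$ consists of at most $N$ triangles and every triangle $T$ satisfies $h_T/\rho_T\le\sigma$, where $h_T$ is its diameter and $\rho_T$ the radius of its greatest inscribed ball. To each $K$ assign a sampling node $x_K\in K$ and a patch $S(K)\ni K$ of elements, connected through edge-neighbours, with at most $M$ elements. Let $\mathcal I(K)=\{x_{K'}:K'\in S(K)\}$, let $d_K$ be the diameter of the region covered by $S(K)$, and $d=\max_K d_K$. Let $m\ge1$, let $\mathbb S_m$ be the space of divergence-free polynomial vector fields of total degree at most $m$, and suppose (Assumption A) that for every $K$ any $p\in\mathbb S_m$ vanishing on $\mathcal I(K)$ vanishes on $S(K)$. Put $$\Lambda(m,\mathcal I(K))=\max_{0\ne p\in\mathbb S_m}\frac{\|p\|_{L^\infty(S(K))}}{\|p|_{\mathcal I(K)}\|_{\ell^\infty}},\qquad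 \Lambda_m=\max_K\bigl(1+\Lambda(m,\mathcal I(K))\sqrt{\#\mathcal I(K)}\bigr).$$ For a vector field $v$ that is constant on each element, let $\mathcal S v$ be the piecewise polynomial field with $(\mathcal Sv)|_K=\arg\min_{p\in\mathbb S_m}\sum_{K'\in S(K)}|v(x_{K'})-p(x_{K'})|^2$. Let $V_h$ be the set of all such $\mathcal Sv$. The interpolant $u_I\in V_h$ of a continuous field $u$ is $\mathcal S\tilde u$, with $\tilde u$ piecewise constant and $\tilde u(x_K)=u(x_K)$. On an interior edge $e=\partial K^+\cap\partial K^-$ with unit normals $n^\pm$ outward to $K^\pm$, put $[\![v\otimes n]\!]=v^+\otimes n^++v^-\otimes n^-$ and $[\![v\cdot n]\!]=v^+\cdot n^++v^-\cdot n^-$; on an edge in $\partial\Omega$ these are $v\otimes n$ and $v\cdot n$. The DG energy norm is $$\|v\|_h^2=\sum_K|v|_{H^1(K)}^2+\sum_e h_e^{-1}\|[\![v\otimes n]\!]\|_{L^2(e)}^2+\sum_e h_e^{-(m+1)}\|[\![v\cdot n]\!]\|_{L^2(e)}^2 ,$$ where $e$ runs over all (interior and boundary) edges. Lemma. For all $m\ge1$,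 $N$, $\sigma$, $M$ and $h_0$ there is a constant $C$, depending only on these numbers, such that for all $\Omega$, meshes, sampling nodes and patches as above with $h\le h_0$ the following holds. If $u\in[H^{m+1}(\Omega)]^2$, represented by its continuous version on $\overline\Omega$, solves the Stokes problem $-\Delta u+\nabla p=f$, $\operatorname{div}u=0$ in $\Omega$, $u=g$ on $\partial\Omega$, then its interpolant $u_I\in V_h$ satisfies $$\|u-u_I\|_h\le C\bigl(h^{m/2}+\Lambda_m d^{m/2}\bigr)|u|_{H^{m+1}(\Omega)} .$$ -/

import Mathlib

open scoped ContDiff Topology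

noncomputable section

namespace StokesDG

/-- The Euclidean plane. -/
abbrev Plane : Type := EuclideanSpace ℝ (Fin 2)

/-! ### Weak derivatives and Sobolev spaces on subsets of the plane -/

/-- The classical partial derivative `∂φ/∂x_i`. -/
def pderivFun (i : Fin 2) (φ : Plane → ℝ) : Plane → ℝ :=
  fun x => fderiv ℝ φ x (EuclideanSpace.single i 1)

/-- The classical mixed partial derivative `∂₀^a ∂₁^b φ`. -/
def mixedDeriv (a b : ℕ) (φ : Plane → ℝ) : Plane → ℝ :=
  (pderivFun 0)^[a] ((pderivFun 1)^[b] φ)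

/-- Test functions: smooth functions with compact support contained in `D`. -/
structure IsTestFunction (D : Set Plane) (φ : Plane → ℝ) : Prop where
  smooth : ContDiff ℝ ∞ φ
  compact : HasCompactSupport φ
  support : tsupport φ ⊆ D

/-- `g` is the weak derivative `∂₀^a ∂₁^b f` on the open set `D`. -/
structure IsWeakDeriv (D : Set Plane) (a b : ℕ) (f g : Plane → ℝ) : Prop where
  locInt : MeasureTheory.LocallyIntegrableOn f D
  locInt' : MeasureTheory.LocallyIntegrableOn g D
  integral_eq : ∀ φ : Plane → ℝ, IsTestFunction D φ →
    ∫ x in D, f x * mixedDeriv a b φ x = (-1) ^ (a + b) * ∫ x in D, g x * φ x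

open Classical in
/-- The weak derivative `∂₀^a ∂₁^b f` on `D` (unique almost everywhere); `0` if there is none. -/
def weakDeriv (D : Set Plane) (a b : ℕ) (f : Plane → ℝ) : Plane → ℝ :=
  if h : ∃ g, IsWeakDeriv D a b f g then h.choose else 0

/-- `f ∈ H^k(D)`: all weak derivatives of order at most `k` exist and lie in `L²(D)`. -/
def MemH (k : ℕ) (D : Set Plane) (f : Plane → ℝ) : Prop :=
  ∀ a b : ℕ, a + b ≤ k → ∃ g, IsWeakDeriv D a b f g ∧
    MeasureTheory.MemLp g 2 (MeasureTheory.volume.restrict D)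

/-- `u ∈ [H^k(D)]²`. -/
def MemHVec (k : ℕ) (D : Set Plane) (u : Plane → Plane) : Prop :=
  ∀ i, MemH k D (fun x => u x i)

/-- The squared seminorm `|u|²_{H^k(D)}`: the sum over both components and over all multi-indices
of order exactly `k` of the squared `L²(D)` norms of the weak derivatives. -/
def seminormSq (k : ℕ) (D : Set Plane) (u : Plane → Plane) : ℝ :=
  ∑ i : Fin 2, ∑ a ∈ Finset.range (k + 1),
    ∫ x in D, (weakDeriv D a (k - a) (fun y => u y i) x) ^ 2

/-- The seminorm `|u|_{H^k(D)}`. -/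
def hSeminorm (k : ℕ) (D : Set Plane) (u : Plane → Plane) : ℝ :=
  Real.sqrt (seminormSq k D u)

/-! ### The Stokes problem -/

/-- `(u, p)` solves `-Δu + ∇p = f`, `div u = 0` in `D` in the sense of distributions, and `u = g`
on the boundary of `D`. The compatibility condition on `g` is a consequence of `div u = 0`. -/
structure IsStokesSolution (D : Set Plane) (f g u : Plane → Plane) (p : Plane → ℝ) : Prop where
  locInt_f : MeasureTheory.LocallyIntegrableOn f D
  locInt_u : MeasureTheory.LocallyIntegrableOn u D
  locInt_p : MeasureTheory.LocallyIntegrableOn p D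
  momentum : ∀ i : Fin 2, ∀ φ : Plane → ℝ, IsTestFunction D φ →
    -(∫ x in D, u x i * (mixedDeriv 2 0 φ x + mixedDeriv 0 2 φ x))
      - ∫ x in D, p x * pderivFun i φ x = ∫ x in D, f x i * φ x
  div_free : ∀ φ : Plane → ℝ, IsTestFunction D φ →
    ∫ x in D, (u x 0 * pderivFun 0 φ x + u x 1 * pderivFun 1 φ x) = 0
  boundary : ∀ x ∈ frontier D, u x = g x

/-! ### Polygonal meshes -/

/-- Open polygons: bounded, connected, regular open sets (no slits, no punctures) whose boundary is
a finite union of segments. They need not be convex, nor simply connected. -/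
structure IsPolygon (D : Set Plane) : Prop where
  isOpen : IsOpen D
  connected : IsConnected D
  bounded : Bornology.IsBounded D
  regular : interior (closure D) = D
  boundary : ∃ s : Finset (Plane × Plane), frontier D = ⋃ q ∈ s, segment ℝ q.1 q.2

/-- A partition of `Ω` into open polygons `elt K`, `K : ι`, together with its edges `e : ε`. The edge
`e` is the segment between `src e` and `tgt e`. It is a side of the element `plus e`; it is either
shared with the element `j` if `minus e = some j` (interior edge), or lies on the boundary of `Ω`
if `minus e = none`. The vector `normal e` is the unit normal of `e` outward to `plus e`. -/
structure PolygonalMesh (Ω : Set Plane) (ι ε : Type) where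
  elt : ι → Set Plane
  elt_polygon : ∀ K, IsPolygon (elt K)
  elt_disjoint : ∀ K L, K ≠ L → Disjoint (elt K) (elt L)
  elt_cover : ⋃ K, closure (elt K) = closure Ω
  src : ε → Plane
  tgt : ε → Plane
  src_ne_tgt : ∀ e, src e ≠ tgt e
  edge_disjoint : ∀ e e', e ≠ e' →
    Disjoint (openSegment ℝ (src e) (tgt e)) (openSegment ℝ (src e') (tgt e'))
  edge_cover : ⋃ e, segment ℝ (src e) (tgt e) = ⋃ K, frontier (elt K)
  plus : ε → ι
  minus : ε → Option ι
  edge_plus : ∀ e, segment ℝ (src e) (tgt e) ⊆ frontier (elt (plus e))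
  edge_minus : ∀ e j, minus e = some j →
    j ≠ plus e ∧ segment ℝ (src e) (tgt e) ⊆ frontier (elt j)
  edge_boundary : ∀ e, minus e = none → segment ℝ (src e) (tgt e) ⊆ frontier Ω
  normal : ε → Plane
  normal_unit : ∀ e, ‖normal e‖ = 1
  normal_orth : ∀ e, inner ℝ (normal e) (tgt e - src e) = 0
  /-- At all but finitely many points `x` of the edge, `normal e` points out of `plus e`. -/
  normal_outward : ∀ e, {x | x ∈ openSegment ℝ (src e) (tgt e) ∧
    ¬ ∀ᶠ t in 𝓝[>] (0 : ℝ), x - t • normal e ∈ elt (plus e) ∧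
      x + t • normal e ∉ elt (plus e)}.Finite

/-- The closed triangle with vertices `v 0, v 1, v 2`. -/
def triangle (v : Fin 3 → Plane) : Set Plane := convexHull ℝ (Set.range v)

/-- The radius of the greatest ball inscribed in `T`. -/
def inradius (T : Set Plane) : ℝ := sSup {r | ∃ c, Metric.closedBall c r ⊆ T}

namespace PolygonalMesh

variable {Ω : Set Plane} {ι ε : Type} (𝒯 : PolygonalMesh Ω ι ε)

/-- The mesh size `h`, the maximum of the element diameters. -/
def meshSize : ℝ := ⨆ K, Metric.diam (𝒯.elt K)

/-- Conditions A1 and A2 with parameters `N` and `σ`: there is a compatible (conforming)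
sub-decomposition of the mesh into triangles, such that every element is composed of at most `N`
triangles, and every triangle satisfies `h_T / ρ_T ≤ σ`. Compatibility means that two distinct
triangles meet exactly in the convex hull of their common vertices (nothing, a common vertex or a
common side) and that the end points of the mesh edges are vertices of triangles. -/
def ShapeRegular (N : ℕ) (σ : ℝ) : Prop :=
  ∃ (τ : Type) (_ : Fintype τ) (vert : τ → Fin 3 → Plane) (owner : τ → ι),
    (∀ t, AffineIndependent ℝ (vert t)) ∧
    (∀ s t, s ≠ t → Set.range (vert s) ≠ Set.range (vert t) ∧
      triangle (vert s) ∩ triangle (vert t) =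
        convexHull ℝ (Set.range (vert s) ∩ Set.range (vert t))) ∧
    (∀ K, closure (𝒯.elt K) = ⋃ t ∈ {t | owner t = K}, triangle (vert t)) ∧
    (∀ e, (∃ t, 𝒯.src e ∈ Set.range (vert t)) ∧ ∃ t, 𝒯.tgt e ∈ Set.range (vert t)) ∧
    (∀ K, {t | owner t = K}.ncard ≤ N) ∧
    (∀ t, Metric.diam (triangle (vert t)) / inradius (triangle (vert t)) ≤ σ)

/-- Von Neumann (edge) neighbours. -/
def neighbourGraph : SimpleGraph ι :=
  SimpleGraph.fromRel fun K L => ∃ e, 𝒯.plus e = K ∧ 𝒯.minus e = some L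

/-! ### Jumps and the energy norm -/

/-- The integral of `F` over the edge `e` with respect to arc length. -/
def edgeIntegral (e : ε) (F : Plane → ℝ) : ℝ :=
  dist (𝒯.src e) (𝒯.tgt e) * ∫ t in (0 : ℝ)..1, F (AffineMap.lineMap (𝒯.src e) (𝒯.tgt e) t)

/-- The jump `⟦v · n⟧ = v⁺ · n⁺ + v⁻ · n⁻` (`v · n` on boundary edges) of a piecewise defined field;
`v K` is the field on the closed element `K`. -/
def jumpNormal (v : ι → Plane → Plane) (e : ε) (x : Plane) : ℝ :=
  match 𝒯.minus e with
  | some j => inner ℝ (v (𝒯.plus e) x) (𝒯.normal e) + inner ℝ (v j x) (-𝒯.normal e)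
  | none => inner ℝ (v (𝒯.plus e) x) (𝒯.normal e)

/-- The jump `⟦v ⊗ n⟧ = v⁺ ⊗ n⁺ + v⁻ ⊗ n⁻` (`v ⊗ n` on boundary edges). -/
def jumpTensor (v : ι → Plane → Plane) (e : ε) (x : Plane) : Matrix (Fin 2) (Fin 2) ℝ :=
  match 𝒯.minus e with
  | some j => Matrix.of (fun i k =>
      v (𝒯.plus e) x i * 𝒯.normal e k + v j x i * (-𝒯.normal e) k)
  | none => Matrix.of (fun i k => v (𝒯.plus e) x i * 𝒯.normal e k)

variable [Fintype ι] [Fintype ε]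

/-- `|v|²_{1,h} = ∑_K |v|²_{H¹(K)}`. -/
def brokenSq (v : ι → Plane → Plane) : ℝ := ∑ K, seminormSq 1 (𝒯.elt K) (v K)

/-- `|v|²_* = ∑_e h_e⁻¹ ‖⟦v ⊗ n⟧‖²_{L²(e)}`. -/
def starSq (v : ι → Plane → Plane) : ℝ :=
  ∑ e, (dist (𝒯.src e) (𝒯.tgt e))⁻¹ *
    𝒯.edgeIntegral e (fun x => ∑ i, ∑ k, (𝒯.jumpTensor v e x i k) ^ 2)

/-- `|v|²_⋄ = ∑_e h_e^{-(m+1)} ‖⟦v · n⟧‖²_{L²(e)}`. -/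
def diamondSq (m : ℕ) (v : ι → Plane → Plane) : ℝ :=
  ∑ e, ((dist (𝒯.src e) (𝒯.tgt e)) ^ (m + 1))⁻¹ *
    𝒯.edgeIntegral e (fun x => (𝒯.jumpNormal v e x) ^ 2)

/-- The DG energy norm `‖v‖_h`. -/
def energyNorm (m : ℕ) (v : ι → Plane → Plane) : ℝ :=
  Real.sqrt (𝒯.brokenSq v + 𝒯.starSq v + 𝒯.diamondSq m v)

end PolygonalMesh

/-! ### Solenoidal polynomials -/

/-- `𝕊_m`: pairs of polynomials of total degree at most `m` with vanishing divergence. -/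
def solenoidal (m : ℕ) : Submodule ℝ (Fin 2 → MvPolynomial (Fin 2) ℝ) where
  carrier := {p | (∀ i, p i ∈ MvPolynomial.restrictTotalDegree (Fin 2) ℝ m) ∧
    MvPolynomial.pderiv 0 (p 0) + MvPolynomial.pderiv 1 (p 1) = 0}
  add_mem' := by
    rintro p q ⟨hp, hp'⟩ ⟨hq, hq'⟩
    refine ⟨fun i => Submodule.add_mem _ (hp i) (hq i), ?_⟩
    simp only [Pi.add_apply, map_add]
    linear_combination hp' + hq'
  zero_mem' := ⟨fun i => Submodule.zero_mem _, by simp⟩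
  smul_mem' := by
    rintro c p ⟨hp, hp'⟩
    refine ⟨fun i => Submodule.smul_mem _ c (hp i), ?_⟩
    simp only [Pi.smul_apply, Derivation.map_smul, ← smul_add, hp', smul_zero]

/-- The vector field of a pair of polynomials. -/
def polyField : (Fin 2 → MvPolynomial (Fin 2) ℝ) →ₗ[ℝ] (Plane → Plane) where
  toFun p x := WithLp.toLp 2 fun i => MvPolynomial.eval (fun j => x j) (p i)
  map_add' p q := by ext x i; simp
  map_smul' c p := by ext x i; simp

/-! ### Patches and reconstruction -/

theorem exists_closest_image {V F : Type*} [AddCommGroup V] [Module ℝ V] [NormedAddCommGroup F]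
    [InnerProductSpace ℝ F] [FiniteDimensional ℝ F] (T : V →ₗ[ℝ] F) (y : F) :
    ∃ p, ∀ q, ‖y - T p‖ ≤ ‖y - T q‖ := by
  obtain ⟨w, hw, hy⟩ := Submodule.exists_norm_eq_iInf_of_complete_subspace
    (LinearMap.range T) (Submodule.complete_of_finiteDimensional (LinearMap.range T)) y
  obtain ⟨p, rfl⟩ := hw
  refine ⟨p, fun q => ?_⟩
  rw [hy]
  exact ciInf_le (f := fun w : LinearMap.range T => ‖y - w‖)
    ⟨0, by rintro _ ⟨w, rfl⟩; exact norm_nonneg _⟩ ⟨T q, LinearMap.mem_range_self T q⟩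

/-- Sampling nodes `x_K ∈ K` and element patches `S(K) ∋ K`. Patches are built by adding edge
neighbours, so they are connected through edges. -/
structure Patches {Ω : Set Plane} {ι ε : Type} (𝒯 : PolygonalMesh Ω ι ε) where
  node : ι → Plane
  node_mem : ∀ K, node K ∈ 𝒯.elt K
  patch : ι → Finset ι
  self_mem : ∀ K, K ∈ patch K
  connected : ∀ K, (𝒯.neighbourGraph.induce (patch K : Set ι)).Connected

namespace Patches

variable {Ω : Set Plane} {ι ε : Type} {𝒯 : PolygonalMesh Ω ι ε} (P : Patches 𝒯)

/-- The region covered by the patch `S(K)`. -/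
def region (K : ι) : Set Plane := ⋃ L ∈ P.patch K, 𝒯.elt L

/-- `d`, the maximum of the patch diameters. -/
def patchSize : ℝ := ⨆ K, Metric.diam (P.region K)

/-- A solenoidal polynomial of degree at most `m` that vanishes at the sampling nodes of a patch
vanishes on the patch. -/
def AssumptionA (m : ℕ) : Prop :=
  ∀ K, ∀ p ∈ solenoidal m, (∀ L ∈ P.patch K, polyField p (P.node L) = 0) →
    ∀ x ∈ P.region K, polyField p x = 0

/-- `Λ(m, I(K)) = max_p ‖p‖_{L^∞(S(K))} / ‖p‖_{ℓ^∞(I(K))}` over solenoidal polynomials `p`. -/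
def stabilityConst (m : ℕ) (K : ι) : ℝ :=
  ⨆ p : solenoidal m, (⨆ x : P.region K, ‖polyField p.1 x.1‖) /
    ⨆ L : P.patch K, ‖polyField p.1 (P.node L.1)‖

/-- `Λ_m = max_K (1 + Λ(m, I(K)) √#I(K))`; the number of sampling nodes is the number of elements
of the patch. -/
def Lam (m : ℕ) : ℝ :=
  ⨆ K, (1 + P.stabilityConst m K * Real.sqrt (P.patch K).card)

/-- The least-squares functional on the patch of `K` for a piecewise constant field with value `v L`
on the element `L`. -/
def lsq (K : ι) (v : ι → Plane) (p : Fin 2 → MvPolynomial (Fin 2) ℝ) : ℝ :=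
  ∑ L ∈ P.patch K, ‖v L - polyField p (P.node L)‖ ^ 2

theorem exists_argmin (m : ℕ) (K : ι) (v : ι → Plane) :
    ∃ p ∈ solenoidal m, ∀ q ∈ solenoidal m, P.lsq K v p ≤ P.lsq K v q := by
  classical
  let ev : solenoidal m →ₗ[ℝ] PiLp 2 (fun _ : P.patch K => Plane) :=
    (WithLp.linearEquiv 2 ℝ (P.patch K → Plane)).symm.toLinearMap.comp
      (LinearMap.pi fun L => (LinearMap.proj (P.node L.1)).comp
        (polyField.comp (solenoidal m).subtype))
  have hev : ∀ p : solenoidal m,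
      P.lsq K v p.1 = ‖WithLp.toLp 2 (fun L : P.patch K => v L.1) - ev p‖ ^ 2 := by
    intro p
    rw [PiLp.norm_sq_eq_of_L2, lsq, ← Finset.sum_coe_sort]
    rfl
  obtain ⟨p, hp⟩ := exists_closest_image ev (WithLp.toLp 2 (fun L : P.patch K => v L.1))
  refine ⟨p.1, p.2, fun q hq => ?_⟩
  rw [hev p, hev ⟨q, hq⟩]
  exact pow_le_pow_left₀ (norm_nonneg _) (hp _) 2

/-- The local reconstruction `𝒮_K v`: the minimizer of the least-squares functional over the
solenoidal polynomials (unique on the patch under Assumption A). -/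
def localRecon (m : ℕ) (v : ι → Plane) (K : ι) : Fin 2 → MvPolynomial (Fin 2) ℝ :=
  (P.exists_argmin m K v).choose

/-- The reconstruction operator `𝒮` on piecewise constant fields, which are given by their values
on the elements; its values are piecewise polynomial fields. -/
def recon (m : ℕ) (v : ι → Plane) : ι → Plane → Plane :=
  fun K => polyField (P.localRecon m v K)

/-- The approximation space `V_h = 𝒮 U_h`. -/
def Vh (m : ℕ) : Set (ι → Plane → Plane) := Set.range (P.recon m)

/-- The interpolant `u_I = 𝒮 ũ`, where `ũ` is piecewise constant with `ũ(x_K) = u(x_K)`. -/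
def interpolant (m : ℕ) (u : Plane → Plane) : ι → Plane → Plane :=
  P.recon m fun K => u (P.node K)

end Patches

end StokesDG

end

/-!
The energy norm of the interpolation error is estimated element by element. Of the Stokes system,
only `div u = 0` matters: it makes the local approximants solenoidal.

*Local approximation.* On a convex set `D` the Taylor polynomials of a smooth solenoidal field are
solenoidal, and so is their average over all base points in `D`. By the integral form of the
remainder, the average differs from the field by at most `diam(D)^(m+1) |D|^(-1/2) |u|_{H^{m+1}(D)}`
up to a constant, in the maximum norm (`exists_solenoidal_approx_smooth`). Mollification of a
slightly contracted copy of `u` extends this to Sobolev fields (`exists_solenoidal_approx`). The same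
method bounds the first derivatives of a function `w` on `D` by its maximum and its derivatives of
order `m + 1` (`exists_interpolation`).

*Patches.* An element need not be convex, so one passes through the triangles of the subdivision.
Two triangles with a common side are compared on a disc around the midpoint of the side: the disc is
covered by the two triangles, it is convex, and an approximant on the disc is close to the
approximants on both triangles on sets of positive size, hence everywhere at comparable distance,
since polynomials of bounded degree form a finite-dimensional space. The triangles of a patch form a
connected family of at most `M N` members of comparable size, and therefore a single solenoidal
polynomial approximates `u` on the whole patch (`exists_approx_union`). Connectedness through sides
within an element holds because removing a point does not disconnect a disc
(`IsConformingFamily.preconnected_induce`).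

*Stability.* Comparing the values of the least-squares functional at its minimizer and at this
polynomial bounds their difference at the nodes; the definition of `Λ` carries the bound over to the
patch, at the price of the factor `Λ_m` (`exists_interpolant_bound`).

*Summation.* The maximum norm estimate gives the jump terms directly. Each edge contains a side of a
triangle (`IsSubdivision.exists_side_subset`), so its length is bounded from below by the diameter
of a triangle `T` at that edge, and the weight `h_e^{-(m+1)}` is compensated by `diam(T)^m`. The
broken seminorm is bounded on each triangle by `exists_interpolation`, applied to `u - u_I`. Finally,
each element has boundedly many edges and neighbours, so each element lies in boundedly many patches
(`sum_region_le`). The resulting bound is the one with the term `Λ_m d^{m/2}` alone.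
-/

noncomputable section

namespace StokesDG

open MeasureTheory

/-! ### Partial derivatives of smooth functions -/

theorem contDiff_pderivFun (i : Fin 2) {φ : Plane → ℝ} (h : ContDiff ℝ ∞ φ) :
    ContDiff ℝ ∞ (pderivFun i φ) :=
  (h.fderiv_right (m := ∞) le_rfl).clm_apply contDiff_const

theorem mixedDeriv_zero (φ : Plane → ℝ) : mixedDeriv 0 0 φ = φ := rfl

theorem mixedDeriv_add_one_left (a b : ℕ) (φ : Plane → ℝ) :
    mixedDeriv (a + 1) b φ = pderivFun 0 (mixedDeriv a b φ) :=
  Function.iterate_succ_apply' _ _ _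

theorem contDiff_mixedDeriv (a b : ℕ) {φ : Plane → ℝ} (h : ContDiff ℝ ∞ φ) :
    ContDiff ℝ ∞ (mixedDeriv a b φ) := by
  induction a with
  | zero =>
    induction b with
    | zero => exact h
    | succ b ih =>
      have : mixedDeriv 0 (b + 1) φ = pderivFun 1 (mixedDeriv 0 b φ) :=
        Function.iterate_succ_apply' _ _ _
      rw [this]
      exact contDiff_pderivFun 1 ih
  | succ a ih =>
    rw [mixedDeriv_add_one_left]
    exact contDiff_pderivFun 0 ih

theorem pderivFun_comm {φ : Plane → ℝ} (h : ContDiff ℝ ∞ φ) :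
    pderivFun 0 (pderivFun 1 φ) = pderivFun 1 (pderivFun 0 φ) := by
  have hd : Differentiable ℝ (fderiv ℝ φ) :=
    (h.fderiv_right (m := ∞) le_rfl).differentiable (by simp)
  ext x
  have key : ∀ i j : Fin 2, pderivFun i (pderivFun j φ) x =
      fderiv ℝ (fderiv ℝ φ) x (EuclideanSpace.single i 1) (EuclideanSpace.single j 1) := by
    intro i j
    unfold pderivFun
    rw [fderiv_clm_apply (hd x) (differentiableAt_const _)]
    simp
  rw [key, key]
  have hs : IsSymmSndFDerivAt ℝ φ x :=
    h.contDiffAt.isSymmSndFDerivAt (by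
      rw [minSmoothness_of_isRCLikeNormedField]
      exact WithTop.coe_le_coe.2 le_top)
  exact hs _ _

theorem mixedDeriv_add_one_right (a b : ℕ) {φ : Plane → ℝ} (h : ContDiff ℝ ∞ φ) :
    mixedDeriv a (b + 1) φ = pderivFun 1 (mixedDeriv a b φ) := by
  induction a with
  | zero => exact Function.iterate_succ_apply' _ _ _
  | succ a ih =>
    rw [mixedDeriv_add_one_left, ih, mixedDeriv_add_one_left,
      pderivFun_comm (contDiff_mixedDeriv a b h)]

theorem mixedDeriv_pderivFun_zero (a b : ℕ) {φ : Plane → ℝ} (h : ContDiff ℝ ∞ φ) :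
    mixedDeriv a b (pderivFun 0 φ) = mixedDeriv (a + 1) b φ := by
  induction b with
  | zero => exact (Function.iterate_succ_apply _ _ _).symm
  | succ b ih =>
    rw [mixedDeriv_add_one_right _ _ (contDiff_pderivFun 0 h), ih,
      mixedDeriv_add_one_right _ _ h]

theorem mixedDeriv_pderivFun_one (a b : ℕ) (φ : Plane → ℝ) :
    mixedDeriv a b (pderivFun 1 φ) = mixedDeriv a (b + 1) φ :=
  congrArg (pderivFun 0)^[a] (Function.iterate_succ_apply _ _ _).symm

theorem pderivFun_add (i : Fin 2) {φ ψ : Plane → ℝ} (h : Differentiable ℝ φ)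
    (h' : Differentiable ℝ ψ) :
    pderivFun i (fun x => φ x + ψ x) = fun x => pderivFun i φ x + pderivFun i ψ x := by
  ext x
  simp only [pderivFun]
  rw [fderiv_fun_add (h x) (h' x)]
  rfl

theorem mixedDeriv_add (a b : ℕ) {φ ψ : Plane → ℝ} (h : ContDiff ℝ ∞ φ)
    (h' : ContDiff ℝ ∞ ψ) :
    mixedDeriv a b (fun x => φ x + ψ x) = fun x => mixedDeriv a b φ x + mixedDeriv a b ψ x := by
  have hd : ∀ {f : Plane → ℝ}, ContDiff ℝ ∞ f → Differentiable ℝ f :=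
    fun hf => hf.differentiable (by simp)
  have hs := h.add h'
  induction a with
  | zero =>
    induction b with
    | zero => rfl
    | succ b ih =>
      rw [mixedDeriv_add_one_right _ _ hs, ih, mixedDeriv_add_one_right _ _ h,
        mixedDeriv_add_one_right _ _ h',
        pderivFun_add 1 (hd (contDiff_mixedDeriv _ _ h)) (hd (contDiff_mixedDeriv _ _ h'))]
  | succ a ih =>
    rw [mixedDeriv_add_one_left, ih, mixedDeriv_add_one_left, mixedDeriv_add_one_left,
      pderivFun_add 0 (hd (contDiff_mixedDeriv _ _ h)) (hd (contDiff_mixedDeriv _ _ h'))]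

/-- Derivatives commute, up to a power of `s`, with an affine change of variables with linear
part `s • id`. -/
theorem mixedDeriv_comp_smul_add (a b : ℕ) {φ : Plane → ℝ} (h : ContDiff ℝ ∞ φ) (s : ℝ)
    (z : Plane) :
    mixedDeriv a b (fun x => φ (s • x + z)) =
      fun x => s ^ (a + b) * mixedDeriv a b φ (s • x + z) := by
  have hp : ∀ (i : Fin 2) (c : ℝ) {f : Plane → ℝ}, ContDiff ℝ ∞ f →
      pderivFun i (fun x => c * f (s • x + z)) = fun x => c * s * pderivFun i f (s • x + z) := by
    intro i c f hf
    ext x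
    have h1 : HasFDerivAt (fun x : Plane => s • x + z)
        (s • ContinuousLinearMap.id ℝ Plane) x :=
      ((hasFDerivAt_id x).const_smul s).add_const z
    have h2 := ((hf.differentiable (by simp) (s • x + z)).hasFDerivAt.comp x h1).const_mul c
    simp only [pderivFun]
    rw [show (fun x => c * f (s • x + z)) = fun x => c * (f ∘ fun x => s • x + z) x from rfl,
      h2.fderiv]
    simp [mul_assoc]
  have hs : ContDiff ℝ ∞ (fun x : Plane => φ (s • x + z)) :=
    h.comp ((contDiff_id.const_smul s).add contDiff_const)
  induction a with
  | zero =>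
    induction b with
    | zero => simp [mixedDeriv_zero]
    | succ b ih =>
      rw [mixedDeriv_add_one_right _ _ hs, ih, hp 1 _ (contDiff_mixedDeriv _ _ h),
        mixedDeriv_add_one_right _ _ h]
      ext x; ring
  | succ a ih =>
    rw [mixedDeriv_add_one_left, ih, hp 0 _ (contDiff_mixedDeriv _ _ h),
      mixedDeriv_add_one_left]
    ext x; ring

/-! ### Derivatives along lines -/

/-- The `k`-th derivative of `v` in the direction `ξ`, expanded in mixed partial derivatives. -/
def dirDeriv (k : ℕ) (ξ : Plane) (v : Plane → ℝ) (x : Plane) : ℝ :=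
  ∑ ij ∈ Finset.HasAntidiagonal.antidiagonal k, (k.choose ij.1 : ℝ) *
    (ξ 0 ^ ij.1 * ξ 1 ^ ij.2 * mixedDeriv ij.1 ij.2 v x)

theorem dirDeriv_zero (ξ : Plane) (v : Plane → ℝ) (x : Plane) : dirDeriv 0 ξ v x = v x := by
  simp [dirDeriv, mixedDeriv_zero]

theorem hasDerivAt_line {v : Plane → ℝ} (h : ContDiff ℝ ∞ v) (y ξ : Plane) (s : ℝ) :
    HasDerivAt (fun s : ℝ => v (y + s • ξ))
      (ξ 0 * pderivFun 0 v (y + s • ξ) + ξ 1 * pderivFun 1 v (y + s • ξ)) s := by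
  have h1 : HasDerivAt (fun s : ℝ => y + s • ξ) ξ s := by
    simpa using ((hasDerivAt_id s).smul_const ξ).const_add y
  have h2 := (h.differentiable (by simp) (y + s • ξ)).hasFDerivAt.comp_hasDerivAt s h1
  refine h2.congr_deriv ?_
  have : ξ = ξ 0 • EuclideanSpace.single 0 (1 : ℝ) + ξ 1 • EuclideanSpace.single 1 (1 : ℝ) := by
    ext i; fin_cases i <;> simp
  set z := y + s • ξ
  rw [show fderiv ℝ v z ξ = fderiv ℝ v z (ξ 0 • EuclideanSpace.single 0 (1 : ℝ) +
    ξ 1 • EuclideanSpace.single 1 (1 : ℝ)) from congrArg _ this]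
  simp [pderivFun]

theorem hasDerivAt_dirDeriv {v : Plane → ℝ} (h : ContDiff ℝ ∞ v) (k : ℕ) (y ξ : Plane) (s : ℝ) :
    HasDerivAt (fun s : ℝ => dirDeriv k ξ v (y + s • ξ)) (dirDeriv (k + 1) ξ v (y + s • ξ)) s := by
  have h1 : HasDerivAt (fun s : ℝ => dirDeriv k ξ v (y + s • ξ))
      (∑ ij ∈ Finset.HasAntidiagonal.antidiagonal k, (k.choose ij.1 : ℝ) * (ξ 0 ^ ij.1 * ξ 1 ^ ij.2 *
        (ξ 0 * mixedDeriv (ij.1 + 1) ij.2 v (y + s • ξ) +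
          ξ 1 * mixedDeriv ij.1 (ij.2 + 1) v (y + s • ξ)))) s := by
    unfold dirDeriv
    refine HasDerivAt.fun_sum fun ij _ => ?_
    have := hasDerivAt_line (contDiff_mixedDeriv ij.1 ij.2 h) y ξ s
    rw [← mixedDeriv_add_one_left, ← mixedDeriv_add_one_right _ _ h] at this
    exact (this.const_mul _).const_mul _
  refine h1.congr_deriv ?_
  symm
  rw [dirDeriv, Finset.sum_antidiagonal_choose_succ_mul
    (fun i j => ξ 0 ^ i * ξ 1 ^ j * mixedDeriv i j v (y + s • ξ)), ← Finset.sum_add_distrib]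
  refine Finset.sum_congr rfl fun ij hij => ?_
  have : k.choose ij.2 = k.choose ij.1 := by
    rw [← Finset.HasAntidiagonal.mem_antidiagonal.1 hij, add_comm, Nat.choose_symm_add]
  rw [this]
  ring

/-- The sum of the squares of the derivatives of order `k`. -/
def sqDeriv (k : ℕ) (v : Plane → ℝ) (x : Plane) : ℝ :=
  ∑ a ∈ Finset.range (k + 1), mixedDeriv a (k - a) v x ^ 2

theorem sqDeriv_nonneg (k : ℕ) (v : Plane → ℝ) (x : Plane) : 0 ≤ sqDeriv k v x :=
  Finset.sum_nonneg fun _ _ => sq_nonneg _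

theorem continuous_mixedDeriv (a b : ℕ) {v : Plane → ℝ} (h : ContDiff ℝ ∞ v) :
    Continuous (mixedDeriv a b v) := (contDiff_mixedDeriv a b h).continuous

theorem continuous_sqDeriv (k : ℕ) {v : Plane → ℝ} (h : ContDiff ℝ ∞ v) :
    Continuous (sqDeriv k v) :=
  continuous_finsetSum _ fun _ _ => (continuous_mixedDeriv _ _ h).pow 2

theorem abs_coord_le (ξ : Plane) (i : Fin 2) : |ξ i| ≤ ‖ξ‖ := by
  simpa using PiLp.norm_apply_le ξ i

theorem dirDeriv_sq_le (k : ℕ) (ξ : Plane) (v : Plane → ℝ) (x : Plane) :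
    dirDeriv k ξ v x ^ 2 ≤ ((k + 1) * 4 ^ k) * ‖ξ‖ ^ (2 * k) * sqDeriv k v x := by
  have e : dirDeriv k ξ v x = ∑ a ∈ Finset.range (k + 1),
      ((k.choose a : ℝ) * (ξ 0 ^ a * ξ 1 ^ (k - a))) * mixedDeriv a (k - a) v x := by
    rw [dirDeriv, Finset.Nat.sum_antidiagonal_eq_sum_range_succ_mk]
    exact Finset.sum_congr rfl fun _ _ => by ring
  rw [e]
  refine (Finset.sum_mul_sq_le_sq_mul_sq _ _ _).trans ?_
  refine mul_le_mul_of_nonneg_right ?_ (sqDeriv_nonneg k v x)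
  have hb : ∀ a ∈ Finset.range (k + 1),
      ((k.choose a : ℝ) * (ξ 0 ^ a * ξ 1 ^ (k - a))) ^ 2 ≤ 4 ^ k * ‖ξ‖ ^ (2 * k) := by
    intro a ha
    have ha' : a ≤ k := Nat.lt_succ_iff.1 (Finset.mem_range.1 ha)
    have h1 : |(k.choose a : ℝ) * (ξ 0 ^ a * ξ 1 ^ (k - a))| ≤ 2 ^ k * ‖ξ‖ ^ k := by
      rw [abs_mul, abs_mul, abs_pow, abs_pow, Nat.abs_cast]
      refine mul_le_mul ?_ ?_ (by positivity) (by positivity)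
      · exact_mod_cast Nat.choose_le_two_pow k a
      · calc |ξ 0| ^ a * |ξ 1| ^ (k - a) ≤ ‖ξ‖ ^ a * ‖ξ‖ ^ (k - a) := by
              gcongr <;> exact abs_coord_le _ _
          _ = ‖ξ‖ ^ k := by rw [← pow_add, Nat.add_sub_cancel' ha']
    calc ((k.choose a : ℝ) * (ξ 0 ^ a * ξ 1 ^ (k - a))) ^ 2
        = |(k.choose a : ℝ) * (ξ 0 ^ a * ξ 1 ^ (k - a))| ^ 2 := (sq_abs _).symm
      _ ≤ (2 ^ k * ‖ξ‖ ^ k) ^ 2 := by gcongr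
      _ = 4 ^ k * ‖ξ‖ ^ (2 * k) := by
          rw [mul_pow, ← pow_mul, ← pow_mul, mul_comm k 2, pow_mul]; norm_num
  refine (Finset.sum_le_sum hb).trans ?_
  simp only [Finset.sum_const, Finset.card_range, nsmul_eq_mul]
  push_cast
  rw [mul_assoc]

/-! ### One-variable estimates -/

/-- Taylor's formula with integral remainder, for a sequence of successive derivatives. -/
theorem taylor_of_hasDerivAt (m : ℕ) (F : ℕ → ℝ → ℝ)
    (hF : ∀ k s, HasDerivAt (F k) (F (k + 1) s) s) (s : ℝ) :
    F 0 s = ∑ k ∈ Finset.range (m + 1), F k 0 * s ^ k / k.factorial +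
      ∫ τ in (0 : ℝ)..s, (s - τ) ^ m / m.factorial * F (m + 1) τ := by
  have hc : ∀ k, Continuous (F k) := fun k =>
    continuous_iff_continuousAt.2 fun s => (hF k s).continuousAt
  have hd : ∀ τ, HasDerivAt (fun τ => ∑ k ∈ Finset.range (m + 1),
      F k τ * (s - τ) ^ k / k.factorial) ((s - τ) ^ m / m.factorial * F (m + 1) τ) τ := by
    intro τ
    induction m with
    | zero => simpa using hF 0 τ
    | succ m ih =>
      simp only [Finset.sum_range_succ _ (m + 1)]
      have h1 : HasDerivAt (fun τ : ℝ => (s - τ) ^ (m + 1)) (-((m + 1 : ℕ) * (s - τ) ^ m)) τ := by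
        have := ((hasDerivAt_id τ).const_sub s).pow (m + 1)
        refine this.congr_deriv ?_
        simp
      refine (ih.add (((hF (m + 1) τ).mul h1).div_const ((m + 1).factorial : ℝ))).congr_deriv ?_
      have h2 : ((m + 1).factorial : ℝ) = (m + 1) * m.factorial := by
        push_cast [Nat.factorial_succ]; ring
      have h3 : (m.factorial : ℝ) ≠ 0 := by positivity
      have h4 : (m + 1 : ℝ) ≠ 0 := by positivity
      rw [h2]
      field_simp
      push_cast
      ring
  have hint : IntervalIntegrable (fun τ => (s - τ) ^ m / m.factorial * F (m + 1) τ)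
      MeasureTheory.volume 0 s :=
    Continuous.intervalIntegrable (by have := hc (m + 1); fun_prop) _ _
  rw [intervalIntegral.integral_eq_sub_of_hasDerivAt (fun τ _ => hd τ) hint]
  have e : ∑ k ∈ Finset.range (m + 1), F k s * (s - s) ^ k / k.factorial = F 0 s := by
    rw [Finset.sum_range_succ']
    simp
  rw [e]
  simp

/-- Bounds for a polynomial of degree at most `m` in one variable on `[-L, L]`, and for its
derivative at the origin, by its values on `[0, 1]`. -/
theorem exists_polynomial_bound (m : ℕ) (L : ℝ) : ∃ C : ℝ, 0 ≤ C ∧ ∀ (p : Polynomial ℝ) (A : ℝ),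
    p.natDegree ≤ m → (∀ s ∈ Set.Icc (0 : ℝ) 1, |p.eval s| ≤ A) →
      (∀ s ∈ Set.Icc (-L) L, |p.eval s| ≤ C * A) ∧ |p.derivative.eval 0| ≤ C * A := by
  classical
  set x : ℕ → ℝ := fun j => j / (m + 1) with hx
  set S := Finset.range (m + 1) with hS
  have hinj : Set.InjOn x S := by
    intro i _ j _ hij
    have : (m + 1 : ℝ) ≠ 0 := by positivity
    simp only [hx] at hij
    field_simp at hij
    exact_mod_cast hij
  have hx01 : ∀ j ∈ S, x j ∈ Set.Icc (0 : ℝ) 1 := by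
    intro j hj
    have : (j : ℝ) ≤ m + 1 := by exact_mod_cast (Finset.mem_range.1 hj).le
    exact ⟨by positivity, (div_le_one (by positivity)).2 this⟩
  have hbd : ∀ j, ∃ c, ∀ s ∈ Set.Icc (-L) L, ‖(Lagrange.basis S x j).eval s‖ ≤ c := fun j =>
    isCompact_Icc.exists_bound_of_continuousOn (Polynomial.continuous _).continuousOn
  choose c hc using hbd
  have hrep : ∀ p : Polynomial ℝ, p.natDegree ≤ m →
      p = ∑ j ∈ S, Polynomial.C (p.eval (x j)) * Lagrange.basis S x j := by
    intro p hp
    have hlt : p.degree < S.card := by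
      rw [hS, Finset.card_range]
      exact Polynomial.degree_le_natDegree.trans_lt
        (by exact_mod_cast Nat.lt_succ_of_le hp)
    conv_lhs => rw [Lagrange.eq_interpolate hinj hlt, Lagrange.interpolate_apply]
  refine ⟨∑ j ∈ S, (|c j| + |(Lagrange.basis S x j).derivative.eval 0|),
    Finset.sum_nonneg fun _ _ => by positivity, fun p A hp hA => ⟨fun s hs => ?_, ?_⟩⟩
  · conv_lhs => rw [hrep p hp]
    rw [Polynomial.eval_finsetSum]
    refine (Finset.abs_sum_le_sum_abs _ _).trans ?_
    rw [Finset.sum_mul]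
    refine Finset.sum_le_sum fun j hj => ?_
    rw [Polynomial.eval_mul, Polynomial.eval_C, abs_mul, mul_comm]
    have h1 := hA _ (hx01 j hj)
    have h2 : |(Lagrange.basis S x j).eval s| ≤ |c j| := (hc j s hs).trans (le_abs_self _)
    exact mul_le_mul (h2.trans (le_add_of_nonneg_right (abs_nonneg _))) h1 (abs_nonneg _)
      (by positivity)
  · conv_lhs => rw [hrep p hp]
    rw [Polynomial.derivative_sum, Polynomial.eval_finsetSum]
    refine (Finset.abs_sum_le_sum_abs _ _).trans ?_
    rw [Finset.sum_mul]
    refine Finset.sum_le_sum fun j hj => ?_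
    rw [Polynomial.derivative_C_mul, Polynomial.eval_mul, Polynomial.eval_C, abs_mul, mul_comm]
    exact mul_le_mul (le_add_of_nonneg_left (abs_nonneg _)) (hA _ (hx01 j hj)) (abs_nonneg _)
      (by positivity)

/-- The derivative at an end point of `[0, 1]` is controlled by the function and by the integral
of its derivative of order `m + 1`. -/
theorem exists_deriv_bound (m : ℕ) (hm : 1 ≤ m) : ∃ C : ℝ, 0 ≤ C ∧ ∀ (F : ℕ → ℝ → ℝ) (S : ℝ),
    (∀ k s, HasDerivAt (F k) (F (k + 1) s) s) → (∀ s ∈ Set.Icc (0 : ℝ) 1, |F 0 s| ≤ S) →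
      |F 1 0| ≤ C * (S + ∫ τ in (0 : ℝ)..1, |F (m + 1) τ|) := by
  obtain ⟨C, hC0, hC⟩ := exists_polynomial_bound m 0
  refine ⟨C, hC0, fun F S hF hS => ?_⟩
  have hc : ∀ k, Continuous (F k) := fun k =>
    continuous_iff_continuousAt.2 fun s => (hF k s).continuousAt
  set p : Polynomial ℝ := ∑ k ∈ Finset.range (m + 1),
    Polynomial.monomial k (F k 0 / k.factorial) with hp
  have hdeg : p.natDegree ≤ m := by
    refine Polynomial.natDegree_sum_le_of_forall_le _ _ fun k hk => ?_
    exact (Polynomial.natDegree_monomial_le _).trans (Nat.lt_succ_iff.1 (Finset.mem_range.1 hk))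
  have hev : ∀ s, p.eval s = ∑ k ∈ Finset.range (m + 1), F k 0 * s ^ k / k.factorial := by
    intro s
    rw [hp, Polynomial.eval_finsetSum]
    exact Finset.sum_congr rfl fun k _ => by rw [Polynomial.eval_monomial]; ring
  have hder : p.derivative.eval 0 = F 1 0 := by
    rw [← Polynomial.coeff_zero_eq_eval_zero, Polynomial.coeff_derivative, hp,
      Polynomial.finsetSum_coeff, Finset.sum_eq_single 1]
    · simp
    · intro k _ hk
      simp [Polynomial.coeff_monomial, hk]
    · intro h
      exact absurd (Finset.mem_range.2 (by omega)) h
  rw [← hder]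
  refine (hC p _ hdeg fun s hs => ?_).2
  have ht := taylor_of_hasDerivAt m F hF s
  rw [← hev] at ht
  have h1 : p.eval s = F 0 s - ∫ τ in (0 : ℝ)..s, (s - τ) ^ m / m.factorial * F (m + 1) τ := by
    linarith
  rw [h1]
  refine (abs_sub _ _).trans (add_le_add (hS s hs) ?_)
  calc |∫ τ in (0 : ℝ)..s, (s - τ) ^ m / m.factorial * F (m + 1) τ|
      ≤ ∫ τ in (0 : ℝ)..s, |F (m + 1) τ| := by
        rw [← Real.norm_eq_abs]
        refine intervalIntegral.norm_integral_le_of_norm_le (μ := MeasureTheory.volume) hs.1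
          (Filter.Eventually.of_forall ?_)
          ((hc _).abs.intervalIntegrable _ _)
        intro τ hτ
        rw [Real.norm_eq_abs, abs_mul]
        refine mul_le_of_le_one_left (abs_nonneg _) ?_
        rw [abs_div, abs_pow, Nat.abs_cast, abs_of_nonneg (by linarith [hτ.2])]
        refine div_le_one_of_le₀ ?_ (by positivity)
        refine (pow_le_one₀ (by linarith [hτ.2]) (by linarith [hτ.1, hs.2])).trans ?_
        exact_mod_cast Nat.one_le_iff_ne_zero.2 (Nat.factorial_ne_zero m)
    _ ≤ ∫ τ in (0 : ℝ)..1, |F (m + 1) τ| := by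
        refine intervalIntegral.integral_mono_interval le_rfl hs.1 hs.2 ?_
          ((hc _).abs.intervalIntegrable _ _)
        exact Filter.Eventually.of_forall fun _ => abs_nonneg _

/-- The Cauchy-Schwarz inequality on the unit interval. -/
theorem sq_integral_le {f : ℝ → ℝ} (hf : Continuous f) :
    (∫ s in (0 : ℝ)..1, f s) ^ 2 ≤ ∫ s in (0 : ℝ)..1, f s ^ 2 := by
  set c := ∫ s in (0 : ℝ)..1, f s with hcdef
  have h0 : 0 ≤ ∫ s in (0 : ℝ)..1, (f s - c) ^ 2 :=
    intervalIntegral.integral_nonneg zero_le_one fun _ _ => sq_nonneg _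
  have e : ∫ s in (0 : ℝ)..1, (f s - c) ^ 2 =
      (∫ s in (0 : ℝ)..1, f s ^ 2) - c ^ 2 := by
    have : ∀ s, (f s - c) ^ 2 = f s ^ 2 - (2 * c) * f s + c ^ 2 := fun s => by ring
    simp_rw [this]
    rw [intervalIntegral.integral_add, intervalIntegral.integral_sub,
      intervalIntegral.integral_const_mul, ← hcdef]
    · simp; ring
    all_goals exact Continuous.intervalIntegrable (by fun_prop) _ _
  linarith

/-! ### Averaged Taylor polynomials -/

/-- The homogeneous part of degree `k` of the Taylor polynomial of `v` at `y`. -/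
def taylorPart (k : ℕ) (v : Plane → ℝ) (y : Plane) : MvPolynomial (Fin 2) ℝ :=
  ∑ ij ∈ Finset.HasAntidiagonal.antidiagonal k,
    MvPolynomial.C (mixedDeriv ij.1 ij.2 v y / (ij.1.factorial * ij.2.factorial)) *
      ((MvPolynomial.X 0 - MvPolynomial.C (y 0)) ^ ij.1 *
        (MvPolynomial.X 1 - MvPolynomial.C (y 1)) ^ ij.2)

/-- The Taylor polynomial of degree `m` of `v` at `y`. -/
def taylorPoly (m : ℕ) (v : Plane → ℝ) (y : Plane) : MvPolynomial (Fin 2) ℝ :=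
  ∑ k ∈ Finset.range (m + 1), taylorPart k v y

theorem taylorPoly_mem_restrictTotalDegree (m : ℕ) (v : Plane → ℝ) (y : Plane) :
    taylorPoly m v y ∈ MvPolynomial.restrictTotalDegree (Fin 2) ℝ m := by
  refine Submodule.sum_mem _ fun k hk => Submodule.sum_mem _ fun ij hij => ?_
  rw [MvPolynomial.mem_restrictTotalDegree]
  have hX : ∀ (i : Fin 2) (c : ℝ), (MvPolynomial.X i - MvPolynomial.C c).totalDegree ≤ 1 :=
    fun i c => (MvPolynomial.totalDegree_sub_C_le _ _).trans (MvPolynomial.totalDegree_X i).le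
  refine (MvPolynomial.totalDegree_mul _ _).trans ?_
  rw [MvPolynomial.totalDegree_C, zero_add]
  refine (MvPolynomial.totalDegree_mul _ _).trans ?_
  have h1 := (MvPolynomial.totalDegree_pow (MvPolynomial.X 0 - MvPolynomial.C (y 0)) ij.1).trans
    (Nat.mul_le_mul_left _ (hX 0 (y 0)))
  have h2 := (MvPolynomial.totalDegree_pow (MvPolynomial.X 1 - MvPolynomial.C (y 1)) ij.2).trans
    (Nat.mul_le_mul_left _ (hX 1 (y 1)))
  have h3 := Finset.HasAntidiagonal.mem_antidiagonal.1 hij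
  have h4 := Finset.mem_range.1 hk
  omega

theorem pderiv_zero_taylorPart (k : ℕ) {v : Plane → ℝ} (h : ContDiff ℝ ∞ v) (y : Plane) :
    MvPolynomial.pderiv 0 (taylorPart (k + 1) v y) = taylorPart k (pderivFun 0 v) y := by
  rw [taylorPart, Finset.Nat.sum_antidiagonal_succ, map_add, map_sum, taylorPart]
  have h0 : MvPolynomial.pderiv (0 : Fin 2)
      (MvPolynomial.X 1 - MvPolynomial.C (y 1) : MvPolynomial (Fin 2) ℝ) = 0 := by
    rw [map_sub, MvPolynomial.pderiv_X_of_ne (by decide), MvPolynomial.pderiv_C, sub_zero]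
  have h1 : MvPolynomial.pderiv (0 : Fin 2)
      (MvPolynomial.X 0 - MvPolynomial.C (y 0) : MvPolynomial (Fin 2) ℝ) = 1 := by
    rw [map_sub, MvPolynomial.pderiv_X_self, MvPolynomial.pderiv_C, sub_zero]
  have hb : ∀ j : ℕ, MvPolynomial.pderiv (0 : Fin 2)
      ((MvPolynomial.X 1 - MvPolynomial.C (y 1) : MvPolynomial (Fin 2) ℝ) ^ j) = 0 := by
    intro j; rw [MvPolynomial.pderiv_pow, h0, mul_zero]
  rw [pow_zero, one_mul, MvPolynomial.pderiv_C_mul, hb, mul_zero, zero_add]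
  refine Finset.sum_congr rfl fun ij _ => ?_
  rw [MvPolynomial.pderiv_C_mul, MvPolynomial.pderiv_mul, hb, mul_zero, add_zero,
    MvPolynomial.pderiv_pow, h1, mul_one, Nat.add_sub_cancel, mixedDeriv_pderivFun_zero _ _ h]
  have h2 : (ij.1.factorial : ℝ) ≠ 0 := by positivity
  have h3 : (ij.2.factorial : ℝ) ≠ 0 := by positivity
  have h4 : (ij.1 + 1 : ℝ) ≠ 0 := by positivity
  have e : mixedDeriv ij.1 ij.2 (pderivFun 0 v) y / (ij.1.factorial * ij.2.factorial) =
      mixedDeriv (ij.1 + 1) ij.2 v y / ((ij.1 + 1).factorial * ij.2.factorial) *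
        ((ij.1 + 1 : ℕ) : ℝ) := by
    rw [mixedDeriv_pderivFun_zero _ _ h, Nat.factorial_succ]
    push_cast
    field_simp
  rw [mixedDeriv_pderivFun_zero _ _ h] at e
  rw [e, MvPolynomial.C_mul, map_natCast]
  ring

theorem pderiv_one_taylorPart (k : ℕ) (v : Plane → ℝ) (y : Plane) :
    MvPolynomial.pderiv 1 (taylorPart (k + 1) v y) = taylorPart k (pderivFun 1 v) y := by
  rw [taylorPart, Finset.Nat.sum_antidiagonal_succ', map_add, map_sum, taylorPart]
  have h0 : MvPolynomial.pderiv (1 : Fin 2)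
      (MvPolynomial.X 0 - MvPolynomial.C (y 0) : MvPolynomial (Fin 2) ℝ) = 0 := by
    rw [map_sub, MvPolynomial.pderiv_X_of_ne (by decide), MvPolynomial.pderiv_C, sub_zero]
  have h1 : MvPolynomial.pderiv (1 : Fin 2)
      (MvPolynomial.X 1 - MvPolynomial.C (y 1) : MvPolynomial (Fin 2) ℝ) = 1 := by
    rw [map_sub, MvPolynomial.pderiv_X_self, MvPolynomial.pderiv_C, sub_zero]
  have hb : ∀ j : ℕ, MvPolynomial.pderiv (1 : Fin 2)
      ((MvPolynomial.X 0 - MvPolynomial.C (y 0) : MvPolynomial (Fin 2) ℝ) ^ j) = 0 := by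
    intro j; rw [MvPolynomial.pderiv_pow, h0, mul_zero]
  rw [pow_zero, mul_one, MvPolynomial.pderiv_C_mul, hb, mul_zero, zero_add]
  refine Finset.sum_congr rfl fun ij _ => ?_
  rw [MvPolynomial.pderiv_C_mul, MvPolynomial.pderiv_mul, hb, zero_mul, zero_add,
    MvPolynomial.pderiv_pow, h1, mul_one, Nat.add_sub_cancel]
  have h2 : (ij.1.factorial : ℝ) ≠ 0 := by positivity
  have h3 : (ij.2.factorial : ℝ) ≠ 0 := by positivity
  have h4 : (ij.2 + 1 : ℝ) ≠ 0 := by positivity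
  have e : mixedDeriv ij.1 ij.2 (pderivFun 1 v) y / (ij.1.factorial * ij.2.factorial) =
      mixedDeriv ij.1 (ij.2 + 1) v y / (ij.1.factorial * (ij.2 + 1).factorial) *
        ((ij.2 + 1 : ℕ) : ℝ) := by
    rw [mixedDeriv_pderivFun_one, Nat.factorial_succ]
    push_cast
    field_simp
  rw [e, MvPolynomial.C_mul, map_natCast]
  ring

theorem pderiv_taylorPart_zero (i : Fin 2) (v : Plane → ℝ) (y : Plane) :
    MvPolynomial.pderiv i (taylorPart 0 v y) = 0 := by
  simp [taylorPart]

/-- The Taylor polynomials of a field whose divergence vanishes near `y` are solenoidal. -/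
theorem taylorPoly_mem_solenoidal (m : ℕ) {v : Fin 2 → Plane → ℝ} (h : ∀ i, ContDiff ℝ ∞ (v i))
    {y : Plane} (hdiv : ∀ᶠ x in 𝓝 y, pderivFun 0 (v 0) x + pderivFun 1 (v 1) x = 0) :
    (fun i => taylorPoly m (v i) y) ∈ solenoidal m := by
  refine ⟨fun i => taylorPoly_mem_restrictTotalDegree m _ _, ?_⟩
  have hs0 := contDiff_pderivFun 0 (h 0)
  have hs1 := contDiff_pderivFun 1 (h 1)
  have hloc : ∀ a b {f : Plane → ℝ}, ContDiff ℝ ∞ f → (∀ᶠ x in 𝓝 y, f x = 0) →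
      ∀ᶠ x in 𝓝 y, mixedDeriv a b f x = 0 := by
    intro a b f hf h0
    have hstep : ∀ (i : Fin 2) {g : Plane → ℝ}, (∀ᶠ x in 𝓝 y, g x = 0) →
        ∀ᶠ x in 𝓝 y, pderivFun i g x = 0 := by
      intro i g hg
      filter_upwards [hg.eventually_nhds] with x hx
      have : g =ᶠ[𝓝 x] fun _ => 0 := hx
      simp [pderivFun, this.fderiv_eq]
    induction a with
    | zero =>
      induction b with
      | zero => exact h0
      | succ b ih => rw [mixedDeriv_add_one_right _ _ hf]; exact hstep 1 ih
    | succ a ih => rw [mixedDeriv_add_one_left]; exact hstep 0 ih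
  have hz : ∀ a b, mixedDeriv a b (pderivFun 0 (v 0)) y + mixedDeriv a b (pderivFun 1 (v 1)) y
      = 0 := by
    intro a b
    have := (hloc a b (hs0.add hs1) hdiv).self_of_nhds
    rwa [mixedDeriv_add a b hs0 hs1] at this
  simp only [taylorPoly, map_sum]
  rw [Finset.sum_range_succ', Finset.sum_range_succ' (fun k => MvPolynomial.pderiv 1 _)]
  simp only [pderiv_taylorPart_zero, add_zero, pderiv_zero_taylorPart _ (h 0),
    pderiv_one_taylorPart]
  rw [← Finset.sum_add_distrib]
  refine Finset.sum_eq_zero fun k _ => ?_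
  rw [taylorPart, taylorPart, ← Finset.sum_add_distrib]
  refine Finset.sum_eq_zero fun ij _ => ?_
  rw [← add_mul, ← map_add, ← add_div, hz, zero_div, map_zero, zero_mul]

theorem eval_taylorPart (k : ℕ) (v : Plane → ℝ) (y x : Plane) :
    MvPolynomial.eval (fun j => x j) (taylorPart k v y) =
      dirDeriv k (x - y) v y / k.factorial := by
  rw [taylorPart, map_sum, dirDeriv, Finset.sum_div]
  refine Finset.sum_congr rfl fun ij hij => ?_
  have hk := Finset.HasAntidiagonal.mem_antidiagonal.1 hij
  have h2 : (ij.1.factorial : ℝ) ≠ 0 := by positivity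
  have h3 : (ij.2.factorial : ℝ) ≠ 0 := by positivity
  have h4 : (k.factorial : ℝ) ≠ 0 := by positivity
  have hc : (k.choose ij.1 : ℝ) * (ij.1.factorial * ij.2.factorial) = k.factorial := by
    rw [← hk, ← mul_assoc]
    rw [Nat.choose_symm_add]
    exact_mod_cast Nat.add_choose_mul_factorial_mul_factorial ij.1 ij.2
  rw [← hc] at h4 ⊢
  have h5 : (k.choose ij.1 : ℝ) ≠ 0 := left_ne_zero_of_mul h4
  simp
  field_simp

theorem eval_taylorPoly (m : ℕ) (v : Plane → ℝ) (y x : Plane) :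
    MvPolynomial.eval (fun j => x j) (taylorPoly m v y) =
      ∑ k ∈ Finset.range (m + 1), dirDeriv k (x - y) v y / k.factorial := by
  rw [taylorPoly, map_sum]
  exact Finset.sum_congr rfl fun k _ => eval_taylorPart k v y x

theorem continuous_dirDeriv (k : ℕ) {v : Plane → ℝ} (h : ContDiff ℝ ∞ v) :
    Continuous fun p : Plane × Plane => dirDeriv k p.1 v p.2 := by
  unfold dirDeriv
  refine continuous_finsetSum _ fun ij _ => ?_
  have := continuous_mixedDeriv ij.1 ij.2 h
  fun_prop

theorem continuous_eval_taylorPoly (m : ℕ) {v : Plane → ℝ} (h : ContDiff ℝ ∞ v) :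
    Continuous fun p : Plane × Plane =>
      MvPolynomial.eval (fun j => p.2 j) (taylorPoly m v p.1) := by
  simp_rw [eval_taylorPoly]
  refine continuous_finsetSum _ fun k _ => Continuous.div_const ?_ _
  exact (continuous_dirDeriv k h).comp ((continuous_snd.sub continuous_fst).prodMk continuous_fst)

theorem continuous_polyField (p : Fin 2 → MvPolynomial (Fin 2) ℝ) : Continuous (polyField p) := by
  refine (PiLp.continuous_toLp 2 _).comp (continuous_pi fun i => ?_)
  exact (MvPolynomial.continuous_eval (p i)).comp (continuous_pi fun j => by fun_prop)

instance finiteDimensional_solenoidal (m : ℕ) : FiniteDimensional ℝ (solenoidal m) := by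
  let L : solenoidal m →ₗ[ℝ] (Fin 2 → MvPolynomial.restrictTotalDegree (Fin 2) ℝ m) :=
    LinearMap.pi fun i => ((LinearMap.proj i).comp (solenoidal m).subtype).codRestrict _
      fun p => p.2.1 i
  refine FiniteDimensional.of_injective L fun p q hpq => Subtype.ext (funext fun i => ?_)
  exact congrArg Subtype.val (congrFun hpq i)

theorem continuous_polyField_taylorPoly (m : ℕ) {v : Fin 2 → Plane → ℝ}
    (h : ∀ i, ContDiff ℝ ∞ (v i)) :
    Continuous fun p : Plane × Plane => polyField (fun i => taylorPoly m (v i) p.1) p.2 := by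
  have : Continuous fun p : Plane × Plane => fun i =>
      MvPolynomial.eval (fun j => p.2 j) (taylorPoly m (v i) p.1) :=
    continuous_pi fun i => continuous_eval_taylorPoly m (h i)
  exact (PiLp.continuous_toLp 2 (fun _ : Fin 2 => ℝ)).comp this

/-- Restriction of polynomial fields to `Z`, as a linear map into the continuous functions. -/
def restrictPolyField (Z : Set Plane) :
    (Fin 2 → MvPolynomial (Fin 2) ℝ) →ₗ[ℝ] C(Z, Plane) where
  toFun p := ⟨fun x => polyField p x.1, (continuous_polyField p).comp continuous_subtype_val⟩
  map_add' p q := ContinuousMap.ext fun x => congrFun (map_add polyField p q) x.1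
  map_smul' c p := ContinuousMap.ext fun x => congrFun (map_smul polyField c p) x.1

/-- The averages over `D` of the Taylor polynomials of a solenoidal field are given by a solenoidal
polynomial: the restrictions of these polynomials to a compact set form a finite-dimensional, hence
closed, subspace of the continuous functions. -/
theorem exists_average_taylorPoly (m : ℕ) {v : Fin 2 → Plane → ℝ} (h : ∀ i, ContDiff ℝ ∞ (v i))
    {D Z : Set Plane} (hD : IsOpen D) (hDb : Bornology.IsBounded D) (hDn : D.Nonempty)
    (hdiv : ∀ x ∈ D, pderivFun 0 (v 0) x + pderivFun 1 (v 1) x = 0) (hZ : IsCompact Z) :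
    ∃ q ∈ solenoidal m, ∀ x ∈ Z, ∀ i, polyField q x i =
      ⨍ y in D, MvPolynomial.eval (fun j => x j) (taylorPoly m (v i) y) := by
  have : CompactSpace Z := isCompact_iff_compactSpace.1 hZ
  let Φ : C(Plane, C(Z, Plane)) := ContinuousMap.curry
    ⟨_, (continuous_polyField_taylorPoly m h).comp
      (continuous_fst.prodMk (continuous_subtype_val.comp (continuous_snd (X := Plane) (Y := Z))))⟩
  let L := (restrictPolyField Z).comp (solenoidal m).subtype
  have hint : MeasureTheory.IntegrableOn Φ D := by
    have := hDb.isCompact_closure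
    exact (Φ.continuous.continuousOn.integrableOn_compact this).mono_set subset_closure
  have hmem : (⨍ y in D, Φ y) ∈ (LinearMap.range L : Set C(Z, Plane)) := by
    refine (LinearMap.range L).convex.set_average_mem
      (Submodule.closed_of_finiteDimensional _) (hD.measure_pos _ hDn).ne'
      hDb.measure_lt_top.ne ?_ hint
    refine (MeasureTheory.ae_restrict_iff' hD.measurableSet).2
      (Filter.Eventually.of_forall fun y hy => ?_)
    refine ⟨⟨_, taylorPoly_mem_solenoidal m h (y := y) ?_⟩, ?_⟩
    · filter_upwards [hD.mem_nhds hy] with x hx using hdiv x hx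
    · ext x : 1; rfl
  obtain ⟨q, hq⟩ := hmem
  refine ⟨q.1, q.2, fun x hx i => ?_⟩
  have h1 : polyField q.1 x = (⨍ y in D, Φ y) ⟨x, hx⟩ := by
    rw [← hq]; rfl
  let E : C(Z, Plane) →L[ℝ] ℝ :=
    (EuclideanSpace.proj i : Plane →L[ℝ] ℝ).comp (ContinuousMap.evalCLM ℝ ⟨x, hx⟩)
  have h2 : E (⨍ y in D, Φ y) = ⨍ y in D, E (Φ y) := by
    rw [MeasureTheory.setAverage_eq, MeasureTheory.setAverage_eq, map_smul,
      ContinuousLinearMap.integral_comp_comm _ hint]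
  rw [h1]
  exact h2

/-- Integrals over a convex set and homotheties centered in it. -/
theorem lintegral_comp_homothety_le {D : Set Plane} (hD : Convex ℝ D) (hDm : MeasurableSet D)
    {x : Plane} (hx : x ∈ D) {s : ℝ} (hs : 0 < s) (hs1 : s ≤ 1) (F : Plane → ENNReal) :
    ∫⁻ y in D, F (x + s • (y - x)) ≤ ENNReal.ofReal (s ^ 2)⁻¹ * ∫⁻ y in D, F y := by
  have hmem : ∀ y ∈ D, x + s • (y - x) ∈ D := fun y hy =>
    hD.add_smul_sub_mem hx hy ⟨hs.le, hs1⟩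
  calc ∫⁻ y in D, F (x + s • (y - x))
      = ∫⁻ y in D, D.indicator F (x + s • (y - x)) := by
        refine setLIntegral_congr_fun hDm fun y hy => ?_
        simp only [Set.indicator_of_mem (hmem y hy)]
    _ ≤ ∫⁻ y, D.indicator F (x + s • (y - x)) := setLIntegral_le_lintegral _ _
    _ = ∫⁻ y, D.indicator F (x + s • y) :=
        lintegral_sub_right_eq_self (fun y => D.indicator F (x + s • y)) x
    _ = ∫⁻ z, D.indicator F (x + z) ∂(Measure.map (s • ·) volume) :=
        ((Homeomorph.smulOfNeZero s hs.ne').measurableEmbedding.lintegral_map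
          (μ := volume) (fun z => D.indicator F (x + z))).symm
    _ = ENNReal.ofReal (s ^ 2)⁻¹ * ∫⁻ y in D, F y := by
        rw [Measure.map_addHaar_smul _ hs.ne', lintegral_smul_measure,
          lintegral_add_left_eq_self, lintegral_indicator hDm]
        simp [abs_of_pos hs]

/-- Averages of `F` over the segments between the points of a convex set. Depending on whether the
point divides the segment before or after its midpoint, one substitutes for one end point or for
the other, so that the Jacobian stays bounded. -/
theorem lintegral_lintegral_segment_le {D : Set Plane} (hD : Convex ℝ D) (hDm : MeasurableSet D)
    {s : ℝ} (hs : 0 < s) (hs1 : s < 1) {F : Plane → ENNReal} (hF : Measurable F) :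
    ∫⁻ x in D, ∫⁻ y in D, F (x + s • (y - x)) ≤ 4 * volume D * ∫⁻ y in D, F y := by
  have h4 : ∀ {t : ℝ}, 1 / 2 ≤ t → ENNReal.ofReal (t ^ 2)⁻¹ ≤ 4 := by
    intro t ht
    rw [show (4 : ENNReal) = ENNReal.ofReal 4 by simp]
    refine ENNReal.ofReal_le_ofReal ?_
    rw [inv_le_comm₀ (by positivity) (by norm_num)]
    nlinarith
  have hend : ∫⁻ _ in D, 4 * ∫⁻ y in D, F y = 4 * volume D * ∫⁻ y in D, F y := by
    rw [setLIntegral_const]; ring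
  rcases le_total (1 / 2) s with h | h
  · rw [← hend]
    refine setLIntegral_mono' hDm fun x hx => ?_
    exact (lintegral_comp_homothety_le hD hDm hx hs hs1.le F).trans (by gcongr; exact h4 h)
  · rw [lintegral_lintegral_swap (by fun_prop), ← hend]
    refine setLIntegral_mono' hDm fun y hy => ?_
    have e : ∀ x, x + s • (y - x) = y + (1 - s) • (x - y) := fun x => by module
    simp_rw [e]
    exact (lintegral_comp_homothety_le hD hDm hy (by linarith) (by linarith) F).trans
      (by gcongr; exact h4 (by linarith))

theorem sq_setIntegral_le {D : Set Plane} (hDb : Bornology.IsBounded D)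
    {f : Plane → ℝ} (hf : Continuous f) :
    (∫ y in D, f y) ^ 2 ≤ volume.real D * ∫ y in D, f y ^ 2 := by
  have hint : ∀ {g : Plane → ℝ}, Continuous g → IntegrableOn g D := fun hg =>
    (hg.continuousOn.integrableOn_compact hDb.isCompact_closure).mono_set subset_closure
  rcases eq_or_ne (volume.real D) 0 with h0 | h0
  · have : volume.restrict D = 0 := by
      rw [Measure.restrict_eq_zero]
      exact (measureReal_eq_zero_iff hDb.measure_lt_top.ne).1 h0
    simp [this]
  have hpos : 0 < volume.real D := lt_of_le_of_ne measureReal_nonneg h0.symm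
  set V := volume.real D
  set c := ∫ y in D, f y with hc
  have h1 : 0 ≤ ∫ y in D, (V * f y - c) ^ 2 := integral_nonneg fun _ => sq_nonneg _
  have e : ∫ y in D, (V * f y - c) ^ 2 = V ^ 2 * (∫ y in D, f y ^ 2) - V * c ^ 2 := by
    have : ∀ y, (V * f y - c) ^ 2 = V ^ 2 * f y ^ 2 - (2 * V * c) * f y + c ^ 2 := fun y => by ring
    simp_rw [this]
    rw [integral_add, integral_sub, integral_const_mul, integral_const_mul, ← hc,
      setIntegral_const, smul_eq_mul]
    · ring
    all_goals exact hint (by fun_prop)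
  rw [e] at h1
  have h2 : 0 ≤ V * (V * (∫ y in D, f y ^ 2) - c ^ 2) := by linarith
  linarith [(mul_nonneg_iff_of_pos_left hpos).1 h2]

theorem integrableOn_of_continuous {D : Set Plane} (hDb : Bornology.IsBounded D)
    {f : Plane → ℝ} (hf : Continuous f) : IntegrableOn f D :=
  (hf.continuousOn.integrableOn_compact hDb.isCompact_closure).mono_set subset_closure

theorem norm_sub_le_of_mem_closedBall {D : Set Plane} {c : Plane} {R : ℝ}
    (hDR : D ⊆ Metric.closedBall c R) {x y : Plane} (hx : x ∈ D) (hy : y ∈ D) :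
    ‖x - y‖ ≤ 2 * R := by
  have h1 := Metric.mem_closedBall.1 (hDR hx)
  have h2 := Metric.mem_closedBall'.1 (hDR hy)
  rw [← dist_eq_norm]
  linarith [dist_triangle x c y]

/-- The constant in the estimates by the derivatives of order `m + 1`. -/
def derivConst (m : ℕ) (R : ℝ) : ℝ := ((m + 1 : ℕ) + 1) * 4 ^ (m + 1) * (2 * R) ^ (2 * (m + 1))

theorem derivConst_nonneg (m : ℕ) (R : ℝ) : 0 ≤ derivConst m R := by
  have : 0 ≤ (2 * R) ^ (2 * (m + 1)) := by rw [pow_mul]; positivity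
  unfold derivConst
  positivity

theorem dirDeriv_sq_le_derivConst (m : ℕ) {D : Set Plane} {c : Plane} {R : ℝ}
    (hDR : D ⊆ Metric.closedBall c R) {x y : Plane} (hx : x ∈ D) (hy : y ∈ D) (v : Plane → ℝ)
    (z : Plane) : dirDeriv (m + 1) (x - y) v z ^ 2 ≤ derivConst m R * sqDeriv (m + 1) v z := by
  refine (dirDeriv_sq_le _ _ _ _).trans ?_
  refine mul_le_mul_of_nonneg_right ?_ (sqDeriv_nonneg _ _ _)
  unfold derivConst
  gcongr
  exact norm_sub_le_of_mem_closedBall hDR hx hy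

theorem ofReal_intervalIntegral {f : ℝ → ℝ} (hf : Continuous f) (h0 : ∀ s, 0 ≤ f s) :
    ENNReal.ofReal (∫ s in (0 : ℝ)..1, f s) = ∫⁻ s in Set.Ioc (0 : ℝ) 1, ENNReal.ofReal (f s) := by
  rw [intervalIntegral.integral_of_le zero_le_one,
    ofReal_integral_eq_lintegral_ofReal (hf.integrableOn_Ioc) (Filter.Eventually.of_forall h0)]

/-- The remainder of the Taylor polynomial at `y`. -/
theorem sq_taylor_remainder_le (m : ℕ) {D : Set Plane} {c : Plane} {R : ℝ}
    (hDR : D ⊆ Metric.closedBall c R) {v : Plane → ℝ} (hv : ContDiff ℝ ∞ v) {x y : Plane}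
    (hx : x ∈ D) (hy : y ∈ D) :
    (v x - MvPolynomial.eval (fun j => x j) (taylorPoly m v y)) ^ 2 ≤
      ∫ s in (0 : ℝ)..1, derivConst m R *
        ((1 - s) ^ (2 * m) * sqDeriv (m + 1) v (x + (1 - s) • (y - x))) := by
  have hWc : Continuous (sqDeriv (m + 1) v) := continuous_sqDeriv _ hv
  have ht := taylor_of_hasDerivAt m (fun k s => dirDeriv k (x - y) v (y + s • (x - y)))
    (fun k s => hasDerivAt_dirDeriv hv k y (x - y) s) 1
  have hz : ∀ k : ℕ, Continuous fun s : ℝ => dirDeriv k (x - y) v (y + s • (x - y)) := fun k =>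
    continuous_iff_continuousAt.2 fun s => (hasDerivAt_dirDeriv hv k y (x - y) s).continuousAt
  simp only [one_smul, add_sub_cancel, dirDeriv_zero, zero_smul, add_zero, one_pow,
    mul_one, ← eval_taylorPoly] at ht
  have e : v x - MvPolynomial.eval (fun j => x j) (taylorPoly m v y) =
      ∫ s in (0 : ℝ)..1, (1 - s) ^ m / m.factorial *
      dirDeriv (m + 1) (x - y) v (y + s • (x - y)) := by
    rw [ht]; ring
  rw [e]
  refine (sq_integral_le (by have := hz (m + 1); fun_prop)).trans ?_
  refine intervalIntegral.integral_mono_on zero_le_one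
    (Continuous.intervalIntegrable (by have := hz (m + 1); fun_prop) _ _)
    (Continuous.intervalIntegrable (by fun_prop) _ _) fun s hs => ?_
  have e2 : x + (1 - s) • (y - x) = y + s • (x - y) := by module
  rw [e2, mul_pow]
  have h1 := dirDeriv_sq_le_derivConst m hDR hx hy v (y + s • (x - y))
  have h2 : ((1 - s) ^ m / m.factorial) ^ 2 ≤ (1 - s) ^ (2 * m) := by
    rw [div_pow, mul_comm 2 m, pow_mul]
    refine div_le_self (by positivity) ?_
    exact_mod_cast Nat.one_le_pow _ _ (Nat.factorial_pos m)
  have h3 : 0 ≤ (1 - s) ^ (2 * m) := by rw [pow_mul]; positivity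
  calc _ ≤ (1 - s) ^ (2 * m) * (derivConst m R * sqDeriv (m + 1) v (y + s • (x - y))) :=
        mul_le_mul h2 h1 (sq_nonneg _) h3
    _ = _ := by ring

/-- Integration of the remainder over `y` and over the segments from `y` to `x`; the weight
`(1 - s) ^ (2 * m)` compensates for the Jacobian since `1 ≤ m`. -/
theorem lintegral_lintegral_remainder_le (m : ℕ) (hm : 1 ≤ m) {D : Set Plane}
    (hDm : MeasurableSet D) (hDc : Convex ℝ D) (hDb : Bornology.IsBounded D) {K : ℝ} (hK : 0 ≤ K)
    {W : Plane → ℝ} (hWc : Continuous W) (hW0 : ∀ z, 0 ≤ W z) {x : Plane} (hx : x ∈ D) :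
    ∫⁻ y in D, ∫⁻ s in Set.Ioc (0 : ℝ) 1,
        ENNReal.ofReal (K * ((1 - s) ^ (2 * m) * W (x + (1 - s) • (y - x)))) ≤
      ENNReal.ofReal (K * ∫ y in D, W y) := by
  calc ∫⁻ y in D, ∫⁻ s in Set.Ioc (0 : ℝ) 1,
        ENNReal.ofReal (K * ((1 - s) ^ (2 * m) * W (x + (1 - s) • (y - x))))
    _ = ∫⁻ s in Set.Ioc (0 : ℝ) 1, ∫⁻ y in D,
          ENNReal.ofReal (K * ((1 - s) ^ (2 * m) * W (x + (1 - s) • (y - x)))) := by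
        rw [lintegral_lintegral_swap]
        exact (Continuous.measurable (by fun_prop)).ennreal_ofReal.aemeasurable
    _ = ∫⁻ s in Set.Ioo (0 : ℝ) 1, ∫⁻ y in D,
          ENNReal.ofReal (K * ((1 - s) ^ (2 * m) * W (x + (1 - s) • (y - x)))) := by
        rw [restrict_Ioo_eq_restrict_Ioc]
    _ ≤ ∫⁻ s in Set.Ioo (0 : ℝ) 1, ∫⁻ y in D, ENNReal.ofReal (K * W y) := by
        refine setLIntegral_mono' measurableSet_Ioo fun s hs => ?_
        have hs1 : 0 < 1 - s := by linarith [hs.2]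
        have h3 : 0 ≤ (1 - s) ^ (2 * m) := by positivity
        have e : ∀ y, ENNReal.ofReal (K * ((1 - s) ^ (2 * m) * W (x + (1 - s) • (y - x)))) =
            ENNReal.ofReal ((1 - s) ^ (2 * m)) *
              (fun z => ENNReal.ofReal (K * W z)) (x + (1 - s) • (y - x)) := by
          intro y
          rw [← ENNReal.ofReal_mul h3]
          congr 1; ring
        simp_rw [e]
        rw [lintegral_const_mul _ (Continuous.measurable (by fun_prop)).ennreal_ofReal]
        have h5 := lintegral_comp_homothety_le hDc hDm hx hs1 (by linarith [hs.1])
          (fun z => ENNReal.ofReal (K * W z))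
        refine (mul_le_mul_right h5 _).trans ?_
        rw [← mul_assoc, ← ENNReal.ofReal_mul h3]
        refine mul_le_of_le_one_left zero_le ?_
        rw [ENNReal.ofReal_le_one]
        rw [← div_eq_mul_inv, div_le_one (by positivity)]
        exact pow_le_pow_of_le_one hs1.le (by linarith [hs.1]) (by omega)
    _ = ENNReal.ofReal (K * ∫ y in D, W y) := by
        rw [setLIntegral_const, Real.volume_Ioo, ← integral_const_mul,
          ofReal_integral_eq_lintegral_ofReal
            (integrableOn_of_continuous hDb (by fun_prop)).integrable
            (Filter.Eventually.of_forall fun y => mul_nonneg hK (hW0 y))]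
        simp

theorem continuous_eval_taylorPoly_left (m : ℕ) {v : Plane → ℝ} (h : ContDiff ℝ ∞ v) (x : Plane) :
    Continuous fun y : Plane => MvPolynomial.eval (fun j => x j) (taylorPoly m v y) := by
  simp_rw [eval_taylorPoly]
  refine continuous_finsetSum _ fun k _ => Continuous.div_const ?_ _
  have h1 : Continuous fun y : Plane => (x - y, y) := by fun_prop
  exact (continuous_dirDeriv k h).comp h1

theorem sq_sub_average_le {D : Set Plane} (hDb : Bornology.IsBounded D)
    (hDpos : 0 < volume.real D) {T : Plane → ℝ} (hT : Continuous T) {a B : ℝ} (hB : 0 ≤ B)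
    (h : ∫⁻ y in D, ENNReal.ofReal ((a - T y) ^ 2) ≤ ENNReal.ofReal B) :
    volume.real D * (a - ⨍ y in D, T y) ^ 2 ≤ B := by
  rw [← ofReal_integral_eq_lintegral_ofReal
    (integrableOn_of_continuous hDb (by fun_prop)).integrable
    (Filter.Eventually.of_forall fun y => sq_nonneg _)] at h
  have h' := (ENNReal.ofReal_le_ofReal_iff hB).1 h
  have hmean : volume.real D * (a - ⨍ y in D, T y) = ∫ y in D, (a - T y) := by
    rw [integral_sub (integrableOn_of_continuous hDb continuous_const).integrable
      (integrableOn_of_continuous hDb hT).integrable, setAverage_eq, setIntegral_const,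
      smul_eq_mul, smul_eq_mul]
    field_simp
  have hcs := sq_setIntegral_le hDb (f := fun y => a - T y) (by fun_prop)
  rw [← hmean, mul_pow, sq (volume.real D), mul_assoc] at hcs
  exact (le_of_mul_le_mul_left hcs hDpos).trans h'

/-- For a smooth function, the mean over `y ∈ D` of the Taylor polynomials at `y` is a good
approximation in the maximum norm. -/
theorem sq_sub_average_taylorPoly_le (m : ℕ) (hm : 1 ≤ m) {D : Set Plane} (hDo : IsOpen D)
    (hDc : Convex ℝ D) {c : Plane} {R : ℝ} (hDR : D ⊆ Metric.closedBall c R) {v : Plane → ℝ}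
    (hv : ContDiff ℝ ∞ v) {x : Plane} (hx : x ∈ D) :
    volume.real D * (v x - ⨍ y in D, MvPolynomial.eval (fun j => x j) (taylorPoly m v y)) ^ 2 ≤
      derivConst m R * ∫ y in D, sqDeriv (m + 1) v y := by
  have hDb : Bornology.IsBounded D := Metric.isBounded_closedBall.subset hDR
  have hDm := hDo.measurableSet
  have hDpos : 0 < volume.real D :=
    ENNReal.toReal_pos (hDo.measure_pos _ ⟨x, hx⟩).ne' hDb.measure_lt_top.ne
  have hK : 0 ≤ derivConst m R := derivConst_nonneg m R
  have hWc : Continuous (sqDeriv (m + 1) v) := continuous_sqDeriv _ hv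
  have hW0 : ∀ z, 0 ≤ sqDeriv (m + 1) v z := sqDeriv_nonneg _ _
  have hTc : Continuous fun y => MvPolynomial.eval (fun j => x j) (taylorPoly m v y) :=
    continuous_eval_taylorPoly_left m hv x
  refine sq_sub_average_le hDb hDpos hTc (mul_nonneg hK (integral_nonneg fun y => hW0 y)) ?_
  refine le_trans (setLIntegral_mono' hDm fun y hy => ?_)
    (lintegral_lintegral_remainder_le m hm hDm hDc hDb hK hWc hW0 hx)
  rw [← ofReal_intervalIntegral (by fun_prop)]
  · exact ENNReal.ofReal_le_ofReal (sq_taylor_remainder_le m hDR hv hx hy)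
  · intro s
    have h3 : 0 ≤ (1 - s) ^ (2 * m) := by rw [pow_mul]; positivity
    have := hW0 (x + (1 - s) • (y - x))
    positivity

/-- Approximation of a smooth solenoidal field on a convex set by a solenoidal polynomial. -/
theorem exists_solenoidal_approx_smooth (m : ℕ) (hm : 1 ≤ m) {D : Set Plane} (hDo : IsOpen D)
    (hDn : D.Nonempty) (hDc : Convex ℝ D) {c : Plane} {R : ℝ} (hDR : D ⊆ Metric.closedBall c R)
    {v : Fin 2 → Plane → ℝ} (hv : ∀ i, ContDiff ℝ ∞ (v i))
    (hdiv : ∀ x ∈ D, pderivFun 0 (v 0) x + pderivFun 1 (v 1) x = 0) :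
    ∃ q ∈ solenoidal m, ∀ x ∈ D, ∀ i, volume.real D * (v i x - polyField q x i) ^ 2 ≤
      derivConst m R * ∫ y in D, sqDeriv (m + 1) (v i) y := by
  have hDb : Bornology.IsBounded D := Metric.isBounded_closedBall.subset hDR
  obtain ⟨q, hq, hqe⟩ := exists_average_taylorPoly m hv hDo hDb hDn hdiv hDb.isCompact_closure
  refine ⟨q, hq, fun x hx i => ?_⟩
  rw [hqe x (subset_closure hx) i]
  exact sq_sub_average_taylorPoly_le m hm hDo hDc hDR (hv i) hx

/-! ### An interpolation inequality for smooth functions -/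

theorem dirDeriv_one (ξ : Plane) (w : Plane → ℝ) (x : Plane) :
    dirDeriv 1 ξ w x = ξ 0 * pderivFun 0 w x + ξ 1 * pderivFun 1 w x := by
  have : Finset.HasAntidiagonal.antidiagonal 1 = {((0 : ℕ), (1 : ℕ)), (1, 0)} := by decide
  rw [dirDeriv, this, Finset.sum_pair (by decide)]
  simp [mixedDeriv]
  ring

theorem dirDeriv_one_sub (ξ η : Plane) (i : Fin 2) (τ : ℝ) (w : Plane → ℝ) (x : Plane)
    (h : ξ - η = τ • EuclideanSpace.single i 1) :
    dirDeriv 1 ξ w x - dirDeriv 1 η w x = τ * pderivFun i w x := by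
  have h0 : ξ 0 - η 0 = τ * (EuclideanSpace.single i (1 : ℝ) : Plane) 0 := congrArg (· 0) h
  have h1 : ξ 1 - η 1 = τ * (EuclideanSpace.single i (1 : ℝ) : Plane) 1 := congrArg (· 1) h
  rw [dirDeriv_one, dirDeriv_one]
  have : ξ 0 * pderivFun 0 w x + ξ 1 * pderivFun 1 w x -
      (η 0 * pderivFun 0 w x + η 1 * pderivFun 1 w x) =
      (ξ 0 - η 0) * pderivFun 0 w x + (ξ 1 - η 1) * pderivFun 1 w x := by ring
  rw [this, h0, h1]
  fin_cases i <;> simp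

/-- The bound for the first derivatives along segments. -/
theorem exists_sq_dirDeriv_one_le (m : ℕ) (hm : 1 ≤ m) : ∃ C : ℝ, 0 ≤ C ∧
    ∀ {D : Set Plane} {c : Plane} {R S : ℝ} {w : Plane → ℝ}, Convex ℝ D →
      D ⊆ Metric.closedBall c R → ContDiff ℝ ∞ w → (∀ x ∈ D, |w x| ≤ S) → ∀ x ∈ D, ∀ y ∈ D,
        dirDeriv 1 (y - x) w x ^ 2 ≤ C * (S ^ 2 + derivConst m R *
          ∫ s in (0 : ℝ)..1, sqDeriv (m + 1) w (x + s • (y - x))) := by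
  obtain ⟨C, hC0, hC⟩ := exists_deriv_bound m hm
  refine ⟨2 * C ^ 2, by positivity, fun {D c R S w} hDc hDR hw hS x hx y hy => ?_⟩
  have hS0 : 0 ≤ S := (abs_nonneg _).trans (hS x hx)
  have hWc := continuous_sqDeriv (m + 1) hw
  have hz : ∀ k : ℕ, Continuous fun s : ℝ => dirDeriv k (y - x) w (x + s • (y - x)) := fun k =>
    continuous_iff_continuousAt.2 fun s => (hasDerivAt_dirDeriv hw k x (y - x) s).continuousAt
  have h1 := hC (fun k s => dirDeriv k (y - x) w (x + s • (y - x))) S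
    (fun k s => hasDerivAt_dirDeriv hw k x (y - x) s) (fun s hs => by
      simp only [dirDeriv_zero]
      exact hS _ (hDc.add_smul_sub_mem hx hy hs))
  simp only [zero_smul, add_zero] at h1
  set I := ∫ τ in (0 : ℝ)..1, |dirDeriv (m + 1) (y - x) w (x + τ • (y - x))| with hI
  have hI2 : I ^ 2 ≤ derivConst m R * ∫ s in (0 : ℝ)..1,
      sqDeriv (m + 1) w (x + s • (y - x)) := by
    refine (sq_integral_le (hz (m + 1)).abs).trans ?_
    rw [← intervalIntegral.integral_const_mul]
    refine intervalIntegral.integral_mono_on zero_le_one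
      (Continuous.intervalIntegrable (by have := hz (m + 1); fun_prop) _ _)
      (Continuous.intervalIntegrable (by fun_prop) _ _) fun s _ => ?_
    rw [sq_abs]
    exact dirDeriv_sq_le_derivConst m hDR hy hx w _
  calc dirDeriv 1 (y - x) w x ^ 2 = |dirDeriv 1 (y - x) w x| ^ 2 := (sq_abs _).symm
    _ ≤ (C * (S + I)) ^ 2 := by gcongr
    _ = C ^ 2 * (S + I) ^ 2 := by ring
    _ ≤ C ^ 2 * (2 * (S ^ 2 + I ^ 2)) := by
        have : (S + I) ^ 2 ≤ 2 * (S ^ 2 + I ^ 2) := by nlinarith [sq_nonneg (S - I)]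
        gcongr
    _ ≤ C ^ 2 * (2 * (S ^ 2 + derivConst m R * ∫ s in (0 : ℝ)..1,
          sqDeriv (m + 1) w (x + s • (y - x)))) := by gcongr
    _ = _ := by ring

/-- A partial derivative at `x` is a difference quotient, in `y`, of the derivative at `x` in the
direction of `y`; it is bounded by a mean value over `y`. -/
theorem mul_pderivFun_sq_le {D : Set Plane} {c : Plane} {r : ℝ} (hr : 0 < r)
    (hrD : Metric.ball c r ⊆ D) (w : Plane → ℝ) (x : Plane) (i : Fin 2) {Ψ : Plane → ENNReal}
    (hΨ : Measurable Ψ)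
    (h : ∀ y ∈ D, ENNReal.ofReal (dirDeriv 1 (y - x) w x ^ 2) ≤ Ψ y) :
    volume (Metric.ball c (r / 2)) * ENNReal.ofReal ((r / 2 * pderivFun i w x) ^ 2) ≤
      4 * ∫⁻ y in D, Ψ y := by
  set e : Plane := (r / 2) • EuclideanSpace.single i (1 : ℝ) with he
  have hen : ‖e‖ = r / 2 := by
    rw [he, norm_smul, PiLp.norm_single, norm_one, mul_one, Real.norm_eq_abs,
      abs_of_pos (by positivity)]
  set B := Metric.ball c (r / 2)
  have hB : B ⊆ D := (Metric.ball_subset_ball (by linarith)).trans hrD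
  have hBe : ∀ y ∈ B, y + e ∈ D := by
    intro y hy
    refine hrD (Metric.mem_ball.2 ?_)
    have h1 := Metric.mem_ball.1 hy
    have h2 : dist (y + e) y = r / 2 := by rw [dist_eq_norm, add_sub_cancel_left, hen]
    linarith [dist_triangle (y + e) y c]
  have hpt : ∀ y ∈ B, ENNReal.ofReal ((r / 2 * pderivFun i w x) ^ 2) ≤
      2 * Ψ (y + e) + 2 * Ψ y := by
    intro y hy
    have h1 := h _ (hBe y hy)
    have h2 := h _ (hB hy)
    rw [← dirDeriv_one_sub (y + e - x) (y - x) i (r / 2) w x (by rw [← he]; module)]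
    have h3 : (dirDeriv 1 (y + e - x) w x - dirDeriv 1 (y - x) w x) ^ 2 ≤
        2 * dirDeriv 1 (y + e - x) w x ^ 2 + 2 * dirDeriv 1 (y - x) w x ^ 2 := by
      nlinarith [sq_nonneg (dirDeriv 1 (y + e - x) w x + dirDeriv 1 (y - x) w x)]
    refine (ENNReal.ofReal_le_ofReal h3).trans ?_
    rw [ENNReal.ofReal_add (by positivity) (by positivity), ENNReal.ofReal_mul zero_le_two,
      ENNReal.ofReal_mul zero_le_two, ENNReal.ofReal_ofNat]
    gcongr
  have hBm : MeasurableSet B := Metric.isOpen_ball.measurableSet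
  have hshift : ∫⁻ y in B, Ψ (y + e) ≤ ∫⁻ y in D, Ψ y := by
    have hpre : ∫⁻ y in B, Ψ (y + e) = ∫⁻ y, ((fun z => z - e) ⁻¹' B).indicator Ψ (y + e) := by
      rw [← lintegral_indicator hBm]
      congr 1
      ext y
      by_cases hy : y ∈ B
      · rw [Set.indicator_of_mem hy, Set.indicator_of_mem (by simpa using hy)]
      · rw [Set.indicator_of_notMem hy, Set.indicator_of_notMem (by simpa using hy)]
    rw [hpre, lintegral_add_right_eq_self (fun y => ((fun z => z - e) ⁻¹' B).indicator Ψ y) e,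
      lintegral_indicator (hBm.preimage (by fun_prop))]
    refine lintegral_mono_set fun z hz => ?_
    have := hBe _ hz
    rwa [sub_add_cancel] at this
  calc volume B * ENNReal.ofReal ((r / 2 * pderivFun i w x) ^ 2)
      = ∫⁻ _ in B, ENNReal.ofReal ((r / 2 * pderivFun i w x) ^ 2) := by
        rw [setLIntegral_const, mul_comm]
    _ ≤ ∫⁻ y in B, (2 * Ψ (y + e) + 2 * Ψ y) := setLIntegral_mono' hBm hpt
    _ = 2 * (∫⁻ y in B, Ψ (y + e)) + 2 * ∫⁻ y in B, Ψ y := by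
        rw [lintegral_add_left (by fun_prop), lintegral_const_mul _ (by fun_prop),
          lintegral_const_mul _ hΨ]
    _ ≤ 2 * (∫⁻ y in D, Ψ y) + 2 * ∫⁻ y in D, Ψ y := by
        gcongr
    _ = 4 * ∫⁻ y in D, Ψ y := by ring

/-- Averages of `W` over all segments between the points of a convex set. -/
theorem lintegral_lintegral_lintegral_segment_le {D : Set Plane} (hD : Convex ℝ D)
    (hDm : MeasurableSet D) (hDb : Bornology.IsBounded D) {W : Plane → ℝ} (hW : Continuous W) :
    ∫⁻ x in D, ∫⁻ y in D, ∫⁻ s in Set.Ioc (0 : ℝ) 1, ENNReal.ofReal (W (x + s • (y - x))) ≤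
      4 * volume D * ∫⁻ y in D, ENNReal.ofReal (W y) := by
  have : IsFiniteMeasure (volume.restrict D) := ⟨by simpa using hDb.measure_lt_top⟩
  have hm1 : Measurable fun p : (Plane × Plane) × ℝ =>
      ENNReal.ofReal (W (p.1.1 + p.2 • (p.1.2 - p.1.1))) :=
    (Continuous.measurable (by fun_prop)).ennreal_ofReal
  calc ∫⁻ x in D, ∫⁻ y in D, ∫⁻ s in Set.Ioc (0 : ℝ) 1, ENNReal.ofReal (W (x + s • (y - x)))
      = ∫⁻ x in D, ∫⁻ s in Set.Ioc (0 : ℝ) 1, ∫⁻ y in D, ENNReal.ofReal (W (x + s • (y - x))) := by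
        refine lintegral_congr fun x => ?_
        rw [lintegral_lintegral_swap]
        exact (Continuous.measurable (by fun_prop)).ennreal_ofReal.aemeasurable
    _ = ∫⁻ s in Set.Ioc (0 : ℝ) 1, ∫⁻ x in D, ∫⁻ y in D, ENNReal.ofReal (W (x + s • (y - x))) := by
        rw [lintegral_lintegral_swap]
        refine Measurable.aemeasurable ?_
        refine Measurable.lintegral_prod_right'
          (f := fun p : (Plane × ℝ) × Plane => ENNReal.ofReal (W (p.1.1 + p.1.2 • (p.2 - p.1.1)))) ?_
        exact (Continuous.measurable (by fun_prop)).ennreal_ofReal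
    _ = ∫⁻ s in Set.Ioo (0 : ℝ) 1, ∫⁻ x in D, ∫⁻ y in D, ENNReal.ofReal (W (x + s • (y - x))) := by
        rw [restrict_Ioo_eq_restrict_Ioc]
    _ ≤ ∫⁻ _ in Set.Ioo (0 : ℝ) 1, 4 * volume D * ∫⁻ y in D, ENNReal.ofReal (W y) :=
        setLIntegral_mono' measurableSet_Ioo fun s hs =>
          lintegral_lintegral_segment_le hD hDm hs.1 hs.2
            (F := fun z => ENNReal.ofReal (W z)) hW.measurable.ennreal_ofReal
    _ = _ := by
        rw [setLIntegral_const, Real.volume_Ioo]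
        simp

/-- A pointwise bound for the derivatives at `x` in the directions `y - x` bounds a partial
derivative in `L²`. -/
theorem lintegral_pderivFun_sq_le {D : Set Plane} {c : Plane} {r C S K : ℝ} {w W : Plane → ℝ}
    (hDo : IsOpen D) (hDc : Convex ℝ D) (hDb : Bornology.IsBounded D) (hr : 0 < r)
    (hrD : Metric.ball c r ⊆ D) (hw : ContDiff ℝ ∞ w) (hW : Continuous W)
    (h : ∀ x ∈ D, ∀ y ∈ D, ENNReal.ofReal (dirDeriv 1 (y - x) w x ^ 2) ≤
      ENNReal.ofReal C * (ENNReal.ofReal (S ^ 2) +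
        ENNReal.ofReal K * ∫⁻ s in Set.Ioc (0 : ℝ) 1, ENNReal.ofReal (W (x + s • (y - x)))))
    (i : Fin 2) :
    volume (Metric.ball c (r / 2)) *
      ∫⁻ x in D, ENNReal.ofReal ((r / 2 * pderivFun i w x) ^ 2) ≤
      4 * (ENNReal.ofReal C * (ENNReal.ofReal (S ^ 2) * volume D * volume D +
        ENNReal.ofReal K * (4 * volume D * ∫⁻ y in D, ENNReal.ofReal (W y)))) := by
  have hDm := hDo.measurableSet
  have hm3 : Measurable fun p : Plane × Plane =>
      ∫⁻ s in Set.Ioc (0 : ℝ) 1, ENNReal.ofReal (W (p.1 + s • (p.2 - p.1))) := by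
    refine Measurable.lintegral_prod_right'
      (f := fun p : (Plane × Plane) × ℝ => ENNReal.ofReal (W (p.1.1 + p.2 • (p.1.2 - p.1.1)))) ?_
    exact (Continuous.measurable (by fun_prop)).ennreal_ofReal
  have hm2 : ∀ x, Measurable fun y : Plane =>
      ∫⁻ s in Set.Ioc (0 : ℝ) 1, ENNReal.ofReal (W (x + s • (y - x))) :=
    fun x => hm3.comp measurable_prodMk_left
  have hpm : Measurable fun x => ENNReal.ofReal ((r / 2 * pderivFun i w x) ^ 2) := by
    have := (contDiff_pderivFun i hw).continuous
    exact (Continuous.measurable (by fun_prop)).ennreal_ofReal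
  rw [← lintegral_const_mul _ hpm]
  refine (setLIntegral_mono' hDm fun x hx => mul_pderivFun_sq_le hr hrD w x i
    ((((hm2 x).const_mul _).const_add _).const_mul _) (h x hx)).trans ?_
  rw [lintegral_const_mul' _ _ (by norm_num)]
  refine mul_le_mul_right ?_ 4
  have e1 : ∀ x, ∫⁻ y in D, ENNReal.ofReal C * (ENNReal.ofReal (S ^ 2) +
        ENNReal.ofReal K * ∫⁻ s in Set.Ioc (0 : ℝ) 1, ENNReal.ofReal (W (x + s • (y - x)))) =
      ENNReal.ofReal C * (ENNReal.ofReal (S ^ 2) * volume D +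
        ENNReal.ofReal K * ∫⁻ y in D, ∫⁻ s in Set.Ioc (0 : ℝ) 1,
          ENNReal.ofReal (W (x + s • (y - x)))) := by
    intro x
    rw [lintegral_const_mul _ (((hm2 x).const_mul _).const_add _),
      lintegral_add_left measurable_const, lintegral_const_mul _ (hm2 x), setLIntegral_const]
  simp_rw [e1]
  rw [lintegral_const_mul' _ _ ENNReal.ofReal_ne_top, lintegral_add_left measurable_const,
    setLIntegral_const, lintegral_const_mul' (ENNReal.ofReal K) _ ENNReal.ofReal_ne_top, mul_assoc]
  refine mul_le_mul_right (add_le_add le_rfl (mul_le_mul_right ?_ _)) _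
  exact lintegral_lintegral_lintegral_segment_le hDc hDm hDb hW

theorem radius_le_of_ball_subset_closedBall {c : Plane} {r R : ℝ} (hr : 0 < r)
    (h : Metric.ball c r ⊆ Metric.closedBall c R) : r ≤ R := by
  by_contra hlt
  push Not at hlt
  have hR0 : 0 ≤ R :=
    dist_nonneg.trans (Metric.mem_closedBall.1 (h (Metric.mem_ball_self hr)))
  set z : Plane := c + EuclideanSpace.single 0 ((R + r) / 2)
  have hz : dist z c = (R + r) / 2 := by
    rw [dist_eq_norm, add_sub_cancel_left, PiLp.norm_single, Real.norm_eq_abs,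
      abs_of_nonneg (by linarith)]
  have := Metric.mem_closedBall.1 (h (Metric.mem_ball.2 (by rw [hz]; linarith) : z ∈ _))
  rw [hz] at this
  linarith

theorem volume_closedBall_eq (c : Plane) {R : ℝ} (hR : 0 ≤ R) :
    volume (Metric.closedBall c R) = ENNReal.ofReal (Real.pi * R ^ 2) := by
  rw [EuclideanSpace.volume_closedBall_fin_two, ENNReal.ofReal_mul Real.pi_pos.le,
    ENNReal.ofReal_pow hR, mul_comm]

theorem volume_ball_eq (c : Plane) {R : ℝ} (hR : 0 ≤ R) :
    volume (Metric.ball c R) = ENNReal.ofReal (Real.pi * R ^ 2) := by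
  rw [← volume_closedBall_eq c hR, Measure.addHaar_closedBall_eq_addHaar_ball]

/-- First derivatives are controlled in `L²` by the maximum of the function and the derivatives of
order `m + 1`. -/
theorem exists_interpolation_smooth (m : ℕ) (hm : 1 ≤ m) : ∃ C : ℝ, 0 ≤ C ∧
    ∀ {D : Set Plane} {c : Plane} {r R S : ℝ} {w : Plane → ℝ}, IsOpen D → Convex ℝ D → 0 < r →
      Metric.ball c r ⊆ D → D ⊆ Metric.closedBall c R → ContDiff ℝ ∞ w →
      (∀ x ∈ D, |w x| ≤ S) → ∀ i, ∫⁻ x in D, ENNReal.ofReal (pderivFun i w x ^ 2) ≤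
        ENNReal.ofReal (C * (R / r) ^ 4 *
          (S ^ 2 + R ^ (2 * m) * ∫ y in D, sqDeriv (m + 1) w y)) := by
  obtain ⟨C, hC0, hC⟩ := exists_sq_dirDeriv_one_le m hm
  have hK₁ : 0 ≤ derivConst m 1 := derivConst_nonneg m 1
  refine ⟨64 * C * (4 + 4 * derivConst m 1), by positivity, ?_⟩
  intro D c r R S w hDo hDc hr hrD hDR hw hS i
  have hDb : Bornology.IsBounded D := Metric.isBounded_closedBall.subset hDR
  have hR : 0 < R := hr.trans_le (radius_le_of_ball_subset_closedBall hr (hrD.trans hDR))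
  have hWc : Continuous (sqDeriv (m + 1) w) := continuous_sqDeriv _ hw
  have hW0 : ∀ z, 0 ≤ sqDeriv (m + 1) w z := sqDeriv_nonneg _ _
  have hK : 0 ≤ derivConst m R := derivConst_nonneg m R
  have h1 := lintegral_pderivFun_sq_le (C := C) (S := S) (K := derivConst m R) hDo hDc hDb hr hrD
    hw hWc (fun x hx y hy => by
      refine (ENNReal.ofReal_le_ofReal (hC hDc hDR hw hS x hx y hy)).trans_eq ?_
      have h0 : 0 ≤ ∫ s in (0 : ℝ)..1, sqDeriv (m + 1) w (x + s • (y - x)) :=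
        intervalIntegral.integral_nonneg zero_le_one fun s _ => hW0 _
      rw [ENNReal.ofReal_mul hC0, ENNReal.ofReal_add (sq_nonneg _) (mul_nonneg hK h0),
        ENNReal.ofReal_mul hK, ofReal_intervalIntegral (by fun_prop) fun s => hW0 _]) i
  rw [← ofReal_integral_eq_lintegral_ofReal (integrableOn_of_continuous hDb hWc).integrable
      (Filter.Eventually.of_forall hW0)] at h1
  have hJ0 : 0 ≤ ∫ y in D, sqDeriv (m + 1) w y := integral_nonneg fun y => hW0 y
  generalize (∫ y in D, sqDeriv (m + 1) w y) = J at h1 hJ0 ⊢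
  have hvol : volume D ≤ ENNReal.ofReal (Real.pi * R ^ 2) :=
    (measure_mono hDR).trans_eq (volume_closedBall_eq c hR.le)
  have hKR : derivConst m R = derivConst m 1 * (R ^ (2 * m) * R ^ 2) := by
    rw [derivConst, derivConst, mul_pow, mul_pow, one_pow, ← pow_add]
    ring_nf
  rw [hKR] at h1 hK
  generalize derivConst m 1 = K at h1 hK hK₁ ⊢
  have h3 : ∀ x, ENNReal.ofReal ((r / 2 * pderivFun i w x) ^ 2) =
      ENNReal.ofReal ((r / 2) ^ 2) * ENNReal.ofReal (pderivFun i w x ^ 2) := fun x => by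
    rw [← ENNReal.ofReal_mul (sq_nonneg _), mul_pow]
  simp_rw [h3] at h1
  rw [lintegral_const_mul' _ _ ENNReal.ofReal_ne_top, volume_ball_eq c (by positivity),
    ← mul_assoc, ← ENNReal.ofReal_mul (by positivity)] at h1
  generalize (∫⁻ x in D, ENNReal.ofReal (pderivFun i w x ^ 2)) = I at h1 ⊢
  have hpi := Real.pi_pos
  have h5 : ENNReal.ofReal (Real.pi * (r / 2) ^ 2 * (r / 2) ^ 2) * I ≤
      ENNReal.ofReal (4 * (C * (S ^ 2 * (Real.pi * R ^ 2) * (Real.pi * R ^ 2) +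
        K * (R ^ (2 * m) * R ^ 2) * (4 * (Real.pi * R ^ 2) * J)))) := by
    refine h1.trans ?_
    rw [ENNReal.ofReal_mul (p := 4) (by norm_num), ENNReal.ofReal_mul hC0,
      ENNReal.ofReal_add (by positivity) (by positivity),
      ENNReal.ofReal_mul (p := S ^ 2 * (Real.pi * R ^ 2)) (by positivity),
      ENNReal.ofReal_mul (p := S ^ 2) (sq_nonneg S),
      ENNReal.ofReal_mul (p := K * (R ^ (2 * m) * R ^ 2)) hK,
      ENNReal.ofReal_mul (p := 4 * (Real.pi * R ^ 2)) (by positivity),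
      ENNReal.ofReal_mul (p := 4) (by norm_num), ENNReal.ofReal_ofNat]
    gcongr
  have ha : 0 < Real.pi * (r / 2) ^ 2 * (r / 2) ^ 2 := by positivity
  have h6 : I ≤ ENNReal.ofReal (4 * (C * (S ^ 2 * (Real.pi * R ^ 2) * (Real.pi * R ^ 2) +
        K * (R ^ (2 * m) * R ^ 2) * (4 * (Real.pi * R ^ 2) * J))) /
          (Real.pi * (r / 2) ^ 2 * (r / 2) ^ 2)) := by
    rw [ENNReal.ofReal_div_of_pos ha, ENNReal.le_div_iff_mul_le
      (Or.inl (ENNReal.ofReal_pos.2 ha).ne') (Or.inl ENNReal.ofReal_ne_top), mul_comm]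
    exact h5
  refine h6.trans (ENNReal.ofReal_le_ofReal ?_)
  rw [div_le_iff₀ ha]
  have e : 64 * C * (4 + 4 * K) * (R / r) ^ 4 * (S ^ 2 + R ^ (2 * m) * J) *
      (Real.pi * (r / 2) ^ 2 * (r / 2) ^ 2) =
      4 * C * Real.pi * R ^ 4 * ((4 + 4 * K) * (S ^ 2 + R ^ (2 * m) * J)) := by
    field_simp
    ring
  have e' : 4 * (C * (S ^ 2 * (Real.pi * R ^ 2) * (Real.pi * R ^ 2) +
        K * (R ^ (2 * m) * R ^ 2) * (4 * (Real.pi * R ^ 2) * J))) =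
      4 * C * Real.pi * R ^ 4 * (Real.pi * S ^ 2 + 4 * K * (R ^ (2 * m) * J)) := by ring
  rw [e, e']
  refine mul_le_mul_of_nonneg_left ?_ (by positivity)
  have hp := Real.pi_le_four
  have hRJ : 0 ≤ R ^ (2 * m) * J := by positivity
  have hKS : 0 ≤ K * S ^ 2 := by positivity
  have := mul_le_mul_of_nonneg_right hp (sq_nonneg S)
  linarith

/-! ### Mollification -/

/-- The convolution of `f`, extended by zero from `D`, with `κ`. -/
def mollify (κ : Plane → ℝ) (D : Set Plane) (f : Plane → ℝ) (x : Plane) : ℝ :=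
  ∫ t in D, f t * κ (x - t)

theorem mollify_eq_convolution (κ : Plane → ℝ) {D : Set Plane} (hD : MeasurableSet D)
    (f : Plane → ℝ) :
    mollify κ D f = convolution (D.indicator f) κ (ContinuousLinearMap.mul ℝ ℝ) volume := by
  ext x
  rw [mollify, convolution_mul, ← integral_indicator hD]
  congr 1
  ext t
  by_cases ht : t ∈ D <;> simp [ht]

theorem contDiff_mollify {κ : Plane → ℝ} (hκ : ContDiff ℝ ∞ κ) (hc : HasCompactSupport κ)
    {D : Set Plane} (hD : MeasurableSet D) {f : Plane → ℝ} (hf : IntegrableOn f D) :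
    ContDiff ℝ ∞ (mollify κ D f) := by
  rw [mollify_eq_convolution κ hD]
  exact hc.contDiff_convolution_right _ (hf.integrable_indicator hD).locallyIntegrable hκ

theorem hasCompactSupport_pderivFun (i : Fin 2) {κ : Plane → ℝ} (hc : HasCompactSupport κ) :
    HasCompactSupport (pderivFun i κ) :=
  hc.fderiv_apply ℝ _

theorem pderivFun_mollify (i : Fin 2) {κ : Plane → ℝ} (hκ : ContDiff ℝ ∞ κ)
    (hc : HasCompactSupport κ) {D : Set Plane} (hD : MeasurableSet D) {f : Plane → ℝ}
    (hf : IntegrableOn f D) : pderivFun i (mollify κ D f) = mollify (pderivFun i κ) D f := by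
  rw [mollify_eq_convolution κ hD, mollify_eq_convolution _ hD]
  have hli := (hf.integrable_indicator hD).locallyIntegrable
  ext x
  rw [pderivFun, (hc.hasFDerivAt_convolution_right (ContinuousLinearMap.mul ℝ ℝ) hli
    (hκ.of_le (by simp)) x).fderiv]
  exact convolution_precompR_apply _ hli (hc.fderiv ℝ) (hκ.continuous_fderiv (by simp)) x _

theorem hasCompactSupport_mixedDeriv (a b : ℕ) {κ : Plane → ℝ} (hκ : ContDiff ℝ ∞ κ)
    (hc : HasCompactSupport κ) : HasCompactSupport (mixedDeriv a b κ) := by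
  induction a with
  | zero =>
    induction b with
    | zero => exact hc
    | succ b ih => rw [mixedDeriv_add_one_right _ _ hκ]; exact hasCompactSupport_pderivFun 1 ih
  | succ a ih => rw [mixedDeriv_add_one_left]; exact hasCompactSupport_pderivFun 0 ih

theorem mixedDeriv_mollify (a b : ℕ) {κ : Plane → ℝ} (hκ : ContDiff ℝ ∞ κ)
    (hc : HasCompactSupport κ) {D : Set Plane} (hD : MeasurableSet D) {f : Plane → ℝ}
    (hf : IntegrableOn f D) : mixedDeriv a b (mollify κ D f) = mollify (mixedDeriv a b κ) D f := by
  induction a with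
  | zero =>
    induction b with
    | zero => rfl
    | succ b ih =>
      rw [mixedDeriv_add_one_right _ _ (contDiff_mollify hκ hc hD hf), ih,
        mixedDeriv_add_one_right _ _ hκ, pderivFun_mollify 1 (contDiff_mixedDeriv _ _ hκ)
          (hasCompactSupport_mixedDeriv _ _ hκ hc) hD hf]
  | succ a ih =>
    rw [mixedDeriv_add_one_left, ih, mixedDeriv_add_one_left,
      pderivFun_mollify 0 (contDiff_mixedDeriv _ _ hκ)
        (hasCompactSupport_mixedDeriv _ _ hκ hc) hD hf]

theorem isTestFunction_comp_const_sub {κ : Plane → ℝ} (hκ : ContDiff ℝ ∞ κ)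
    (hc : HasCompactSupport κ) {δ : ℝ} (hδ : tsupport κ ⊆ Metric.closedBall 0 δ) {D : Set Plane}
    {x : Plane} (hx : Metric.closedBall x δ ⊆ D) : IsTestFunction D fun t => κ (x - t) where
  smooth := hκ.comp (contDiff_const.sub contDiff_id)
  compact := hc.comp_homeomorph (Homeomorph.subLeft x)
  support := by
    have h1 : tsupport (fun t => κ (x - t)) ⊆ (fun t => x - t) ⁻¹' tsupport κ :=
      tsupport_comp_subset_preimage κ (f := fun t => x - t) (by fun_prop)
    refine h1.trans fun t ht => hx ?_
    have := hδ ht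
    rwa [mem_closedBall_zero_iff, ← dist_eq_norm, dist_comm] at this

/-- Away from the boundary, mollification commutes with weak derivatives. -/
theorem mixedDeriv_mollify_of_isWeakDeriv {a b : ℕ} {κ : Plane → ℝ} (hκ : ContDiff ℝ ∞ κ)
    (hc : HasCompactSupport κ) {δ : ℝ} (hδ : tsupport κ ⊆ Metric.closedBall 0 δ) {D : Set Plane}
    (hD : MeasurableSet D) {f g : Plane → ℝ} (hf : MeasureTheory.IntegrableOn f D)
    (hw : IsWeakDeriv D a b f g) {x : Plane} (hx : Metric.closedBall x δ ⊆ D) :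
    mixedDeriv a b (mollify κ D f) x = mollify κ D g x := by
  rw [mixedDeriv_mollify a b hκ hc hD hf]
  have h1 := hw.integral_eq _ (isTestFunction_comp_const_sub hκ hc hδ hx)
  have e : (fun t => κ (x - t)) = fun t => κ ((-1 : ℝ) • t + x) := by
    ext t; congr 1; module
  rw [e, mixedDeriv_comp_smul_add a b hκ (-1) x] at h1
  have e2 : ∀ t, (-1 : ℝ) • t + x = x - t := fun t => by module
  simp only [e2] at h1
  have h2 : ∀ t, f t * ((-1) ^ (a + b) * mixedDeriv a b κ (x - t)) =
      (-1) ^ (a + b) * (f t * mixedDeriv a b κ (x - t)) := fun t => by ring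
  simp only [h2] at h1
  rw [MeasureTheory.integral_const_mul] at h1
  exact mul_left_cancel₀ (pow_ne_zero _ (by norm_num)) h1

theorem integrableOn_mul_comp_const_sub {κ : Plane → ℝ} (hκ : Continuous κ)
    (hc : HasCompactSupport κ) {D : Set Plane} {f : Plane → ℝ} (hf : IntegrableOn f D)
    (x : Plane) : IntegrableOn (fun t => f t * κ (x - t)) D := by
  obtain ⟨C, hC⟩ := hc.exists_bound_of_continuous hκ
  exact hf.mul_bdd (c := C) (Continuous.aestronglyMeasurable (by fun_prop))
    (Filter.Eventually.of_forall fun t => hC _)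

/-- A mollifier of radius `δ`. -/
structure IsMollifier (κ : Plane → ℝ) (δ : ℝ) : Prop where
  smooth : ContDiff ℝ ∞ κ
  compact : HasCompactSupport κ
  support : tsupport κ ⊆ Metric.closedBall 0 δ
  nonneg : ∀ x, 0 ≤ κ x
  integral : ∫ x, κ x = 1

theorem isMollifier_normed (η : ContDiffBump (0 : Plane)) :
    IsMollifier (η.normed MeasureTheory.volume) η.rOut where
  smooth := η.contDiff_normed
  compact := η.hasCompactSupport_normed
  support := (η.tsupport_normed_eq).subset
  nonneg := fun x => η.nonneg_normed x
  integral := η.integral_normed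

namespace IsMollifier

variable {κ : Plane → ℝ} {δ : ℝ}

theorem integrable_comp_const_sub (hκ : IsMollifier κ δ) (x : Plane) :
    Integrable fun t => κ (x - t) :=
  (hκ.smooth.continuous.integrable_of_hasCompactSupport hκ.compact).comp_sub_left x

theorem integral_comp_const_sub (hκ : IsMollifier κ δ) (x : Plane) : ∫ t, κ (x - t) = 1 := by
  rw [integral_sub_left_eq_self κ volume x, hκ.integral]

theorem setIntegral_comp_const_sub_le (hκ : IsMollifier κ δ) (D : Set Plane) (x : Plane) :
    ∫ t in D, κ (x - t) ≤ 1 := by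
  rw [← hκ.integral_comp_const_sub x]
  exact setIntegral_le_integral (hκ.integrable_comp_const_sub x)
    (Filter.Eventually.of_forall fun t => hκ.nonneg _)

theorem eq_zero_of_lt (hκ : IsMollifier κ δ) {x : Plane} (hx : δ < ‖x‖) : κ x = 0 := by
  refine image_eq_zero_of_notMem_tsupport fun h => ?_
  have := hκ.support h
  rw [mem_closedBall_zero_iff] at this
  linarith

theorem setIntegral_comp_const_sub (hκ : IsMollifier κ δ) {D : Set Plane} {x : Plane}
    (hx : Metric.closedBall x δ ⊆ D) : ∫ t in D, κ (x - t) = 1 := by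
  rw [← hκ.integral_comp_const_sub x]
  refine setIntegral_eq_integral_of_forall_compl_eq_zero fun t ht => hκ.eq_zero_of_lt ?_
  by_contra h
  push Not at h
  exact ht (hx (by rwa [Metric.mem_closedBall, dist_comm, dist_eq_norm]))

theorem abs_mollify_sub_le (hκ : IsMollifier κ δ) {D : Set Plane} (hD : MeasurableSet D)
    {f : Plane → ℝ} (hf : IntegrableOn f D) {x : Plane}
    (hx : Metric.closedBall x δ ⊆ D) {a ε : ℝ}
    (h : ∀ t ∈ Metric.closedBall x δ, |f t - a| ≤ ε) : |mollify κ D f x - a| ≤ ε := by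
  have hi := (hκ.integrable_comp_const_sub x).integrableOn (s := D)
  have e : mollify κ D f x - a = ∫ t in D, (f t * κ (x - t) - a * κ (x - t)) := by
    rw [integral_sub (integrableOn_mul_comp_const_sub hκ.smooth.continuous hκ.compact hf x)
      (hi.const_mul a), integral_const_mul, hκ.setIntegral_comp_const_sub hx, mul_one]
    rfl
  have e2 : ε = ∫ t in D, ε * κ (x - t) := by
    rw [integral_const_mul, hκ.setIntegral_comp_const_sub hx, mul_one]
  rw [e, ← Real.norm_eq_abs]
  conv_rhs => rw [e2]
  refine norm_integral_le_of_norm_le (hi.const_mul ε) ?_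
  refine (ae_restrict_iff' hD).2 (Filter.Eventually.of_forall fun t ht => ?_)
  rw [← sub_mul, Real.norm_eq_abs, abs_mul, abs_of_nonneg (hκ.nonneg _)]
  by_cases hxt : ‖x - t‖ ≤ δ
  · refine mul_le_mul_of_nonneg_right (h t ?_) (hκ.nonneg _)
    rwa [Metric.mem_closedBall, dist_comm, dist_eq_norm]
  · rw [hκ.eq_zero_of_lt (not_le.1 hxt)]; simp

/-- Jensen's inequality for the averages that define the mollification. -/
theorem sq_mollify_le (hκ : IsMollifier κ δ) {D : Set Plane} {g : Plane → ℝ}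
    (hg : IntegrableOn g D) (hg2 : IntegrableOn (fun t => g t ^ 2) D) (x : Plane) :
    mollify κ D g x ^ 2 ≤ mollify κ D (fun t => g t ^ 2) x := by
  set I := mollify κ D g x with hI
  have hi := (hκ.integrable_comp_const_sub x).integrableOn (s := D)
  have hi1 := integrableOn_mul_comp_const_sub hκ.smooth.continuous hκ.compact hg x
  have hi2 := integrableOn_mul_comp_const_sub hκ.smooth.continuous hκ.compact hg2 x
  have h0 : 0 ≤ ∫ t in D, (g t - I) ^ 2 * κ (x - t) :=
    integral_nonneg fun t => mul_nonneg (sq_nonneg _) (hκ.nonneg _)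
  have e : ∀ t, (g t - I) ^ 2 * κ (x - t) = g t ^ 2 * κ (x - t) - 2 * I * (g t * κ (x - t)) +
      I ^ 2 * κ (x - t) := fun t => by ring
  simp_rw [e] at h0
  rw [integral_add (f := fun t => g t ^ 2 * κ (x - t) - 2 * I * (g t * κ (x - t)))
    (Integrable.sub hi2 (hi1.const_mul _)) (hi.const_mul _),
    integral_sub hi2 (hi1.const_mul _), integral_const_mul, integral_const_mul] at h0
  have hI' : ∫ t in D, g t * κ (x - t) = I := rfl
  have hJ' : ∫ t in D, g t ^ 2 * κ (x - t) = mollify κ D (fun t => g t ^ 2) x := rfl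
  rw [hI', hJ'] at h0
  have := mul_le_mul_of_nonneg_left (hκ.setIntegral_comp_const_sub_le D x) (sq_nonneg I)
  nlinarith

/-- Mollification does not increase the `L²` norm. -/
theorem lintegral_sq_mollify_le (hκ : IsMollifier κ δ) {D : Set Plane} {g : Plane → ℝ}
    (hg : IntegrableOn g D) (hg2 : IntegrableOn (fun t => g t ^ 2) D) :
    ∫⁻ x, ENNReal.ofReal (mollify κ D g x ^ 2) ≤ ENNReal.ofReal (∫ t in D, g t ^ 2) := by
  have hpt : ∀ x, ENNReal.ofReal (mollify κ D g x ^ 2) ≤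
      ∫⁻ t in D, ENNReal.ofReal (g t ^ 2) * ENNReal.ofReal (κ (x - t)) := by
    intro x
    refine (ENNReal.ofReal_le_ofReal (hκ.sq_mollify_le hg hg2 x)).trans_eq ?_
    rw [mollify, ofReal_integral_eq_lintegral_ofReal
      (integrableOn_mul_comp_const_sub hκ.smooth.continuous hκ.compact hg2 x)
      (Filter.Eventually.of_forall fun t => mul_nonneg (sq_nonneg _) (hκ.nonneg _))]
    exact lintegral_congr fun t => ENNReal.ofReal_mul (sq_nonneg _)
  refine (lintegral_mono hpt).trans_eq ?_
  have hm : AEMeasurable (fun t => ENNReal.ofReal (g t ^ 2)) (volume.restrict D) :=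
    hg2.aestronglyMeasurable.aemeasurable.ennreal_ofReal
  have hκm : Measurable fun p : Plane × Plane => ENNReal.ofReal (κ (p.1 - p.2)) := by
    have := hκ.smooth.continuous
    exact (Continuous.measurable (by fun_prop)).ennreal_ofReal
  rw [lintegral_lintegral_swap, ofReal_integral_eq_lintegral_ofReal hg2
    (Filter.Eventually.of_forall fun t => sq_nonneg _)]
  · refine lintegral_congr fun t => ?_
    rw [lintegral_const_mul' _ _ ENNReal.ofReal_ne_top,
      lintegral_sub_right_eq_self (fun x => ENNReal.ofReal (κ x)) t,
      ← ofReal_integral_eq_lintegral_ofReal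
        (hκ.smooth.continuous.integrable_of_hasCompactSupport hκ.compact)
        (Filter.Eventually.of_forall hκ.nonneg), hκ.integral, ENNReal.ofReal_one, mul_one]
  · exact (hm.comp_snd).mul hκm.aemeasurable

end IsMollifier

/-- Convergence of mollifications at the Lebesgue points; the supports of the mollifiers have to be
comparable to the discs where they are constant. -/
theorem ae_tendsto_mollify {D : Set Plane} (hD : MeasurableSet D) {g : Plane → ℝ}
    (hg : IntegrableOn g D) {η : ℕ → ContDiffBump (0 : Plane)}
    (hη : Filter.Tendsto (fun n => (η n).rOut) Filter.atTop (𝓝 0)) {K : ℝ}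
    (hK : ∀ n, (η n).rOut ≤ K * (η n).rIn) :
    ∀ᵐ x ∂(volume.restrict D), Filter.Tendsto (fun n => mollify ((η n).normed volume) D g x)
      Filter.atTop (𝓝 (g x)) := by
  have h1 := ContDiffBump.ae_convolution_tendsto_right_of_locallyIntegrable (μ := volume)
    hη (Filter.Eventually.of_forall hK) (hg.integrable_indicator hD).locallyIntegrable
  refine (ae_restrict_iff' hD).2 ?_
  filter_upwards [h1] with x hx hxD
  rw [Set.indicator_of_mem hxD] at hx
  refine hx.congr fun n => ?_
  rw [convolution_lsmul_swap, mollify, ← integral_indicator hD]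
  congr 1
  ext t
  by_cases ht : t ∈ D <;> simp [ht, mul_comm]

/-! ### Approximation of Sobolev functions on convex sets -/

/-- A contraction of a convex set towards an inner point leaves a margin around the image of the
closure, so that mollification there does not see the exterior. -/
theorem closedBall_homothety_subset {D : Set Plane} (hDc : Convex ℝ D) {c : Plane} {r : ℝ}
    (hrD : Metric.ball c r ⊆ D) {t δ : ℝ} (ht : 0 < t) (ht1 : t ≤ 1) (hδ : δ < t * r)
    {x : Plane} (hx : x ∈ closure D) : Metric.closedBall (c + (1 - t) • (x - c)) δ ⊆ D := by
  intro z hz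
  set w : Plane := c + t⁻¹ • (z - (c + (1 - t) • (x - c))) with hw
  have hwb : w ∈ Metric.ball c r := by
    rw [Metric.mem_ball, dist_eq_norm, hw, add_sub_cancel_left, norm_smul, norm_inv,
      Real.norm_eq_abs, abs_of_pos ht, inv_mul_lt_iff₀ ht, ← dist_eq_norm]
    exact (Metric.mem_closedBall.1 hz).trans_lt hδ
  have hwi : w ∈ interior D := interior_maximal hrD Metric.isOpen_ball hwb
  have e : z = t • w + (1 - t) • x := by
    rw [hw, smul_add, smul_smul, mul_inv_cancel₀ ht.ne']
    module
  rw [e]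
  exact interior_subset
    (hDc.combo_interior_closure_mem_interior hwi hx ht (by linarith) (by ring))

/-- The image of `D` under the homothety with center `c` and ratio `s`. -/
def shrink (c : Plane) (s : ℝ) (D : Set Plane) : Set Plane :=
  (fun z => c + s⁻¹ • (z - c)) ⁻¹' D

theorem isOpen_shrink (c : Plane) (s : ℝ) {D : Set Plane} (hD : IsOpen D) :
    IsOpen (shrink c s D) :=
  hD.preimage (by fun_prop)

theorem homothety_mem_shrink {c : Plane} {s : ℝ} (hs : s ≠ 0) {D : Set Plane} {x : Plane}
    (hx : x ∈ D) : c + s • (x - c) ∈ shrink c s D := by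
  have : c + s⁻¹ • (c + s • (x - c) - c) = x := by
    rw [add_sub_cancel_left, smul_smul, inv_mul_cancel₀ hs]; module
  rw [shrink, Set.mem_preimage, this]
  exact hx

theorem exists_eq_of_mem_shrink {c : Plane} {s : ℝ} (hs : s ≠ 0) {D : Set Plane} {z : Plane}
    (hz : z ∈ shrink c s D) : ∃ x ∈ D, z = c + s • (x - c) := by
  refine ⟨_, hz, ?_⟩
  rw [add_sub_cancel_left, smul_smul, mul_inv_cancel₀ hs]
  module

theorem convex_shrink (c : Plane) (s : ℝ) {D : Set Plane} (hD : Convex ℝ D) :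
    Convex ℝ (shrink c s D) := by
  have e : shrink c s D = AffineMap.homothety c s⁻¹ ⁻¹' D := by
    ext z
    simp only [shrink, Set.mem_preimage, AffineMap.homothety_apply, vsub_eq_sub, vadd_eq_add]
    rw [add_comm]
  rw [e]
  exact hD.affine_preimage (AffineMap.homothety c s⁻¹)

theorem shrink_mono {c : Plane} {s s' : ℝ} (hs : 0 < s) (hss : s ≤ s') {D : Set Plane}
    (hD : Convex ℝ D) (hc : c ∈ D) : shrink c s D ⊆ shrink c s' D := by
  intro z hz
  have hs' : 0 < s' := hs.trans_le hss
  have h1 := hD.add_smul_sub_mem hc hz (t := s / s')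
    ⟨by positivity, (div_le_one hs').2 hss⟩
  have e : c + (s / s') • (c + s⁻¹ • (z - c) - c) = c + s'⁻¹ • (z - c) := by
    rw [add_sub_cancel_left, smul_smul]
    congr 2
    field_simp
  rw [e] at h1
  exact h1

/-- Over a bounded set, square integrable functions are integrable. -/
theorem integrableOn_of_memLp_two {D : Set Plane} (hDb : Bornology.IsBounded D) {g : Plane → ℝ}
    (hg : MemLp g 2 (volume.restrict D)) : IntegrableOn g D := by
  have : IsFiniteMeasure (volume.restrict D) := ⟨by simpa using hDb.measure_lt_top⟩
  exact hg.integrable (by norm_num)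

theorem integrableOn_of_continuousOn_closure {D : Set Plane} (hDb : Bornology.IsBounded D)
    {f : Plane → ℝ} (hf : ContinuousOn f (closure D)) : IntegrableOn f D :=
  (hf.integrableOn_compact hDb.isCompact_closure).mono_set subset_closure

/-- A smooth bump function at the origin of outer radius `δ`. -/
theorem exists_isMollifier {δ : ℝ} (hδ : 0 < δ) : ∃ κ, IsMollifier κ δ :=
  ⟨_, isMollifier_normed ⟨δ / 2, δ, by positivity, by linarith⟩⟩

/-- The energy of a mollification on a set that the mollifier does not leave. -/
theorem setIntegral_sqDeriv_mollify_le {k : ℕ} {κ : Plane → ℝ} {δ : ℝ} (hκ : IsMollifier κ δ)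
    {D E : Set Plane} (hD : MeasurableSet D) (hE : MeasurableSet E) (hDb : Bornology.IsBounded D)
    (hED : ∀ x ∈ E, Metric.closedBall x δ ⊆ D)
    {f : Plane → ℝ} (hf : IntegrableOn f D) {G : ℕ → Plane → ℝ}
    (hG : ∀ a ≤ k, IsWeakDeriv D a (k - a) f (G a))
    (hGL : ∀ a ≤ k, MemLp (G a) 2 (volume.restrict D)) :
    ∫⁻ x in E, ENNReal.ofReal (sqDeriv k (mollify κ D f) x) ≤
      ENNReal.ofReal (∑ a ∈ Finset.range (k + 1), ∫ x in D, G a x ^ 2) := by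
  have hle : ∀ a ∈ Finset.range (k + 1), a ≤ k := fun a ha =>
    Nat.lt_succ_iff.1 (Finset.mem_range.1 ha)
  have hsm := contDiff_mollify hκ.smooth hκ.compact hD hf
  have e : ∀ x, ENNReal.ofReal (sqDeriv k (mollify κ D f) x) =
      ∑ a ∈ Finset.range (k + 1), ENNReal.ofReal (mixedDeriv a (k - a) (mollify κ D f) x ^ 2) :=
    fun x => ENNReal.ofReal_sum_of_nonneg fun a _ => sq_nonneg _
  simp_rw [e]
  rw [lintegral_finsetSum _ fun a _ => Measurable.ennreal_ofReal
      ((continuous_mixedDeriv a (k - a) hsm).measurable.pow_const 2),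
    ENNReal.ofReal_sum_of_nonneg fun a _ => integral_nonneg fun x => sq_nonneg _]
  refine Finset.sum_le_sum fun a ha => ?_
  calc ∫⁻ x in E, ENNReal.ofReal (mixedDeriv a (k - a) (mollify κ D f) x ^ 2)
      = ∫⁻ x in E, ENNReal.ofReal (mollify κ D (G a) x ^ 2) := by
        refine setLIntegral_congr_fun hE fun x hx => ?_
        rw [mixedDeriv_mollify_of_isWeakDeriv hκ.smooth hκ.compact hκ.support hD hf
          (hG a (hle a ha)) (hED x hx)]
    _ ≤ ∫⁻ x, ENNReal.ofReal (mollify κ D (G a) x ^ 2) := setLIntegral_le_lintegral _ _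
    _ ≤ _ := hκ.lintegral_sq_mollify_le (integrableOn_of_memLp_two hDb (hGL a (hle a ha)))
        (hGL a (hle a ha)).integrable_sq

/-- `u` is weakly solenoidal in `D`. -/
def IsWeaklySolenoidal (D : Set Plane) (u : Plane → Plane) : Prop :=
  ∀ φ : Plane → ℝ, IsTestFunction D φ →
    ∫ x in D, (u x 0 * pderivFun 0 φ x + u x 1 * pderivFun 1 φ x) = 0

theorem pderivFun_comp_const_sub (i : Fin 2) {κ : Plane → ℝ} (hκ : ContDiff ℝ ∞ κ)
    (x t : Plane) : pderivFun i (fun t => κ (x - t)) t = -pderivFun i κ (x - t) := by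
  have h1 : HasFDerivAt (fun t : Plane => x - t) (-ContinuousLinearMap.id ℝ Plane) t :=
    (hasFDerivAt_id t).const_sub x
  have h2 := (hκ.differentiable (by simp) (x - t)).hasFDerivAt.comp t h1
  rw [pderivFun, show (fun t => κ (x - t)) = κ ∘ fun t => x - t from rfl, h2.fderiv]
  simp [pderivFun]

theorem divergence_mollify_eq_zero {κ : Plane → ℝ} {δ : ℝ} (hκ : IsMollifier κ δ)
    {D : Set Plane} (hD : MeasurableSet D) {u : Plane → Plane}
    (hu : ∀ i, IntegrableOn (fun x => u x i) D) (hdiv : IsWeaklySolenoidal D u) {x : Plane}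
    (hx : Metric.closedBall x δ ⊆ D) :
    pderivFun 0 (mollify κ D fun x => u x 0) x + pderivFun 1 (mollify κ D fun x => u x 1) x =
      0 := by
  have h := hdiv _ (isTestFunction_comp_const_sub hκ.smooth hκ.compact hκ.support hx)
  simp only [pderivFun_comp_const_sub _ hκ.smooth] at h
  have hi : ∀ i, IntegrableOn (fun t => u t i * pderivFun i κ (x - t)) D := fun i =>
    integrableOn_mul_comp_const_sub (contDiff_pderivFun i hκ.smooth).continuous
      (hasCompactSupport_pderivFun i hκ.compact) (hu i) x
  rw [pderivFun_mollify 0 hκ.smooth hκ.compact hD (hu 0),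
    pderivFun_mollify 1 hκ.smooth hκ.compact hD (hu 1), mollify, mollify,
    ← integral_add (hi 0) (hi 1), ← neg_eq_zero, ← integral_neg, ← h]
  refine integral_congr_ae (Filter.Eventually.of_forall fun t => ?_)
  simp only []
  ring

/-- Smooth approximation of a solenoidal Sobolev field on a convex set: mollification of a slightly
shrunk field. -/
theorem exists_smooth_approx (k : ℕ) (hk : 1 ≤ k) {D : Set Plane} (hDo : IsOpen D)
    (hDn : D.Nonempty) (hDc : Convex ℝ D) (hDb : Bornology.IsBounded D) {u : Plane → Plane}
    (hu : ContinuousOn u (closure D)) {G : Fin 2 → ℕ → Plane → ℝ}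
    (hG : ∀ i, ∀ a ≤ k, IsWeakDeriv D a (k - a) (fun x => u x i) (G i a))
    (hGL : ∀ i, ∀ a ≤ k, MemLp (G i a) 2 (volume.restrict D)) (hdiv : IsWeaklySolenoidal D u)
    {ε : ℝ} (hε : 0 < ε) :
    ∃ v : Fin 2 → Plane → ℝ, (∀ i, ContDiff ℝ ∞ (v i)) ∧
      (∀ x ∈ D, pderivFun 0 (v 0) x + pderivFun 1 (v 1) x = 0) ∧
      (∀ i, ∫ x in D, sqDeriv k (v i) x ≤ ∑ a ∈ Finset.range (k + 1), ∫ x in D, G i a x ^ 2) ∧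
      ∀ i, ∀ x ∈ closure D, |v i x - u x i| ≤ ε := by
  have hDm := hDo.measurableSet
  obtain ⟨c, hcD⟩ := hDn
  obtain ⟨r, hr, hrD⟩ := Metric.isOpen_iff.1 hDo c hcD
  obtain ⟨R, hR⟩ := hDb.closure.subset_closedBall c
  have hR0 : 0 ≤ R := dist_nonneg.trans (Metric.mem_closedBall.1 (hR (subset_closure hcD)))
  have huc : UniformContinuousOn u (closure D) :=
    hDb.isCompact_closure.uniformContinuousOn_of_continuous hu
  obtain ⟨τ, hτ, hτu⟩ := Metric.uniformContinuousOn_iff.1 huc ε hε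
  set t : ℝ := min (1 / 2) (τ / (2 * (R + 1))) with ht
  have ht0 : 0 < t := by positivity
  have ht1 : t ≤ 1 / 2 := min_le_left _ _
  have htR : t * R < τ / 2 := by
    have h1 : t * (2 * (R + 1)) ≤ τ := by
      rw [← le_div_iff₀ (by positivity)]; exact min_le_right _ _
    nlinarith
  set δ : ℝ := min (t * r) τ / 2 with hδ
  have hδ0 : 0 < δ := by positivity
  have hδr : δ < t * r := by
    have : 0 < min (t * r) τ := by positivity
    have := min_le_left (t * r) τ
    linarith
  have hδτ : δ ≤ τ / 2 := by
    have := min_le_right (t * r) τ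
    linarith
  obtain ⟨κ, hκ⟩ := exists_isMollifier hδ0
  have hball : ∀ x ∈ closure D, Metric.closedBall (c + (1 - t) • (x - c)) δ ⊆ D := fun x hx =>
    closedBall_homothety_subset hDc hrD ht0 (by linarith) hδr hx
  have hui : ∀ i, IntegrableOn (fun x => u x i) D := fun i =>
    integrableOn_of_continuousOn_closure hDb
      ((EuclideanSpace.proj (𝕜 := ℝ) i).continuous.comp_continuousOn hu)
  have eψ : ∀ x : Plane, (1 - t) • x + t • c = c + (1 - t) • (x - c) := fun x => by module
  have hsm : ∀ i, ContDiff ℝ ∞ (mollify κ D fun x => u x i) := fun i =>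
    contDiff_mollify hκ.smooth hκ.compact hDm (hui i)
  have hmd : ∀ i a b x, mixedDeriv a b
      (fun x => mollify κ D (fun x => u x i) ((1 - t) • x + t • c)) x =
      (1 - t) ^ (a + b) *
        mixedDeriv a b (mollify κ D fun x => u x i) ((1 - t) • x + t • c) := fun i a b x =>
    congrFun (mixedDeriv_comp_smul_add a b (hsm i) (1 - t) (t • c)) x
  have hvs : ∀ i, ContDiff ℝ ∞
      (fun x => mollify κ D (fun x => u x i) ((1 - t) • x + t • c)) := fun i =>
    (hsm i).comp ((contDiff_id.const_smul _).add contDiff_const)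
  refine ⟨fun i x => mollify κ D (fun x => u x i) ((1 - t) • x + t • c), hvs,
    fun x hx => ?_, fun i => ?_, fun i x hx => ?_⟩
  · have h0 := hmd 0 1 0 x
    have h1 := hmd 1 0 1 x
    simp only [mixedDeriv, Function.iterate_one, Function.iterate_zero, id] at h0 h1
    rw [h0, h1, eψ]
    have := divergence_mollify_eq_zero hκ hDm hui hdiv (hball x (subset_closure hx))
    linear_combination (1 - t) * this
  · have hnn : 0 ≤ ∑ a ∈ Finset.range (k + 1), ∫ x in D, G i a x ^ 2 :=
      Finset.sum_nonneg fun a _ => integral_nonneg fun x => sq_nonneg _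
    rw [← ENNReal.ofReal_le_ofReal_iff hnn, ofReal_integral_eq_lintegral_ofReal
      (integrableOn_of_continuous hDb (continuous_sqDeriv k (hvs i))).integrable
      (Filter.Eventually.of_forall fun x => sqDeriv_nonneg _ _ _)]
    have hs : (1 - t) ≠ 0 := by linarith
    have hEo := isOpen_shrink c (1 - t) hDo
    have h1 := setIntegral_sqDeriv_mollify_le hκ hDm hEo.measurableSet hDb (fun z hz => by
      obtain ⟨x, hx, rfl⟩ := exists_eq_of_mem_shrink hs hz
      exact hball x (subset_closure hx)) (hui i) (hG i) (hGL i)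
    rw [← lintegral_indicator hEo.measurableSet] at h1
    set F := (shrink c (1 - t) D).indicator fun z =>
      ENNReal.ofReal (sqDeriv k (mollify κ D fun x => u x i) z) with hF
    have e : ∀ x ∈ D, ENNReal.ofReal (sqDeriv k
        (fun x => mollify κ D (fun x => u x i) ((1 - t) • x + t • c)) x) =
        ENNReal.ofReal (((1 - t) ^ k) ^ 2) * F (c + (1 - t) • (x - c)) := by
      intro x hx
      rw [hF, Set.indicator_of_mem (homothety_mem_shrink hs hx), ← ENNReal.ofReal_mul (sq_nonneg _),
        sqDeriv, sqDeriv, Finset.mul_sum]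
      congr 1
      refine Finset.sum_congr rfl fun a ha => ?_
      rw [hmd, eψ, mul_pow, Nat.add_sub_cancel' (Nat.lt_succ_iff.1 (Finset.mem_range.1 ha))]
    rw [setLIntegral_congr_fun hDm e, lintegral_const_mul' _ _ ENNReal.ofReal_ne_top]
    refine le_trans (mul_le_mul_right (lintegral_comp_homothety_le hDc hDm hcD
      (by linarith : 0 < 1 - t) (by linarith) F) _) ?_
    rw [← mul_assoc, ← ENNReal.ofReal_mul (by positivity)]
    refine (mul_le_of_le_one_left zero_le ?_).trans ((setLIntegral_le_lintegral _ _).trans h1)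
    rw [ENNReal.ofReal_le_one, ← div_eq_mul_inv, div_le_one (by nlinarith)]
    have h2 : (1 - t) ^ k ≤ (1 - t) ^ 1 :=
      pow_le_pow_of_le_one (by linarith) (by linarith) hk
    have h3 : 0 ≤ (1 - t) ^ k := pow_nonneg (by linarith) k
    rw [pow_one] at h2
    gcongr
  · have h1 : ∀ z ∈ Metric.closedBall (c + (1 - t) • (x - c)) δ, |u z i - u x i| ≤ ε := by
      intro z hz
      have hzx : dist z x < τ := by
        have e1 : dist (c + (1 - t) • (x - c)) x = t * dist x c := by
          rw [dist_eq_norm, dist_eq_norm,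
            show c + (1 - t) • (x - c) - x = (-t) • (x - c) by module, norm_smul, norm_neg,
            Real.norm_eq_abs, abs_of_pos ht0]
        have e2 : t * dist x c ≤ t * R := by
          gcongr
          exact Metric.mem_closedBall.1 (hR hx)
        have := dist_triangle z (c + (1 - t) • (x - c)) x
        have := Metric.mem_closedBall.1 hz
        linarith
      have h2 := (hτu z (subset_closure (hball x hx hz)) x hx hzx).le
      rw [dist_eq_norm] at h2
      exact (abs_coord_le (u z - u x) i).trans h2
    simp only [eψ]
    exact hκ.abs_mollify_sub_le hDm (hui i) (hball x hx) h1

/-- The bound for the maximum norm of the approximation error on `D` of a function with derivatives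
`G a` of order `m + 1`. -/
def approxBound (m : ℕ) (R : ℝ) (D : Set Plane) (G : ℕ → Plane → ℝ) : ℝ :=
  Real.sqrt (derivConst m R / MeasureTheory.volume.real D *
    ∑ a ∈ Finset.range (m + 2), ∫ x in D, G a x ^ 2)

/-- Approximation of a solenoidal Sobolev field on a convex set by solenoidal polynomials. -/
theorem exists_solenoidal_approx (m : ℕ) (hm : 1 ≤ m) {D : Set Plane} (hDo : IsOpen D)
    (hDn : D.Nonempty) (hDc : Convex ℝ D) {c : Plane} {R : ℝ} (hDR : D ⊆ Metric.closedBall c R)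
    {u : Plane → Plane} (hu : ContinuousOn u (closure D)) {G : Fin 2 → ℕ → Plane → ℝ}
    (hG : ∀ i, ∀ a ≤ m + 1, IsWeakDeriv D a (m + 1 - a) (fun x => u x i) (G i a))
    (hGL : ∀ i, ∀ a ≤ m + 1, MemLp (G i a) 2 (volume.restrict D))
    (hdiv : IsWeaklySolenoidal D u) {ε : ℝ} (hε : 0 < ε) :
    ∃ q ∈ solenoidal m, ∀ x ∈ closure D, ∀ i,
      |u x i - polyField q x i| ≤ approxBound m R D (G i) + ε := by
  have hDb : Bornology.IsBounded D := Metric.isBounded_closedBall.subset hDR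
  have hDpos : 0 < volume.real D :=
    ENNReal.toReal_pos (hDo.measure_pos _ hDn).ne' hDb.measure_lt_top.ne
  obtain ⟨v, hv, hvdiv, hvG, hvu⟩ := exists_smooth_approx (m + 1) (by omega) hDo hDn hDc hDb hu hG
    hGL hdiv hε
  obtain ⟨q, hq, hqv⟩ := exists_solenoidal_approx_smooth m hm hDo hDn hDc hDR hv hvdiv
  refine ⟨q, hq, fun x hx i => ?_⟩
  have h1 : ∀ x ∈ D, |v i x - polyField q x i| ≤ approxBound m R D (G i) := by
    intro x hx
    refine Real.abs_le_sqrt ?_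
    rw [div_mul_eq_mul_div, le_div_iff₀ hDpos, mul_comm]
    exact (hqv x hx i).trans (mul_le_mul_of_nonneg_left (hvG i) (derivConst_nonneg m R))
  have h2 : |v i x - polyField q x i| ≤ approxBound m R D (G i) := by
    have hcl : IsClosed {x : Plane | |v i x - polyField q x i| ≤ approxBound m R D (G i)} := by
      have h3 := (hv i).continuous
      have h4 : Continuous fun x => polyField q x i :=
        (EuclideanSpace.proj (𝕜 := ℝ) i).continuous.comp (continuous_polyField q)
      exact isClosed_le (by fun_prop) continuous_const
    exact closure_minimal (fun x hx => h1 x hx) hcl hx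
  have h3 := abs_sub_le (u x i) (v i x) (polyField q x i)
  have h4 := hvu i x hx
  rw [abs_sub_comm] at h4
  linarith

/-- The first weak derivatives are controlled in `L²` by the maximum of the function and its weak
derivatives of order `m + 1`. -/
theorem exists_interpolation (m : ℕ) (hm : 1 ≤ m) : ∃ C : ℝ, 0 ≤ C ∧
    ∀ {D : Set Plane} {c : Plane} {r R S : ℝ} {w g : Plane → ℝ} {G : ℕ → Plane → ℝ} {i : Fin 2},
      IsOpen D → Convex ℝ D → 0 < r → Metric.ball c r ⊆ D → D ⊆ Metric.closedBall c R →
      (∀ x ∈ D, |w x| ≤ S) → IntegrableOn w D →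
      IsWeakDeriv D (1 - (i : ℕ)) i w g → MemLp g 2 (volume.restrict D) →
      (∀ a ≤ m + 1, IsWeakDeriv D a (m + 1 - a) w (G a)) →
      (∀ a ≤ m + 1, MemLp (G a) 2 (volume.restrict D)) →
      ∫ x in D, g x ^ 2 ≤ C * (R / r) ^ 4 *
          (S ^ 2 + R ^ (2 * m) * ∑ a ∈ Finset.range (m + 2), ∫ x in D, G a x ^ 2) := by
  obtain ⟨C, hC0, hC⟩ := exists_interpolation_smooth m hm
  refine ⟨16 * C, by positivity, ?_⟩
  intro D c r R S w g G i hDo hDc hr hrD hDR hS hw hg hgL hG hGL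
  have hDm := hDo.measurableSet
  have hDb : Bornology.IsBounded D := Metric.isBounded_closedBall.subset hDR
  have hcD : c ∈ D := hrD (Metric.mem_ball_self hr)
  have hgi := integrableOn_of_memLp_two hDb hgL
  have hR : 0 < R := hr.trans_le (radius_le_of_ball_subset_closedBall hr (hrD.trans hDR))
  have hJ0 : 0 ≤ ∑ a ∈ Finset.range (m + 2), ∫ x in D, G a x ^ 2 :=
    Finset.sum_nonneg fun a _ => integral_nonneg fun x => sq_nonneg _
  set B := 16 * C * (R / r) ^ 4 *
    (S ^ 2 + R ^ (2 * m) * ∑ a ∈ Finset.range (m + 2), ∫ x in D, G a x ^ 2) with hB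
  have hB0 : 0 ≤ B := by positivity
  -- the estimate on a shrunk domain, by mollification and Fatou's lemma
  have hshrink : ∀ t : ℝ, 0 < t → t ≤ 1 / 2 →
      ∫⁻ x in shrink c (1 - t) D, ENNReal.ofReal (g x ^ 2) ≤ ENNReal.ofReal B := by
    intro t ht ht1
    have hs : (1 - t) ≠ 0 := by linarith
    have hEo := isOpen_shrink c (1 - t) hDo
    have hED : shrink c (1 - t) D ⊆ D := by
      intro z hz
      obtain ⟨x, hx, rfl⟩ := exists_eq_of_mem_shrink hs hz
      exact hDc.add_smul_sub_mem hcD hx ⟨by linarith, by linarith⟩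
    have hrE : Metric.ball c ((1 - t) * r) ⊆ shrink c (1 - t) D := by
      intro z hz
      refine hrD ?_
      rw [Metric.mem_ball, dist_eq_norm] at hz ⊢
      rwa [add_sub_cancel_left, norm_smul, norm_inv, Real.norm_eq_abs, abs_of_pos (by linarith),
        inv_mul_lt_iff₀ (by linarith)]
    let η : ℕ → ContDiffBump (0 : Plane) := fun n =>
      ⟨t * r / (n + 2) / 2, t * r / (n + 2), by positivity, half_lt_self (by positivity)⟩
    have hη0 : Filter.Tendsto (fun n => (η n).rOut) Filter.atTop (𝓝 0) := by
      have h1 := (tendsto_const_div_atTop_nhds_zero_nat (t * r)).comp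
        (Filter.tendsto_add_atTop_nat 2)
      refine h1.congr fun n => ?_
      simp [η]
    have hηK : ∀ n, (η n).rOut ≤ 2 * (η n).rIn := fun n => by simp only [η]; linarith
    have hηr : ∀ n, (η n).rOut < t * r := fun n => by
      simp only [η]
      refine div_lt_self (by positivity) ?_
      have : (0 : ℝ) ≤ n := n.cast_nonneg
      linarith
    have hball : ∀ n, ∀ z ∈ shrink c (1 - t) D, Metric.closedBall z (η n).rOut ⊆ D := by
      intro n z hz
      obtain ⟨x, hx, rfl⟩ := exists_eq_of_mem_shrink hs hz
      exact closedBall_homothety_subset hDc hrD ht (by linarith) (hηr n) (subset_closure hx)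
    have hκ := fun n => isMollifier_normed (η n)
    have hae := ae_mono (Measure.restrict_mono hED le_rfl)
      (ae_tendsto_mollify hDm hgi hη0 hηK)
    have hn : ∀ n, ∫⁻ x in shrink c (1 - t) D,
        ENNReal.ofReal (mollify ((η n).normed volume) D g x ^ 2) ≤ ENNReal.ofReal B := by
      intro n
      have hsm := contDiff_mollify (hκ n).smooth (hκ n).compact hDm hw
      have h1 := hC hEo (convex_shrink c (1 - t) hDc) (mul_pos (by linarith) hr) hrE
        (hED.trans hDR) hsm (S := S) (fun x hx => by
          have := (hκ n).abs_mollify_sub_le hDm hw (hball n x hx) (a := 0) (ε := S)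
            fun z hz => by rw [sub_zero]; exact hS z (hball n x hx hz)
          rwa [sub_zero] at this) i
      have e : ∀ x ∈ shrink c (1 - t) D,
          ENNReal.ofReal (mollify ((η n).normed volume) D g x ^ 2) =
          ENNReal.ofReal (pderivFun i (mollify ((η n).normed volume) D w) x ^ 2) := by
        intro x hx
        rw [← mixedDeriv_mollify_of_isWeakDeriv (hκ n).smooth (hκ n).compact (hκ n).support hDm hw
          hg (hball n x hx)]
        fin_cases i <;> rfl
      rw [setLIntegral_congr_fun hEo.measurableSet e]
      refine h1.trans (ENNReal.ofReal_le_ofReal ?_)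
      have h2 := setIntegral_sqDeriv_mollify_le (hκ n) hDm hEo.measurableSet hDb (hball n) hw hG hGL
      rw [← ofReal_integral_eq_lintegral_ofReal (integrableOn_of_continuous (hDb.subset hED)
        (continuous_sqDeriv (m + 1) hsm)).integrable
        (Filter.Eventually.of_forall fun x => sqDeriv_nonneg _ _ _),
        ENNReal.ofReal_le_ofReal_iff hJ0] at h2
      have h3 : (R / ((1 - t) * r)) ^ 4 ≤ 16 * (R / r) ^ 4 := by
        have : R / ((1 - t) * r) ≤ 2 * (R / r) := by
          rw [div_le_iff₀ (mul_pos (by linarith) hr)]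
          have : 2 * (R / r) * ((1 - t) * r) = 2 * (1 - t) * R := by field_simp
          rw [this]
          nlinarith
        calc (R / ((1 - t) * r)) ^ 4 ≤ (2 * (R / r)) ^ 4 :=
              pow_le_pow_left₀ (div_nonneg hR.le (mul_pos (by linarith) hr).le) this 4
          _ = 16 * (R / r) ^ 4 := by ring
      calc C * (R / ((1 - t) * r)) ^ 4 * (S ^ 2 + R ^ (2 * m) *
            ∫ y in shrink c (1 - t) D, sqDeriv (m + 1) (mollify ((η n).normed volume) D w) y)
          ≤ C * (16 * (R / r) ^ 4) * (S ^ 2 + R ^ (2 * m) *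
            ∑ a ∈ Finset.range (m + 2), ∫ x in D, G a x ^ 2) := by
            have h4 : 0 ≤ ∫ y in shrink c (1 - t) D,
                sqDeriv (m + 1) (mollify ((η n).normed volume) D w) y :=
              integral_nonneg fun x => sqDeriv_nonneg _ _ _
            gcongr
        _ = B := by rw [hB]; ring
    calc ∫⁻ x in shrink c (1 - t) D, ENNReal.ofReal (g x ^ 2)
        ≤ ∫⁻ x in shrink c (1 - t) D, Filter.liminf (fun n =>
            ENNReal.ofReal (mollify ((η n).normed volume) D g x ^ 2)) Filter.atTop := by
          refine lintegral_mono_ae ?_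
          filter_upwards [hae] with x hx
          exact (((ENNReal.continuous_ofReal.tendsto _).comp (hx.pow 2)).liminf_eq).ge
      _ ≤ Filter.liminf (fun n => ∫⁻ x in shrink c (1 - t) D,
            ENNReal.ofReal (mollify ((η n).normed volume) D g x ^ 2)) Filter.atTop := by
          refine lintegral_liminf_le' fun n => ?_
          have := (contDiff_mollify (hκ n).smooth (hκ n).compact hDm hgi).continuous
          exact ((this.pow 2).measurable.ennreal_ofReal).aemeasurable
      _ ≤ ENNReal.ofReal B :=
          Filter.liminf_le_of_frequently_le' (Filter.Frequently.of_forall hn)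
  -- exhaustion of the domain
  have hpos : ∀ n : ℕ, 0 < 1 - 1 / ((n : ℝ) + 2) := by
    intro n
    have : (0 : ℝ) ≤ n := n.cast_nonneg
    rw [sub_pos, div_lt_one (by positivity)]
    linarith
  have hU : (⋃ n : ℕ, shrink c (1 - 1 / ((n : ℝ) + 2)) D) = D := by
    refine Set.Subset.antisymm (Set.iUnion_subset fun n z hz => ?_) fun x hx => ?_
    · obtain ⟨x, hx, rfl⟩ := exists_eq_of_mem_shrink (hpos n).ne' hz
      exact hDc.add_smul_sub_mem hcD hx ⟨(hpos n).le, by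
        have : 0 ≤ 1 / ((n : ℝ) + 2) := by positivity
        linarith⟩
    · have h1 : Filter.Tendsto (fun n : ℕ => 1 - 1 / ((n : ℝ) + 2)) Filter.atTop (𝓝 (1 - 0)) := by
        refine tendsto_const_nhds.sub ?_
        refine ((tendsto_const_div_atTop_nhds_zero_nat (1 : ℝ)).comp
          (Filter.tendsto_add_atTop_nat 2)).congr fun n => ?_
        simp
      rw [sub_zero] at h1
      have h2 := ((h1.inv₀ one_ne_zero).smul_const (x - c)).const_add c
      rw [inv_one, one_smul, add_sub_cancel] at h2
      obtain ⟨n, hn⟩ := (h2.eventually (hDo.mem_nhds hx)).exists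
      exact Set.mem_iUnion.2 ⟨n, hn⟩
  have hmono : Monotone fun n : ℕ => shrink c (1 - 1 / ((n : ℝ) + 2)) D := by
    intro n k hnk
    refine shrink_mono (hpos n) ?_ hDc hcD
    gcongr
  rw [← ENNReal.ofReal_le_ofReal_iff hB0, ofReal_integral_eq_lintegral_ofReal
    hgL.integrable_sq (Filter.Eventually.of_forall fun x => sq_nonneg _)]
  conv_lhs => rw [← hU]
  rw [setLIntegral_iUnion_of_directed _ hmono.directed_le]
  refine iSup_le fun n => hshrink _ (by positivity) ?_
  rw [div_le_div_iff_of_pos_left one_pos (by positivity) two_pos]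
  have : (0 : ℝ) ≤ n := n.cast_nonneg
  linarith

/-! ### Comparison of polynomials -/

/-- A polynomial of degree at most `m` that is bounded on a disc is bounded on larger discs. -/
theorem exists_eval_bound (m : ℕ) (L : ℝ) : ∃ C : ℝ, 0 ≤ C ∧
    ∀ (p : MvPolynomial (Fin 2) ℝ) (z : Plane) (ρ A : ℝ),
      p ∈ MvPolynomial.restrictTotalDegree (Fin 2) ℝ m → 0 < ρ →
      (∀ x ∈ Metric.closedBall z ρ, |MvPolynomial.eval (fun j => x j) p| ≤ A) →
      ∀ x ∈ Metric.closedBall z (L * ρ), |MvPolynomial.eval (fun j => x j) p| ≤ C * A := by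
  obtain ⟨C, hC0, hC⟩ := exists_polynomial_bound m L
  refine ⟨C + 1, by positivity, fun p z ρ A hp hρ hA x hx => ?_⟩
  have hA0 : 0 ≤ A := (abs_nonneg _).trans (hA z (Metric.mem_closedBall_self hρ.le))
  rcases eq_or_ne x z with rfl | hxz
  · exact (hA _ (Metric.mem_closedBall_self hρ.le)).trans (by nlinarith)
  have hn : 0 < ‖x - z‖ := norm_pos_iff.2 (sub_ne_zero.2 hxz)
  -- restriction to the line through `z` and `x`
  set e : Plane := (ρ / ‖x - z‖) • (x - z) with he
  have hen : ‖e‖ = ρ := by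
    rw [he, norm_smul, Real.norm_eq_abs, abs_of_pos (by positivity), div_mul_cancel₀ _ hn.ne']
  set P : Polynomial ℝ := MvPolynomial.aeval
    (fun j => Polynomial.C (z j) + Polynomial.C (e j) * Polynomial.X) p with hP
  have hdeg : P.natDegree ≤ m := by
    rw [MvPolynomial.mem_restrictTotalDegree] at hp
    have := MvPolynomial.aeval_natDegree_le p hp
      (fun j => Polynomial.C (z j) + Polynomial.C (e j) * Polynomial.X) (n := 1) fun j => by
        rw [add_comm]; exact Polynomial.natDegree_linear_le
    simpa using this
  have hev : ∀ s, P.eval s = MvPolynomial.eval (fun j => (z + s • e) j) p := by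
    intro s
    rw [hP, MvPolynomial.aeval_def, ← Polynomial.coe_evalRingHom, MvPolynomial.hom_eval₂]
    rw [MvPolynomial.eval, MvPolynomial.coe_eval₂Hom]
    refine congrArg₂ (fun f g => MvPolynomial.eval₂ f g p) ?_ ?_
    · ext a
      simp only [RingHom.comp_apply, Polynomial.coe_evalRingHom, Polynomial.algebraMap_apply,
        Algebra.algebraMap_self, RingHom.id_apply, Polynomial.eval_C]
    · ext j
      simp only [Polynomial.coe_evalRingHom, Polynomial.eval_add, Polynomial.eval_mul,
        Polynomial.eval_C, Polynomial.eval_X, PiLp.add_apply, PiLp.smul_apply, smul_eq_mul]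
      ring
  have hb := (hC P A hdeg fun s hs => by
    rw [hev]
    refine hA _ ?_
    rw [Metric.mem_closedBall, dist_eq_norm, add_sub_cancel_left, norm_smul, hen,
      Real.norm_eq_abs, abs_of_nonneg hs.1]
    nlinarith [hs.2]).1 (‖x - z‖ / ρ) ⟨by
      have h1 : ‖x - z‖ ≤ L * ρ := by rw [← dist_eq_norm]; exact Metric.mem_closedBall.1 hx
      have h2 : 0 ≤ L := by
        by_contra h
        nlinarith [not_le.1 h]
      have h3 : 0 ≤ ‖x - z‖ / ρ := by positivity
      linarith, by
      rw [div_le_iff₀ hρ, ← dist_eq_norm]; exact Metric.mem_closedBall.1 hx⟩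
  have ex : z + (‖x - z‖ / ρ) • e = x := by
    rw [he, smul_smul, div_mul_div_cancel₀ hρ.ne', div_self hn.ne', one_smul, add_sub_cancel]
  rw [hev, ex] at hb
  linarith [mul_nonneg hC0 hA0]

/-! ### Triangles -/

theorem exists_affineBasis_eq {v : Fin 3 → Plane} (hv : AffineIndependent ℝ v) :
    ∃ b : AffineBasis (Fin 3) ℝ Plane, ⇑b = v :=
  ⟨⟨v, hv, hv.affineSpan_eq_top_iff_card_eq_finrank_add_one.2 (by simp)⟩, rfl⟩

theorem mem_triangle_iff (b : AffineBasis (Fin 3) ℝ Plane) (x : Plane) :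
    x ∈ triangle b ↔ ∀ i, 0 ≤ b.coord i x := by
  rw [triangle, b.convexHull_eq_nonneg_coord]
  rfl

theorem mem_interior_triangle_iff (b : AffineBasis (Fin 3) ℝ Plane) (x : Plane) :
    x ∈ interior (triangle b) ↔ ∀ i, 0 < b.coord i x := by
  rw [triangle, b.interior_convexHull]
  rfl

theorem convex_triangle (v : Fin 3 → Plane) : Convex ℝ (triangle v) := convex_convexHull ℝ _

theorem isCompact_triangle (v : Fin 3 → Plane) : IsCompact (triangle v) :=
  Set.Finite.isCompact_convexHull (𝕜 := ℝ) (Set.finite_range v)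

theorem isClosed_triangle (v : Fin 3 → Plane) : IsClosed (triangle v) :=
  (isCompact_triangle v).isClosed

theorem vertex_mem_triangle (v : Fin 3 → Plane) (i : Fin 3) : v i ∈ triangle v :=
  subset_convexHull ℝ _ (Set.mem_range_self i)

theorem dist_le_diam_triangle {v : Fin 3 → Plane} {x y : Plane} (hx : x ∈ triangle v)
    (hy : y ∈ triangle v) : dist x y ≤ Metric.diam (triangle v) :=
  Metric.dist_le_diam_of_mem (isCompact_triangle v).isBounded hx hy

theorem coord_le_one (b : AffineBasis (Fin 3) ℝ Plane) {x : Plane} (hx : x ∈ triangle b)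
    (i : Fin 3) : b.coord i x ≤ 1 := by
  rw [← b.sum_coord_apply_eq_one x]
  exact Finset.single_le_sum (f := fun i => b.coord i x)
    (fun j _ => (mem_triangle_iff b x).1 hx j) (Finset.mem_univ i)

/-- A disc in a triangle bounds the gradients of the barycentric coordinates. -/
theorem abs_coord_sub_le (b : AffineBasis (Fin 3) ℝ Plane) {c : Plane} {r : ℝ} (hr : 0 < r)
    (h : Metric.closedBall c r ⊆ triangle b) (i : Fin 3) (x y : Plane) :
    |b.coord i x - b.coord i y| ≤ dist x y / (2 * r) := by
  rcases eq_or_ne x y with rfl | hxy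
  · simp
  have hn : 0 < ‖x - y‖ := norm_pos_iff.2 (sub_ne_zero.2 hxy)
  set e : Plane := (r / ‖x - y‖) • (x - y) with he
  have hen : ‖e‖ = r := by
    rw [he, norm_smul, Real.norm_eq_abs, abs_of_pos (by positivity), div_mul_cancel₀ _ hn.ne']
  have h1 : c + e ∈ triangle b := h (by simp [hen])
  have h2 : c - e ∈ triangle b := h (by simp [hen])
  have h3 : b.coord i (c + e) - b.coord i (c - e) = 2 * (b.coord i).linear e := by
    rw [← vsub_eq_sub (b.coord i (c + e)), ← AffineMap.linearMap_vsub, vsub_eq_sub,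
      show c + e - (c - e) = (2 : ℝ) • e by module, map_smul, smul_eq_mul]
  have h4 : b.coord i x - b.coord i y = (‖x - y‖ / r) * (b.coord i).linear e := by
    rw [← vsub_eq_sub (b.coord i x), ← AffineMap.linearMap_vsub, vsub_eq_sub,
      ← smul_eq_mul, ← map_smul, he, smul_smul, div_mul_div_cancel₀ hr.ne', div_self hn.ne',
      one_smul]
  have h5 : |2 * (b.coord i).linear e| ≤ 1 := by
    rw [← h3, abs_le]
    have a1 := (mem_triangle_iff b _).1 h1 i
    have a2 := (mem_triangle_iff b _).1 h2 i
    have a3 := coord_le_one b h1 i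
    have a4 := coord_le_one b h2 i
    constructor <;> linarith
  rw [abs_mul, abs_of_pos two_pos] at h5
  rw [h4, abs_mul, abs_of_pos (by positivity), dist_eq_norm]
  calc ‖x - y‖ / r * |(b.coord i).linear e| ≤ ‖x - y‖ / r * (1 / 2) := by
        gcongr; linarith
    _ = ‖x - y‖ / (2 * r) := by field_simp

/-- The sides of a triangle are at least as long as the diameters of discs in the triangle. -/
theorem two_mul_radius_le_dist (b : AffineBasis (Fin 3) ℝ Plane) {c : Plane} {r : ℝ} (hr : 0 < r)
    (h : Metric.closedBall c r ⊆ triangle b) {i j : Fin 3} (hij : i ≠ j) :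
    2 * r ≤ dist (b i) (b j) := by
  have h1 := abs_coord_sub_le b hr h i (b i) (b j)
  rw [b.coord_apply_eq, b.coord_apply_ne hij, sub_zero, abs_one, le_div_iff₀ (by positivity)] at h1
  linarith

/-- A nondegenerate triangle contains a disc of at least half the inradius. -/
theorem exists_closedBall_subset_triangle {v : Fin 3 → Plane} (hv : AffineIndependent ℝ v) {σ : ℝ}
    (hσ : Metric.diam (triangle v) / inradius (triangle v) ≤ σ) :
    ∃ c r, 0 < r ∧ Metric.closedBall c r ⊆ triangle v ∧
      Metric.diam (triangle v) ≤ 2 * σ * r := by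
  obtain ⟨b, rfl⟩ := exists_affineBasis_eq hv
  set S := {r : ℝ | ∃ c, Metric.closedBall c r ⊆ triangle b} with hS
  have hbdd : BddAbove S := by
    refine ⟨Metric.diam (triangle b), ?_⟩
    rintro r ⟨c, hc⟩
    rcases le_or_gt r 0 with h0 | h0
    · exact h0.trans Metric.diam_nonneg
    · have h1 := two_mul_radius_le_dist b h0 hc (show (0 : Fin 3) ≠ 1 by decide)
      have h2 := dist_le_diam_triangle (vertex_mem_triangle b 0) (vertex_mem_triangle b 1)
      linarith
  obtain ⟨x, hx⟩ : (interior (triangle b)).Nonempty :=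
    ⟨_, AffineBasis.centroid_mem_interior_convexHull b⟩
  obtain ⟨r₀, hr₀, hr₀'⟩ := Metric.isOpen_iff.1 isOpen_interior x hx
  have hr₀S : r₀ / 2 ∈ S := ⟨x, (Metric.closedBall_subset_ball (by linarith)).trans
    (hr₀'.trans interior_subset)⟩
  have hpos : 0 < inradius (triangle b) :=
    (half_pos hr₀).trans_le (le_csSup hbdd hr₀S)
  obtain ⟨r, ⟨c, hc⟩, hr⟩ := exists_lt_of_lt_csSup ⟨_, hr₀S⟩
    (show inradius (triangle b) / 2 < sSup S from half_lt_self hpos)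
  refine ⟨c, r, (half_pos hpos).trans hr, hc, ?_⟩
  have hσ0 : 0 ≤ σ := (div_nonneg Metric.diam_nonneg hpos.le).trans hσ
  rw [div_le_iff₀ hpos] at hσ
  nlinarith

theorem exists_third_index {i j : Fin 3} (hij : i ≠ j) :
    ∃ k, k ≠ i ∧ k ≠ j ∧ ∀ l, l = i ∨ l = j ∨ l = k := by
  revert i j
  decide

theorem sum_coord_third {i j k : Fin 3} (hij : i ≠ j) (hki : k ≠ i) (hkj : k ≠ j)
    (f : Fin 3 → ℝ) : ∑ l, f l = f i + f j + f k := by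
  have : (Finset.univ : Finset (Fin 3)) = {i, j, k} := by
    revert i j k; decide
  rw [this, Finset.sum_insert (by simp [hij, hki.symm]), Finset.sum_pair hkj.symm, add_assoc]

/-- An affine function that vanishes at two vertices is a multiple of the barycentric coordinate
of the third. -/
theorem eq_mul_coord (b : AffineBasis (Fin 3) ℝ Plane) {i j k : Fin 3} (hij : i ≠ j)
    (hki : k ≠ i) (hkj : k ≠ j) (f : Plane →ᵃ[ℝ] ℝ) (hi : f (b i) = 0) (hj : f (b j) = 0)
    (x : Plane) : f x = f (b k) * b.coord k x := by
  have h1 : f x = ∑ l, b.coord l x * f (b l) := by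
    conv_lhs => rw [← b.affineCombination_coord_eq_self x]
    rw [Finset.map_affineCombination _ _ _ (b.sum_coord_apply_eq_one x),
      Finset.affineCombination_eq_linear_combination _ _ _ (b.sum_coord_apply_eq_one x)]
    rfl
  rw [h1, sum_coord_third hij hki hkj, hi, hj]
  ring

/-- The midpoint of a common side of two triangles which meet only along that side is the center of
a disc covered by the two triangles. -/
theorem closedBall_midpoint_subset_union (b b' : AffineBasis (Fin 3) ℝ Plane)
    (hne : Set.range b ≠ Set.range b')
    (hinter : triangle b ∩ triangle b' = convexHull ℝ (Set.range b ∩ Set.range b'))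
    {i j i' j' : Fin 3} (hij : i ≠ j) (hi : b i = b' i') (hj : b j = b' j')
    {c c' : Plane} {r : ℝ} (hr : 0 < r) (hc : Metric.closedBall c r ⊆ triangle b)
    (hc' : Metric.closedBall c' r ⊆ triangle b') :
    Metric.closedBall (midpoint ℝ (b i) (b j)) r ⊆ triangle b ∪ triangle b' := by
  have hij' : i' ≠ j' := fun h => hij (b.ind.injective (by rw [hi, hj, h]))
  obtain ⟨k, hki, hkj, hk⟩ := exists_third_index hij
  obtain ⟨k', hki', hkj', hk'⟩ := exists_third_index hij'
  set z := midpoint ℝ (b i) (b j) with hz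
  have hz' : z = midpoint ℝ (b' i') (b' j') := by rw [hz, hi, hj]
  have hbk : b k ∉ Set.range b' := by
    intro h
    refine hne (Set.eq_of_subset_of_ncard_le ?_ ?_ (Set.finite_range _))
    · rintro _ ⟨l, rfl⟩
      rcases hk l with rfl | rfl | rfl
      · exact ⟨i', hi.symm⟩
      · exact ⟨j', hj.symm⟩
      · exact h
    · rw [← Set.image_univ, ← Set.image_univ, Set.ncard_image_of_injective _ b.ind.injective,
        Set.ncard_image_of_injective _ b'.ind.injective]
  -- on the intersection, the coordinate of the vertex opposite to the common side vanishes
  have hzero : ∀ y ∈ triangle b ∩ triangle b', b.coord k y = 0 := by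
    intro y hy
    rw [hinter] at hy
    have hconv : Convex ℝ {y | b.coord k y = 0} :=
      (convex_singleton (0 : ℝ)).affine_preimage (b.coord k)
    refine convexHull_min ?_ hconv hy
    rintro _ ⟨⟨l, rfl⟩, hl⟩
    refine b.coord_apply_ne fun h => hbk ?_
    rwa [h]
  have hmid : ∀ l, b.coord l z = (b.coord l (b i) + b.coord l (b j)) / 2 := fun l => by
    rw [hz, AffineMap.map_midpoint, midpoint_eq_smul_add, smul_eq_mul, invOf_eq_inv]; ring
  have hmid' : ∀ l, b'.coord l z = (b'.coord l (b' i') + b'.coord l (b' j')) / 2 := fun l => by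
    rw [hz', AffineMap.map_midpoint, midpoint_eq_smul_add, smul_eq_mul, invOf_eq_inv]; ring
  have hside : ∀ (b : AffineBasis (Fin 3) ℝ Plane) (c : Plane),
      Metric.closedBall c r ⊆ triangle b → ∀ l, b.coord l z = 1 / 2 →
      ∀ x ∈ Metric.closedBall z r, 0 ≤ b.coord l x := by
    intro b c hc l hl x hx
    have h1 := (abs_le.1 (abs_coord_sub_le b hr hc l x z)).1
    have h2 : dist x z / (2 * r) ≤ 1 / 2 := by
      rw [div_le_div_iff₀ (by positivity) two_pos]
      have := Metric.mem_closedBall.1 hx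
      linarith
    linarith
  have hzi : b.coord i z = 1 / 2 := by
    rw [hmid, b.coord_apply_eq, b.coord_apply_ne hij]; norm_num
  have hzj : b.coord j z = 1 / 2 := by
    rw [hmid, b.coord_apply_eq, b.coord_apply_ne hij.symm]; norm_num
  have hzk : b.coord k z = 0 := by
    rw [hmid, b.coord_apply_ne hki, b.coord_apply_ne hkj]; norm_num
  have hzi' : b'.coord i' z = 1 / 2 := by
    rw [hmid', b'.coord_apply_eq, b'.coord_apply_ne hij']; norm_num
  have hzj' : b'.coord j' z = 1 / 2 := by
    rw [hmid', b'.coord_apply_eq, b'.coord_apply_ne hij'.symm]; norm_num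
  set μ := b'.coord k' (b k) with hμ
  have hprop : ∀ x, b'.coord k' x = μ * b.coord k x := fun x =>
    eq_mul_coord b hij hki hkj (b'.coord k') (by rw [hi, b'.coord_apply_ne hki'])
      (by rw [hj, b'.coord_apply_ne hkj']) x
  -- otherwise the triangles would overlap near the midpoint
  have hμ0 : μ ≤ 0 := by
    by_contra hpos
    push Not at hpos
    have hd : 0 < dist (b k) z := by
      refine dist_pos.2 fun h => ?_
      have := b.coord_apply_eq k
      rw [h, hzk] at this
      norm_num at this
    set s := min 1 (r / dist (b k) z) with hs
    have hs0 : 0 < s := by positivity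
    have hs1 : s ≤ 1 := min_le_left _ _
    set y := AffineMap.lineMap z (b k) s with hy
    have hyk : b.coord k y = s := by
      rw [hy, AffineMap.apply_lineMap, hzk, b.coord_apply_eq, AffineMap.lineMap_apply]
      simp
    have hyr : y ∈ Metric.closedBall z r := by
      rw [Metric.mem_closedBall, hy, dist_lineMap_left, Real.norm_eq_abs, abs_of_pos hs0, dist_comm]
      calc s * dist (b k) z ≤ r / dist (b k) z * dist (b k) z := by
            gcongr; exact min_le_right _ _
        _ = r := div_mul_cancel₀ _ hd.ne'
    have hyT : y ∈ triangle b := by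
      refine (mem_triangle_iff b y).2 fun l => ?_
      rcases hk l with rfl | rfl | rfl
      · exact hside b c hc _ hzi y hyr
      · exact hside b c hc _ hzj y hyr
      · rw [hyk]; exact hs0.le
    have hyT' : y ∈ triangle b' := by
      refine (mem_triangle_iff b' y).2 fun l => ?_
      rcases hk' l with rfl | rfl | rfl
      · exact hside b' c' hc' _ hzi' y hyr
      · exact hside b' c' hc' _ hzj' y hyr
      · rw [hprop, hyk]; positivity
    have := hzero y ⟨hyT, hyT'⟩
    rw [hyk] at this
    linarith
  intro x hx
  rcases le_or_gt 0 (b.coord k x) with h | h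
  · left
    refine (mem_triangle_iff b x).2 fun l => ?_
    rcases hk l with rfl | rfl | rfl
    · exact hside b c hc _ hzi x hx
    · exact hside b c hc _ hzj x hx
    · exact h
  · right
    refine (mem_triangle_iff b' x).2 fun l => ?_
    rcases hk' l with rfl | rfl | rfl
    · exact hside b' c' hc' _ hzi' x hx
    · exact hside b' c' hc' _ hzj' x hx
    · rw [hprop]; exact mul_nonneg_of_nonpos_of_nonpos hμ0 h.le

/-- Near each of its points, a convex set contains homothetic copies of the discs it contains. -/
theorem exists_closedBall_subset_inter {T : Set Plane} (hT : Convex ℝ T) {c z : Plane} {r H : ℝ}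
    (hr : 0 < r) (hc : Metric.closedBall c r ⊆ T) (hz : z ∈ T) (hH : dist c z ≤ H)
    (hrH : r ≤ H) : ∃ y, dist y z ≤ r ∧
      Metric.closedBall y (r ^ 2 / (4 * H)) ⊆ T ∩ Metric.ball z r := by
  have hH0 : 0 < H := hr.trans_le hrH
  set μ := r / (4 * H) with hμ
  have hμ0 : 0 < μ := by positivity
  have hμH : μ * H = r / 4 := by rw [hμ]; field_simp
  have hμ1 : μ ≤ 1 := by
    rw [hμ, div_le_one (by positivity)]; linarith
  set y := z + μ • (c - z) with hy
  have hyz : dist y z ≤ r / 4 := by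
    rw [hy, dist_eq_norm, add_sub_cancel_left, norm_smul, Real.norm_eq_abs, abs_of_pos hμ0,
      ← dist_eq_norm, ← hμH]
    gcongr
  refine ⟨y, by linarith, fun x hx => ⟨?_, ?_⟩⟩
  · have hx1 : dist x y ≤ μ * r := by
      refine (Metric.mem_closedBall.1 hx).trans_eq ?_
      rw [hμ]; ring
    have hw : c + μ⁻¹ • (x - y) ∈ T := by
      refine hc ?_
      rw [Metric.mem_closedBall, dist_eq_norm, add_sub_cancel_left, norm_smul, norm_inv,
        Real.norm_eq_abs, abs_of_pos hμ0, inv_mul_le_iff₀ hμ0, ← dist_eq_norm]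
      exact hx1
    have e : x = z + μ • (c + μ⁻¹ • (x - y) - z) := by
      rw [add_sub_right_comm, smul_add, smul_smul, mul_inv_cancel₀ hμ0.ne', hy]
      module
    rw [e]
    exact hT.add_smul_sub_mem hz hw ⟨hμ0.le, hμ1⟩
  · have h1 : r ^ 2 / (4 * H) ≤ r / 4 := by
      rw [div_le_div_iff₀ (by positivity) (by norm_num)]
      nlinarith
    have := dist_triangle x y z
    have := Metric.mem_closedBall.1 hx
    rw [Metric.mem_ball]
    linarith

/-! ### Weak derivatives: restriction, uniqueness, smooth functions -/

theorem IsTestFunction.mono {D E : Set Plane} (hDE : D ⊆ E) {φ : Plane → ℝ}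
    (h : IsTestFunction D φ) : IsTestFunction E φ :=
  ⟨h.smooth, h.compact, h.support.trans hDE⟩

theorem tsupport_pderivFun_subset (i : Fin 2) (φ : Plane → ℝ) :
    tsupport (pderivFun i φ) ⊆ tsupport φ :=
  tsupport_fderiv_apply_subset ℝ _

theorem tsupport_mixedDeriv_subset (a b : ℕ) {φ : Plane → ℝ} (h : ContDiff ℝ ∞ φ) :
    tsupport (mixedDeriv a b φ) ⊆ tsupport φ := by
  induction a with
  | zero =>
    induction b with
    | zero => exact subset_rfl
    | succ b ih =>
      rw [mixedDeriv_add_one_right 0 b h]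
      exact (tsupport_pderivFun_subset _ _).trans ih
  | succ a ih =>
    rw [mixedDeriv_add_one_left]
    exact (tsupport_pderivFun_subset _ _).trans ih

theorem setIntegral_mul_eq_of_tsupport_subset {D E : Set Plane} (hE : MeasurableSet E)
    (hDE : D ⊆ E) (f : Plane → ℝ) {ψ : Plane → ℝ} (hψ : tsupport ψ ⊆ D) :
    ∫ x in E, f x * ψ x = ∫ x in D, f x * ψ x :=
  setIntegral_eq_of_subset_of_forall_sdiff_eq_zero hE hDE fun x hx => by
    rw [image_eq_zero_of_notMem_tsupport fun h => hx.2 (hψ h), mul_zero]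

theorem IsWeakDeriv.mono {D E : Set Plane} (hE : MeasurableSet E) (hDE : D ⊆ E) {a b : ℕ}
    {f g : Plane → ℝ} (h : IsWeakDeriv E a b f g) : IsWeakDeriv D a b f g where
  locInt := h.locInt.mono_set hDE
  locInt' := h.locInt'.mono_set hDE
  integral_eq φ hφ := by
    rw [← setIntegral_mul_eq_of_tsupport_subset hE hDE f
        ((tsupport_mixedDeriv_subset a b hφ.smooth).trans hφ.support),
      ← setIntegral_mul_eq_of_tsupport_subset hE hDE g hφ.support]
    exact h.integral_eq φ (hφ.mono hDE)

theorem integrable_mul_test {D : Set Plane} {f ψ : Plane → ℝ}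
    (hf : LocallyIntegrableOn f D) (hψ : Continuous ψ) (hc : HasCompactSupport ψ)
    (hs : tsupport ψ ⊆ D) : Integrable fun x => f x * ψ x := by
  have h1 : IntegrableOn (fun x => f x * ψ x) (tsupport ψ) :=
    (hf.integrableOn_compact_subset hs hc).mul_continuousOn hψ.continuousOn hc
  refine (integrableOn_iff_integrable_of_support_subset fun x hx => ?_).1 h1
  exact subset_tsupport ψ (right_ne_zero_of_mul hx)

theorem IsWeakDeriv.sub {D : Set Plane} {a b : ℕ} {f g f' g' : Plane → ℝ}
    (h : IsWeakDeriv D a b f g) (h' : IsWeakDeriv D a b f' g') :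
    IsWeakDeriv D a b (fun x => f x - f' x) fun x => g x - g' x where
  locInt := h.locInt.sub h'.locInt
  locInt' := h.locInt'.sub h'.locInt'
  integral_eq φ hφ := by
    have hs := tsupport_mixedDeriv_subset a b hφ.smooth
    have hc : HasCompactSupport (mixedDeriv a b φ) :=
      hasCompactSupport_mixedDeriv a b hφ.smooth hφ.compact
    have hcont := continuous_mixedDeriv a b hφ.smooth
    simp only [sub_mul]
    rw [integral_sub, integral_sub, h.integral_eq φ hφ, h'.integral_eq φ hφ, mul_sub]
    · exact (integrable_mul_test h.locInt' hφ.smooth.continuous hφ.compact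
        hφ.support).integrableOn
    · exact (integrable_mul_test h'.locInt' hφ.smooth.continuous hφ.compact
        hφ.support).integrableOn
    · exact (integrable_mul_test h.locInt hcont hc (hs.trans hφ.support)).integrableOn
    · exact (integrable_mul_test h'.locInt hcont hc (hs.trans hφ.support)).integrableOn

theorem IsWeakDeriv.ae_eq {D : Set Plane} (hD : IsOpen D) {a b : ℕ} {f g g' : Plane → ℝ}
    (h : IsWeakDeriv D a b f g) (h' : IsWeakDeriv D a b f g') :
    g =ᵐ[volume.restrict D] g' := by
  have h0 : ∀ᵐ x, x ∈ D → g x - g' x = 0 := by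
    refine hD.ae_eq_zero_of_integral_contDiff_smul_eq_zero (h.locInt'.sub h'.locInt') ?_
    intro φ hφ hc hs
    have ht : IsTestFunction D φ := ⟨hφ, hc, hs⟩
    have h1 := h.integral_eq φ ht
    rw [h'.integral_eq φ ht] at h1
    have h2 : ∫ x in D, g' x * φ x = ∫ x in D, g x * φ x :=
      mul_left_cancel₀ (pow_ne_zero _ (by norm_num)) h1
    have h3 := setIntegral_mul_eq_of_tsupport_subset MeasurableSet.univ (Set.subset_univ D)
      (fun x => g x - g' x) hs
    rw [Measure.restrict_univ] at h3
    simp only [smul_eq_mul, mul_comm (φ _)]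
    rw [h3]
    simp only [sub_mul]
    rw [integral_sub, h2, sub_self]
    · exact (integrable_mul_test h.locInt' hφ.continuous hc hs).integrableOn
    · exact (integrable_mul_test h'.locInt' hφ.continuous hc hs).integrableOn
  rw [Filter.EventuallyEq, ae_restrict_iff' hD.measurableSet]
  filter_upwards [h0] with x hx hxD
  exact sub_eq_zero.1 (hx hxD)

theorem integral_mul_pderivFun {f ψ : Plane → ℝ} (hf : ContDiff ℝ ∞ f) (hψ : ContDiff ℝ ∞ ψ)
    (hc : HasCompactSupport ψ) (i : Fin 2) :
    ∫ x, f x * pderivFun i ψ x = -∫ x, pderivFun i f x * ψ x := by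
  have hint : ∀ {f ψ : Plane → ℝ}, Continuous f → Continuous ψ → HasCompactSupport ψ →
      Integrable fun x => f x * ψ x := fun hf hψ hc =>
    (hf.mul hψ).integrable_of_hasCompactSupport hc.mul_left
  exact integral_mul_fderiv_eq_neg_fderiv_mul_of_integrable
    (hint (contDiff_pderivFun i hf).continuous hψ.continuous hc)
    (hint hf.continuous (contDiff_pderivFun i hψ).continuous (hasCompactSupport_pderivFun i hc))
    (hint hf.continuous hψ.continuous hc)
    (fun x _ => hf.differentiable (by simp) x) (fun x _ => hψ.differentiable (by simp) x)

theorem integral_mul_mixedDeriv (a b : ℕ) {f φ : Plane → ℝ} (hf : ContDiff ℝ ∞ f)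
    (hφ : ContDiff ℝ ∞ φ) (hc : HasCompactSupport φ) :
    ∫ x, f x * mixedDeriv a b φ x = (-1) ^ (a + b) * ∫ x, mixedDeriv a b f x * φ x := by
  induction a generalizing f with
  | zero =>
    induction b generalizing f with
    | zero => simp [mixedDeriv_zero]
    | succ b ih =>
      rw [mixedDeriv_add_one_right 0 b hφ,
        integral_mul_pderivFun hf (contDiff_mixedDeriv 0 b hφ)
          (hasCompactSupport_mixedDeriv 0 b hφ hc),
        ih (contDiff_pderivFun 1 hf), mixedDeriv_pderivFun_one]
      ring
  | succ a ih =>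
    rw [mixedDeriv_add_one_left, integral_mul_pderivFun hf (contDiff_mixedDeriv a b hφ)
        (hasCompactSupport_mixedDeriv a b hφ hc),
      ih (contDiff_pderivFun 0 hf), mixedDeriv_pderivFun_zero a b hf]
    ring

theorem isWeakDeriv_mixedDeriv (D : Set Plane) (a b : ℕ) {f : Plane → ℝ} (hf : ContDiff ℝ ∞ f) :
    IsWeakDeriv D a b f (mixedDeriv a b f) := by
  have h : IsWeakDeriv Set.univ a b f (mixedDeriv a b f) :=
    { locInt := hf.continuous.locallyIntegrable.locallyIntegrableOn _
      locInt' := (continuous_mixedDeriv a b hf).locallyIntegrable.locallyIntegrableOn _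
      integral_eq := fun φ hφ => by
        rw [Measure.restrict_univ]
        exact integral_mul_mixedDeriv a b hf hφ.smooth hφ.compact }
  exact h.mono MeasurableSet.univ (Set.subset_univ D)

theorem IsWeakDeriv.weakDeriv {D : Set Plane} {a b : ℕ} {f g : Plane → ℝ}
    (h : IsWeakDeriv D a b f g) : IsWeakDeriv D a b f (weakDeriv D a b f) := by
  have h1 : ∃ g, IsWeakDeriv D a b f g := ⟨g, h⟩
  rw [StokesDG.weakDeriv, dif_pos h1]
  exact h1.choose_spec

/-! ### Derivatives of polynomials -/

theorem contDiff_eval (p : MvPolynomial (Fin 2) ℝ) :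
    ContDiff ℝ ∞ fun x : Plane => MvPolynomial.eval (fun j => x j) p := by
  induction p using MvPolynomial.induction_on with
  | C a => simpa using contDiff_const
  | add p q hp hq => simpa using hp.add hq
  | mul_X p i hp =>
    simp only [map_mul, MvPolynomial.eval_X]
    exact hp.mul (EuclideanSpace.proj (𝕜 := ℝ) i).contDiff

theorem pderivFun_eval (i : Fin 2) (p : MvPolynomial (Fin 2) ℝ) :
    pderivFun i (fun x : Plane => MvPolynomial.eval (fun j => x j) p) =
      fun x => MvPolynomial.eval (fun j => x j) (MvPolynomial.pderiv i p) := by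
  induction p using MvPolynomial.induction_on with
  | C a => ext x; simp [pderivFun]
  | add p q hp hq =>
    simp only [map_add]
    rw [pderivFun_add i ((contDiff_eval p).differentiable (by simp))
      ((contDiff_eval q).differentiable (by simp)), hp, hq]
  | mul_X p k hp =>
    ext x
    have hd := ((contDiff_eval p).differentiable (by simp) x).hasFDerivAt
    have hX : HasFDerivAt (fun x : Plane => x k) (EuclideanSpace.proj (𝕜 := ℝ) k) x :=
      (EuclideanSpace.proj (𝕜 := ℝ) k).hasFDerivAt
    have h1 := (hd.mul hX).fderiv
    have h2 := congrFun hp x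
    simp only [pderivFun] at h2 ⊢
    simp only [map_mul, MvPolynomial.eval_X, MvPolynomial.pderiv_mul, MvPolynomial.pderiv_X]
    rw [show (fun x : Plane => MvPolynomial.eval (fun j => x j) p * x k) =
      (fun x : Plane => MvPolynomial.eval (fun j => x j) p) * fun x : Plane => x k from rfl, h1]
    simp only [add_apply, smul_apply, h2, map_add,
      map_mul, MvPolynomial.eval_X, smul_eq_mul, PiLp.proj_apply, PiLp.single_apply,
      Pi.single_apply]
    split_ifs <;> simp_all <;> ring

theorem mixedDeriv_eval (a b : ℕ) (p : MvPolynomial (Fin 2) ℝ) :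
    mixedDeriv a b (fun x : Plane => MvPolynomial.eval (fun j => x j) p) =
      fun x => MvPolynomial.eval (fun j => x j)
        ((MvPolynomial.pderiv 0)^[a] ((MvPolynomial.pderiv 1)^[b] p)) := by
  have h : ∀ (i : Fin 2) (n : ℕ) (p : MvPolynomial (Fin 2) ℝ),
      (pderivFun i)^[n] (fun x : Plane => MvPolynomial.eval (fun j => x j) p) =
        fun x => MvPolynomial.eval (fun j => x j) ((MvPolynomial.pderiv i)^[n] p) := by
    intro i n
    induction n with
    | zero => intro p; rfl
    | succ n ih => intro p; rw [Function.iterate_succ_apply, pderivFun_eval, ih]; rfl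
  rw [mixedDeriv, h, h]

theorem pderiv_mem_restrictTotalDegree (i : Fin 2) (k : ℕ) {p : MvPolynomial (Fin 2) ℝ}
    (hp : p ∈ MvPolynomial.restrictTotalDegree (Fin 2) ℝ (k + 1)) :
    MvPolynomial.pderiv i p ∈ MvPolynomial.restrictTotalDegree (Fin 2) ℝ k := by
  rw [MvPolynomial.mem_restrictTotalDegree] at hp
  rw [p.as_sum, map_sum]
  refine Submodule.sum_mem _ fun s hs => ?_
  rw [MvPolynomial.pderiv_monomial]
  rcases Nat.eq_zero_or_pos (s i) with h0 | h0
  · simp [h0]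
  · rw [MvPolynomial.mem_restrictTotalDegree]
    refine (MvPolynomial.totalDegree_monomial_le _ _).trans ?_
    have h1 := (MvPolynomial.le_totalDegree hs).trans hp
    have h2 : s = (s - Finsupp.single i 1) + Finsupp.single i 1 :=
      (tsub_add_cancel_of_le (Finsupp.single_le_iff.2 h0)).symm
    rw [h2, Finsupp.sum_add_index' (fun _ => rfl) (fun _ _ _ => rfl),
      Finsupp.sum_single_index rfl] at h1
    change (s - Finsupp.single i 1).sum (fun _ e => e) ≤ k
    omega

theorem pderiv_eq_zero_of_mem (i : Fin 2) {p : MvPolynomial (Fin 2) ℝ}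
    (hp : p ∈ MvPolynomial.restrictTotalDegree (Fin 2) ℝ 0) : MvPolynomial.pderiv i p = 0 := by
  rw [MvPolynomial.mem_restrictTotalDegree, Nat.le_zero,
    MvPolynomial.totalDegree_eq_zero_iff_eq_C] at hp
  rw [hp, MvPolynomial.pderiv_C]

theorem iterate_pderiv_mem (i : Fin 2) (n k : ℕ) {p : MvPolynomial (Fin 2) ℝ}
    (hp : p ∈ MvPolynomial.restrictTotalDegree (Fin 2) ℝ (k + n)) :
    (MvPolynomial.pderiv i)^[n] p ∈ MvPolynomial.restrictTotalDegree (Fin 2) ℝ k := by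
  induction n generalizing p with
  | zero => exact hp
  | succ n ih => exact ih (pderiv_mem_restrictTotalDegree i _ hp)

theorem mixedDeriv_eval_eq_zero {a b m : ℕ} (hab : a + b = m + 1) {p : MvPolynomial (Fin 2) ℝ}
    (hp : p ∈ MvPolynomial.restrictTotalDegree (Fin 2) ℝ m) :
    mixedDeriv a b (fun x : Plane => MvPolynomial.eval (fun j => x j) p) = fun _ => 0 := by
  rw [mixedDeriv_eval]
  have h : (MvPolynomial.pderiv 0)^[a] ((MvPolynomial.pderiv 1)^[b] p) = 0 := by
    cases a with
    | zero =>
      obtain rfl : b = m + 1 := by omega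
      rw [Function.iterate_zero, id, Function.iterate_succ_apply']
      exact pderiv_eq_zero_of_mem 1 (iterate_pderiv_mem 1 m 0 (by rwa [zero_add]))
    | succ a =>
      obtain rfl : m = a + b := by omega
      rw [Function.iterate_succ_apply']
      refine pderiv_eq_zero_of_mem 0 (iterate_pderiv_mem 0 a 0 ?_)
      rw [zero_add]
      exact iterate_pderiv_mem 1 b a hp
  simp [h]

/-! ### Solenoidal Sobolev fields -/

/-- A weakly divergence-free field, continuous up to the boundary, whose weak derivatives
`G i a = ∂₀^a ∂₁^(m+1-a) u_i` of order `m + 1` lie in `L²(D)`. -/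
structure IsSolenoidalSobolev (m : ℕ) (D : Set Plane) (u : Plane → Plane)
    (G : Fin 2 → ℕ → Plane → ℝ) : Prop where
  cont : ContinuousOn u (closure D)
  weak : ∀ i, ∀ a ≤ m + 1, IsWeakDeriv D a (m + 1 - a) (fun x => u x i) (G i a)
  memLp : ∀ i, ∀ a ≤ m + 1, MemLp (G i a) 2 (volume.restrict D)
  solenoidal : IsWeaklySolenoidal D u

/-- The sum of the squares of all derivatives of order `m + 1` of both components. -/
def density (m : ℕ) (G : Fin 2 → ℕ → Plane → ℝ) (x : Plane) : ℝ :=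
  ∑ i, ∑ a ∈ Finset.range (m + 2), G i a x ^ 2

theorem density_nonneg (m : ℕ) (G : Fin 2 → ℕ → Plane → ℝ) (x : Plane) : 0 ≤ density m G x :=
  Finset.sum_nonneg fun _ _ => Finset.sum_nonneg fun _ _ => sq_nonneg _

theorem IsWeaklySolenoidal.mono {D E : Set Plane} (hE : MeasurableSet E) (hDE : D ⊆ E)
    {u : Plane → Plane} (h : IsWeaklySolenoidal E u) : IsWeaklySolenoidal D u := by
  intro φ hφ
  rw [← h φ (hφ.mono hDE)]
  refine (setIntegral_eq_of_subset_of_forall_sdiff_eq_zero hE hDE fun x hx => ?_).symm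
  have h0 : ∀ i, pderivFun i φ x = 0 := fun i =>
    image_eq_zero_of_notMem_tsupport fun h => hx.2 (hφ.support (tsupport_pderivFun_subset i φ h))
  rw [h0, h0, mul_zero, mul_zero, add_zero]

namespace IsSolenoidalSobolev

variable {m : ℕ} {D E : Set Plane} {u : Plane → Plane} {G : Fin 2 → ℕ → Plane → ℝ}

theorem mono (h : IsSolenoidalSobolev m E u G) (hE : MeasurableSet E) (hDE : D ⊆ E) :
    IsSolenoidalSobolev m D u G where
  cont := h.cont.mono (closure_mono hDE)
  weak i a ha := (h.weak i a ha).mono hE hDE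
  memLp i a ha := (h.memLp i a ha).mono_measure (Measure.restrict_mono hDE le_rfl)
  solenoidal := h.solenoidal.mono hE hDE

theorem integrableOn_sq (h : IsSolenoidalSobolev m D u G) (i : Fin 2) {a : ℕ}
    (ha : a ∈ Finset.range (m + 2)) : IntegrableOn (fun x => G i a x ^ 2) D :=
  (h.memLp i a (by have := Finset.mem_range.1 ha; omega)).integrable_sq

theorem integrableOn_density (h : IsSolenoidalSobolev m D u G) :
    IntegrableOn (density m G) D :=
  integrable_finsetSum _ fun i _ => integrable_finsetSum _ fun _ ha => h.integrableOn_sq i ha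

theorem integral_density (h : IsSolenoidalSobolev m D u G) :
    ∫ x in D, density m G x = ∑ i, ∑ a ∈ Finset.range (m + 2), ∫ x in D, G i a x ^ 2 := by
  simp only [density]
  rw [integral_finsetSum _ fun i _ => integrable_finsetSum _ fun _ ha => h.integrableOn_sq i ha]
  exact Finset.sum_congr rfl fun i _ => integral_finsetSum _ fun _ ha => h.integrableOn_sq i ha

theorem sum_integral_le (h : IsSolenoidalSobolev m D u G) (i : Fin 2) :
    ∑ a ∈ Finset.range (m + 2), ∫ x in D, G i a x ^ 2 ≤ ∫ x in D, density m G x := by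
  rw [h.integral_density]
  exact Finset.single_le_sum
    (f := fun i => ∑ a ∈ Finset.range (m + 2), ∫ x in D, G i a x ^ 2)
    (fun _ _ => Finset.sum_nonneg fun _ _ => integral_nonneg fun _ => sq_nonneg _)
    (Finset.mem_univ i)

/-- Local approximation on a convex set that contains a disc of radius `ρ` and has diameter of
order `H`. -/
theorem exists_approx (h : IsSolenoidalSobolev m D u G) (hm : 1 ≤ m) (hD : IsOpen D)
    (hDc : Convex ℝ D) {c c' : Plane} {ρ H J ε : ℝ} (hρ : 0 < ρ) (hρD : Metric.ball c ρ ⊆ D)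
    (hDH : D ⊆ Metric.closedBall c' H) (hJ : ∫ x in D, density m G x ≤ J) (hε : 0 < ε) :
    ∃ q ∈ StokesDG.solenoidal m, ∀ x ∈ closure D, ∀ i, |u x i - polyField q x i| ≤
      Real.sqrt (derivConst m H / (Real.pi * ρ ^ 2) * J) + ε := by
  obtain ⟨q, hq, hb⟩ := exists_solenoidal_approx m hm hD
    ⟨c, hρD (Metric.mem_ball_self hρ)⟩ hDc hDH h.cont h.weak h.memLp h.solenoidal hε
  refine ⟨q, hq, fun x hx i => (hb x hx i).trans ?_⟩
  gcongr
  have hvol : Real.pi * ρ ^ 2 ≤ volume.real D := by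
    have h1 : volume (Metric.ball c ρ) ≤ volume D := measure_mono hρD
    rw [volume_ball_eq c hρ.le] at h1
    have hfin : volume D ≠ ⊤ := (Metric.isBounded_closedBall.subset hDH).measure_lt_top.ne
    exact (ENNReal.ofReal_le_iff_le_toReal hfin).1 h1
  have h0 := derivConst_nonneg m H
  have hpos : 0 < Real.pi * ρ ^ 2 := by positivity
  have h1 := (h.sum_integral_le i).trans hJ
  have h2 : 0 ≤ ∑ a ∈ Finset.range (m + 2), ∫ x in D, G i a x ^ 2 :=
    Finset.sum_nonneg fun _ _ => integral_nonneg fun _ => sq_nonneg _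
  rw [approxBound]
  gcongr

end IsSolenoidalSobolev

/-- The bound of the local approximation, in terms of a length `d` that is comparable to the
diameter `H` and to the radius `ρ`. -/
theorem sqrt_derivConst_le (m : ℕ) {d ρ H J α β : ℝ} (hd : 0 < d) (hβ : 0 < β)
    (hH : H = α * d) (hρ : ρ = β * d) :
    Real.sqrt (derivConst m H / (Real.pi * ρ ^ 2) * J) =
      Real.sqrt (derivConst m α / (Real.pi * β ^ 2)) * (d ^ m * Real.sqrt J) := by
  have e : derivConst m H / (Real.pi * ρ ^ 2) * J =
      derivConst m α / (Real.pi * β ^ 2) * ((d ^ m) ^ 2 * J) := by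
    rw [hH, hρ, derivConst, derivConst]
    have : (2 * (α * d)) ^ (2 * (m + 1)) = (2 * α) ^ (2 * (m + 1)) * ((d ^ m) ^ 2 * d ^ 2) := by
      ring
    rw [this]
    field_simp
  rw [e, Real.sqrt_mul (div_nonneg (derivConst_nonneg m α) (by positivity)),
    Real.sqrt_mul (by positivity), Real.sqrt_sq (by positivity)]

/-- Comparison of polynomials near a point of a convex set. -/
theorem exists_eval_bound_of_convex (m n : ℕ) (κ : ℝ) : ∃ C : ℝ, 0 ≤ C ∧
    ∀ (T : Set Plane) (c z : Plane) (ρ H B : ℝ) (p : MvPolynomial (Fin 2) ℝ), Convex ℝ T →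
      0 < ρ → Metric.closedBall c ρ ⊆ T → z ∈ T → dist c z ≤ H → ρ ≤ H → H ≤ κ * ρ →
      p ∈ MvPolynomial.restrictTotalDegree (Fin 2) ℝ m →
      (∀ x ∈ T ∩ Metric.ball z ρ, |MvPolynomial.eval (fun j => x j) p| ≤ B) →
      ∀ x ∈ Metric.closedBall z (n * H), |MvPolynomial.eval (fun j => x j) p| ≤ C * B := by
  -- the disc in `T` near `z` has radius `ρ² / (4 H)`, and its center is not farther than `H`
  -- from `z`
  obtain ⟨C, hC0, hC⟩ := exists_eval_bound m ((n + 1) * (4 * κ ^ 2))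
  refine ⟨C, hC0, fun T c z ρ H B p hT hρ hc hz hcz hρH hκ hp hB x hx => ?_⟩
  obtain ⟨y, hyz, hy⟩ := exists_closedBall_subset_inter hT hρ hc hz hcz hρH
  have hH : 0 < H := hρ.trans_le hρH
  refine hC p y _ B hp (by positivity) (fun x hx => hB x (hy hx)) x ?_
  rw [Metric.mem_closedBall] at hx ⊢
  have h1 : (n + 1) * H ≤ (n + 1) * (4 * κ ^ 2) * (ρ ^ 2 / (4 * H)) := by
    rw [mul_assoc]
    gcongr
    rw [← mul_div_assoc, le_div_iff₀ (by positivity)]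
    nlinarith [mul_le_mul hκ hκ hH.le (hH.le.trans hκ)]
  have := dist_triangle x z y
  rw [dist_comm z y] at this
  linarith

/-! ### Chains of triangles -/

/-- A family of nondegenerate triangles with shape parameter `σ`, two of which meet exactly in the
convex hull of their common vertices. -/
structure IsConformingFamily {τ : Type} (σ : ℝ) (vert : τ → Fin 3 → Plane) : Prop where
  ind : ∀ t, AffineIndependent ℝ (vert t)
  range_ne : ∀ s t, s ≠ t → Set.range (vert s) ≠ Set.range (vert t)
  inter : ∀ s t, s ≠ t → triangle (vert s) ∩ triangle (vert t) =
    convexHull ℝ (Set.range (vert s) ∩ Set.range (vert t))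
  shape : ∀ t, Metric.diam (triangle (vert t)) / inradius (triangle (vert t)) ≤ σ

/-- Two triangles are adjacent if they have two common vertices. -/
def sideGraph {τ : Type} (vert : τ → Fin 3 → Plane) : SimpleGraph τ where
  Adj s t := s ≠ t ∧ ∃ a b, a ≠ b ∧ a ∈ Set.range (vert s) ∩ Set.range (vert t) ∧
    b ∈ Set.range (vert s) ∩ Set.range (vert t)
  symm := ⟨fun _ _ ⟨h, a, b, hab, ha, hb⟩ => ⟨h.symm, a, b, hab, ha.symm, hb.symm⟩⟩
  loopless := ⟨fun _ h => h.1 rfl⟩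

theorem exists_walk_length_lt {V : Type} [Finite V] {G : SimpleGraph V} (hG : G.Preconnected)
    {n : ℕ} (hn : Nat.card V ≤ n) (s t : V) : ∃ p : G.Walk s t, p.length < n := by
  classical
  have := Fintype.ofFinite V
  obtain ⟨p⟩ := hG s t
  refine ⟨p.bypass, (SimpleGraph.Walk.IsPath.length_lt p.bypass_isPath).trans_le ?_⟩
  rwa [← Nat.card_eq_fintype_card]

namespace IsConformingFamily

variable {τ : Type} {σ : ℝ} {vert : τ → Fin 3 → Plane}

theorem exists_disc (h : IsConformingFamily σ vert) (t : τ) :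
    ∃ c r, 0 < r ∧ Metric.closedBall c r ⊆ triangle (vert t) ∧
      Metric.diam (triangle (vert t)) ≤ 2 * σ * r ∧
      2 * r ≤ Metric.diam (triangle (vert t)) := by
  obtain ⟨c, r, hr, hc, hd⟩ := exists_closedBall_subset_triangle (h.ind t) (h.shape t)
  obtain ⟨b, hb⟩ := exists_affineBasis_eq (h.ind t)
  refine ⟨c, r, hr, hc, hd, ?_⟩
  rw [← hb] at hc ⊢
  exact (two_mul_radius_le_dist b hr hc (show (0 : Fin 3) ≠ 1 by decide)).trans
    (dist_le_diam_triangle (vertex_mem_triangle b 0) (vertex_mem_triangle b 1))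

theorem diam_pos (h : IsConformingFamily σ vert) (t : τ) :
    0 < Metric.diam (triangle (vert t)) := by
  obtain ⟨c, r, hr, -, -, hd⟩ := h.exists_disc t
  linarith

theorem one_le (h : IsConformingFamily σ vert) (t : τ) : 1 ≤ σ := by
  obtain ⟨c, r, hr, -, hd, hd'⟩ := h.exists_disc t
  by_contra hσ
  nlinarith [not_le.1 hσ]

theorem interior_nonempty (h : IsConformingFamily σ vert) (t : τ) :
    (interior (triangle (vert t))).Nonempty := by
  obtain ⟨c, r, hr, hc, -, -⟩ := h.exists_disc t
  exact ⟨c, mem_interior_iff_mem_nhds.2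
    (Filter.mem_of_superset (Metric.closedBall_mem_nhds c hr) hc)⟩

theorem closure_interior (h : IsConformingFamily σ vert) (t : τ) :
    closure (interior (triangle (vert t))) = triangle (vert t) := by
  rw [(convex_triangle _).closure_interior_eq_closure_of_nonempty_interior (h.interior_nonempty t),
    (isClosed_triangle _).closure_eq]

/-- The diameter of a triangle is bounded by a multiple of each of its sides. -/
theorem diam_le_mul_dist (h : IsConformingFamily σ vert) (t : τ) {i j : Fin 3} (hij : i ≠ j) :
    Metric.diam (triangle (vert t)) ≤ σ * dist (vert t i) (vert t j) := by
  have hσ := h.one_le t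
  obtain ⟨c, r, hr, hc, hd, -⟩ := h.exists_disc t
  obtain ⟨b, hb⟩ := exists_affineBasis_eq (h.ind t)
  rw [← hb] at hc hd ⊢
  have := two_mul_radius_le_dist b hr hc hij
  nlinarith

theorem diam_le_of_adj (h : IsConformingFamily σ vert) {s t : τ} (hst : (sideGraph vert).Adj s t) :
    Metric.diam (triangle (vert s)) ≤ σ * Metric.diam (triangle (vert t)) := by
  obtain ⟨-, a, b, hab, ⟨⟨i, rfl⟩, ha⟩, ⟨⟨j, rfl⟩, hb⟩⟩ := hst
  have hij : i ≠ j := fun h => hab (by rw [h])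
  have hσ := h.one_le s
  refine (h.diam_le_mul_dist s hij).trans ?_
  gcongr
  exact dist_le_diam_triangle (subset_convexHull ℝ _ ha) (subset_convexHull ℝ _ hb)

theorem diam_le_pow_of_walk (h : IsConformingFamily σ vert) {A : Set τ} {s t : A}
    (p : ((sideGraph vert).induce A).Walk s t) :
    Metric.diam (triangle (vert s)) ≤ σ ^ p.length * Metric.diam (triangle (vert t)) := by
  induction p with
  | nil => simp
  | @cons s r t hadj p ih =>
    have hσ := h.one_le s.1
    rw [SimpleGraph.Walk.length_cons, pow_succ', mul_assoc]
    exact (h.diam_le_of_adj hadj).trans (mul_le_mul_of_nonneg_left ih (by linarith))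

theorem diam_le_pow (h : IsConformingFamily σ vert) {A : Set τ} [Finite A] {n : ℕ}
    (hA : ((sideGraph vert).induce A).Preconnected) (hn : A.ncard ≤ n) {s t : τ} (hs : s ∈ A)
    (ht : t ∈ A) :
    Metric.diam (triangle (vert s)) ≤ σ ^ n * Metric.diam (triangle (vert t)) := by
  obtain ⟨p, hp⟩ := exists_walk_length_lt hA hn ⟨s, hs⟩ ⟨t, ht⟩
  refine (h.diam_le_pow_of_walk p).trans ?_
  exact mul_le_mul_of_nonneg_right (pow_le_pow_right₀ (h.one_le s) hp.le) Metric.diam_nonneg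

theorem dist_le_of_walk {A : Set τ} {H : ℝ}
    (hH : ∀ t ∈ A, Metric.diam (triangle (vert t)) ≤ H) {s t : A}
    (p : ((sideGraph vert).induce A).Walk s t) {x y : Plane} (hx : x ∈ triangle (vert s))
    (hy : y ∈ triangle (vert t)) : dist x y ≤ (p.length + 1) * H := by
  induction p generalizing x with
  | @nil s =>
    rw [SimpleGraph.Walk.length_nil, Nat.cast_zero, zero_add, one_mul]
    exact (dist_le_diam_triangle hx hy).trans (hH _ s.2)
  | @cons s r t hadj p ih =>
    obtain ⟨a, ha, ha'⟩ : ∃ a, a ∈ Set.range (vert s) ∧ a ∈ Set.range (vert r) := by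
      obtain ⟨-, a, -, -, ha, -⟩ := hadj
      exact ⟨a, ha.1, ha.2⟩
    have h1 := (dist_le_diam_triangle hx (subset_convexHull ℝ _ ha)).trans (hH _ s.2)
    have h2 := ih (subset_convexHull ℝ _ ha') hy
    have h3 := dist_triangle x a y
    rw [SimpleGraph.Walk.length_cons]
    push_cast
    linarith

theorem dist_le {A : Set τ} [Finite A] {H : ℝ} {n : ℕ}
    (hH : ∀ t ∈ A, Metric.diam (triangle (vert t)) ≤ H)
    (hA : ((sideGraph vert).induce A).Preconnected) (hn : A.ncard ≤ n) {s t : τ} (hs : s ∈ A)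
    (ht : t ∈ A) {x y : Plane} (hx : x ∈ triangle (vert s)) (hy : y ∈ triangle (vert t)) :
    dist x y ≤ n * H := by
  obtain ⟨p, hp⟩ := exists_walk_length_lt hA hn ⟨s, hs⟩ ⟨t, ht⟩
  refine (dist_le_of_walk hH p hx hy).trans ?_
  have : 0 ≤ H := Metric.diam_nonneg.trans (hH s hs)
  gcongr
  exact_mod_cast hp

end IsConformingFamily

namespace IsConformingFamily

variable {τ : Type} {σ : ℝ} {vert : τ → Fin 3 → Plane}

/-- Two adjacent triangles cover a disc centered at the midpoint of their common side. -/
theorem exists_closedBall_subset_union (h : IsConformingFamily σ vert) {s t : τ}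
    (hst : (sideGraph vert).Adj s t) {c c' : Plane} {ρ : ℝ} (hρ : 0 < ρ)
    (hc : Metric.closedBall c ρ ⊆ triangle (vert s))
    (hc' : Metric.closedBall c' ρ ⊆ triangle (vert t)) :
    ∃ z ∈ triangle (vert s) ∩ triangle (vert t),
      Metric.closedBall z ρ ⊆ triangle (vert s) ∪ triangle (vert t) := by
  obtain ⟨hne, a, a', haa, ⟨⟨i, hi⟩, ⟨i', hi'⟩⟩, ⟨⟨j, hj⟩, ⟨j', hj'⟩⟩⟩ := hst
  obtain ⟨b, hb⟩ := exists_affineBasis_eq (h.ind s)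
  obtain ⟨b', hb'⟩ := exists_affineBasis_eq (h.ind t)
  have h1 := h.range_ne s t hne
  have h2 := h.inter s t hne
  rw [← hb, ← hb'] at h1 h2
  rw [← hb] at hi hj hc ⊢
  rw [← hb'] at hi' hj' hc' ⊢
  refine ⟨midpoint ℝ (b i) (b j), ⟨?_, ?_⟩, closedBall_midpoint_subset_union b b' h1 h2
    (fun e => haa (by rw [← hi, ← hj, e])) (hi.trans hi'.symm) (hj.trans hj'.symm) hρ hc hc'⟩
  · exact (convex_triangle _).midpoint_mem (vertex_mem_triangle b i) (vertex_mem_triangle b j)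
  · rw [hi.trans hi'.symm, hj.trans hj'.symm]
    exact (convex_triangle _).midpoint_mem (vertex_mem_triangle b' i') (vertex_mem_triangle b' j')

theorem volume_frontier (t : τ) : volume (frontier (triangle (vert t))) = 0 :=
  (convex_triangle _).addHaar_frontier volume

/-- A set covered by two triangles is covered, up to a null set, by their interiors. -/
theorem ae_le_of_subset_union {s t : τ} {B Y : Set Plane}
    (hB : B ⊆ triangle (vert s) ∪ triangle (vert t)) (hs : interior (triangle (vert s)) ⊆ Y)
    (ht : interior (triangle (vert t)) ⊆ Y) : B ≤ᵐ[volume] Y := by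
  have h1 : ∀ r : τ, ∀ᵐ x, x ∉ frontier (triangle (vert r)) := fun r =>
    measure_eq_zero_iff_ae_notMem.1 (volume_frontier r)
  filter_upwards [h1 s, h1 t] with x hxs hxt hx
  rw [(isClosed_triangle _).frontier_eq] at hxs hxt
  rcases hB hx with h | h
  · exact hs (by_contra fun h' => hxs ⟨h, h'⟩)
  · exact ht (by_contra fun h' => hxt ⟨h, h'⟩)

end IsConformingFamily

theorem sub_mem_restrictTotalDegree {m : ℕ} {q q' : Fin 2 → MvPolynomial (Fin 2) ℝ}
    (hq : q ∈ solenoidal m) (hq' : q' ∈ solenoidal m) (i : Fin 2) :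
    q i - q' i ∈ MvPolynomial.restrictTotalDegree (Fin 2) ℝ m :=
  Submodule.sub_mem _ (hq.1 i) (hq'.1 i)

theorem eval_sub_eq (q q' : Fin 2 → MvPolynomial (Fin 2) ℝ) (x : Plane) (i : Fin 2) :
    MvPolynomial.eval (fun j => x j) (q i - q' i) = polyField q x i - polyField q' x i := by
  rw [map_sub]; rfl

/-- Local approximants on adjacent triangles are close to each other. The comparison goes through
an approximant on a disc centered at the midpoint of the common side. -/
theorem exists_compare_of_adj (m n : ℕ) (κ : ℝ) : ∃ C : ℝ, 0 ≤ C ∧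
    ∀ {S T : Set Plane} {c c' z : Plane} {ρ H b : ℝ} {u : Plane → Plane}
      {q q' q'' : Fin 2 → MvPolynomial (Fin 2) ℝ}, Convex ℝ S → Convex ℝ T → 0 < ρ →
      Metric.closedBall c ρ ⊆ S → Metric.closedBall c' ρ ⊆ T → z ∈ S ∩ T →
      S ⊆ Metric.closedBall c H → T ⊆ Metric.closedBall c' H → ρ ≤ H → H ≤ κ * ρ →
      q ∈ solenoidal m → q' ∈ solenoidal m → q'' ∈ solenoidal m →
      (∀ x ∈ S, ∀ i, |u x i - polyField q x i| ≤ b) →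
      (∀ x ∈ T, ∀ i, |u x i - polyField q' x i| ≤ b) →
      (∀ x ∈ Metric.closedBall z ρ, ∀ i, |u x i - polyField q'' x i| ≤ b) →
      ∀ x ∈ Metric.closedBall z (n * H), ∀ i, |polyField q x i - polyField q' x i| ≤ C * b := by
  obtain ⟨C, hC0, hC⟩ := exists_eval_bound_of_convex m n κ
  refine ⟨4 * C, by positivity, fun {S T c c' z ρ H b u q q' q''} hS hT hρ hc hc' hz hSH hTH hρH
    hκ hq hq' hq'' hu hu' hu'' x hx i => ?_⟩
  have key : ∀ {S : Set Plane} {c : Plane} {q : Fin 2 → MvPolynomial (Fin 2) ℝ}, Convex ℝ S →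
      Metric.closedBall c ρ ⊆ S → z ∈ S → S ⊆ Metric.closedBall c H → q ∈ solenoidal m →
      (∀ x ∈ S, ∀ i, |u x i - polyField q x i| ≤ b) →
      |polyField q x i - polyField q'' x i| ≤ C * (2 * b) := by
    intro S c q hS hc hz hSH hq hu
    rw [← eval_sub_eq]
    refine hC S c z ρ H (2 * b) _ hS hρ hc hz ?_ hρH hκ (sub_mem_restrictTotalDegree hq hq'' i)
      (fun y hy => ?_) x hx
    · rw [dist_comm]; exact hSH hz
    · rw [eval_sub_eq]
      have h1 := abs_le.1 (hu y hy.1 i)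
      have h2 := abs_le.1 (hu'' y (Metric.ball_subset_closedBall hy.2) i)
      rw [abs_le]
      constructor <;> linarith
  have h1 := abs_le.1 (key hS hc hz.1 hSH hq hu)
  have h2 := abs_le.1 (key hT hc' hz.2 hTH hq' hu')
  rw [abs_le]
  constructor <;> linarith

/-- If the local approximants on adjacent triangles are close to each other, then each of them is a
good approximation on the union of a connected family of triangles. -/
theorem abs_sub_le_of_preconnected {τ : Type} {vert : τ → Fin 3 → Plane} {A : Set τ} [Finite A]
    {n : ℕ} (hA : ((sideGraph vert).induce A).Preconnected) (hn : A.ncard ≤ n) {b B : ℝ}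
    (hB : 0 ≤ B) {u : Plane → Plane} {q : A → Fin 2 → MvPolynomial (Fin 2) ℝ}
    (hq : ∀ t : A, ∀ x ∈ triangle (vert t), ∀ i, |u x i - polyField (q t) x i| ≤ b)
    (hadj : ∀ s t : A, (sideGraph vert).Adj s t → ∀ r : A, ∀ x ∈ triangle (vert r), ∀ i,
      |polyField (q s) x i - polyField (q t) x i| ≤ B)
    (s t : A) {x : Plane} (hx : x ∈ triangle (vert t)) (i : Fin 2) :
    |u x i - polyField (q s) x i| ≤ b + n * B := by
  have hw : ∀ {s r : A} (p : ((sideGraph vert).induce A).Walk s r),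
      |polyField (q s) x i - polyField (q r) x i| ≤ p.length * B := by
    intro s r p
    induction p with
    | nil => simp
    | @cons s r r' h p ih =>
      have h1 := abs_le.1 (hadj s r h t x hx i)
      have h2 := abs_le.1 ih
      rw [SimpleGraph.Walk.length_cons, abs_le]
      push_cast
      constructor <;> linarith
  obtain ⟨p, hp⟩ := exists_walk_length_lt hA hn s t
  have h1 := abs_le.1 (hw p)
  have h2 := abs_le.1 (hq t x hx i)
  have h3 : (p.length : ℝ) * B ≤ n * B := by
    have : (p.length : ℝ) ≤ n := by exact_mod_cast hp.le
    gcongr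
  rw [abs_le]
  constructor <;> linarith

/-- Approximation of solenoidal Sobolev fields by solenoidal polynomials on the union of a connected
family of triangles, with constants that depend only on the shape parameter and on the number of
triangles. -/
theorem exists_approx_union (m : ℕ) (hm : 1 ≤ m) (n : ℕ) (σ : ℝ) : ∃ C : ℝ, 0 ≤ C ∧
    ∀ {τ : Type} {vert : τ → Fin 3 → Plane} {A : Set τ} {Ω Y : Set Plane} {u : Plane → Plane}
      {G : Fin 2 → ℕ → Plane → ℝ} {t₀ : τ} {ε : ℝ}, IsConformingFamily σ vert → Finite A →
      ((sideGraph vert).induce A).Preconnected → A.ncard ≤ n → IsOpen Ω →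
      interior (closure Ω) = Ω → IsSolenoidalSobolev m Ω u G → IsOpen Y → Y ⊆ Ω →
      (∀ t ∈ A, interior (triangle (vert t)) ⊆ Y) → t₀ ∈ A → 0 < ε →
      ∃ q ∈ solenoidal m, ∀ t ∈ A, ∀ x ∈ triangle (vert t), ∀ i, |u x i - polyField q x i| ≤
        C * (Metric.diam (triangle (vert t₀)) ^ m * Real.sqrt (∫ x in Y, density m G x) + ε) := by
  obtain ⟨C₁, hC₁, hcomp⟩ := exists_compare_of_adj m n (2 * σ * σ ^ n * σ ^ n)
  set C₂ := Real.sqrt (derivConst m (σ ^ n) / (Real.pi * ((2 * σ * σ ^ n)⁻¹) ^ 2)) with hC₂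
  refine ⟨(1 + n * C₁) * (C₂ + 1), by positivity, ?_⟩
  intro τ vert A Ω Y u G t₀ ε hT hfin hA hn hΩ hreg hu hYo hYΩ hY ht₀ hε
  have hσ := hT.one_le t₀
  have hσ0 : 0 < σ := by linarith
  set d := Metric.diam (triangle (vert t₀)) with hd
  have hd0 : 0 < d := hT.diam_pos t₀
  set J := ∫ x in Y, density m G x with hJ
  -- `H` bounds the diameters of all triangles, and each of them contains a disc of radius `ρ`
  set H := σ ^ n * d with hH
  set ρ := (2 * σ * σ ^ n)⁻¹ * d with hρ
  set b := C₂ * (d ^ m * Real.sqrt J) + ε with hb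
  have hρ0 : 0 < ρ := by positivity
  have hpow : 1 ≤ σ ^ n := one_le_pow₀ hσ
  have hHκ : H = 2 * σ * σ ^ n * σ ^ n * ρ := by
    rw [hH, hρ]; field_simp
  have hρH : ρ ≤ H := by
    rw [hHκ]
    refine le_mul_of_one_le_left hρ0.le ?_
    nlinarith [mul_le_mul hσ hpow zero_le_one (by linarith)]
  have hdiam : ∀ t ∈ A, Metric.diam (triangle (vert t)) ≤ H := fun t ht =>
    hT.diam_le_pow hA hn ht ht₀
  have hdisc : ∀ t : A, ∃ c, Metric.closedBall c ρ ⊆ triangle (vert t) := by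
    intro t
    obtain ⟨c, r, hr, hc, hr', -⟩ := hT.exists_disc t
    refine ⟨c, (Metric.closedBall_subset_closedBall ?_).trans hc⟩
    have h1 := hT.diam_le_pow hA hn ht₀ t.2
    rw [hρ, inv_mul_le_iff₀ (by positivity)]
    calc d ≤ σ ^ n * (2 * σ * r) := h1.trans (by gcongr)
      _ = 2 * σ * σ ^ n * r := by ring
  choose c hc using hdisc
  have hsub : ∀ t : A, triangle (vert t) ⊆ Metric.closedBall (c t) H := fun t x hx =>
    Metric.mem_closedBall.2 ((dist_le_diam_triangle hx
      (hc t (Metric.mem_closedBall_self hρ0.le))).trans (hdiam t t.2))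
  have hdens : IntegrableOn (density m G) Y := (hu.mono hΩ.measurableSet hYΩ).integrableOn_density
  -- local approximation on a convex set that is covered by `Y` up to a null set
  have hloc : ∀ (D : Set Plane) (z z' : Plane), IsOpen D → Convex ℝ D → Metric.ball z ρ ⊆ D →
      D ⊆ Metric.closedBall z' H → D ⊆ Ω → D ≤ᵐ[volume] Y →
      ∃ q ∈ solenoidal m, ∀ x ∈ closure D, ∀ i, |u x i - polyField q x i| ≤ b := by
    intro D z z' hD hDc hz hz' hDΩ hDY
    have h1 : ∫ x in D, density m G x ≤ J := setIntegral_mono_set hdens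
      (Filter.Eventually.of_forall fun x => density_nonneg m G x) hDY
    obtain ⟨q, hq, hq'⟩ := (hu.mono hΩ.measurableSet hDΩ).exists_approx hm hD hDc hρ0 hz hz' h1 hε
    rw [sqrt_derivConst_le m hd0 (by positivity) hH hρ] at hq'
    exact ⟨q, hq, hq'⟩
  have htri : ∀ t : A, ∃ q ∈ solenoidal m, ∀ x ∈ triangle (vert t), ∀ i,
      |u x i - polyField q x i| ≤ b := by
    intro t
    rw [← hT.closure_interior t]
    exact hloc _ (c t) (c t) isOpen_interior (convex_triangle _).interior
      (interior_maximal (Metric.ball_subset_closedBall.trans (hc t)) Metric.isOpen_ball)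
      (interior_subset.trans (hsub t)) ((hY t t.2).trans hYΩ)
      (LE.le.eventuallyLE (hY t t.2))
  choose q hqS hq using htri
  have hcl : ∀ t : A, triangle (vert t) ⊆ closure Ω := fun t => by
    rw [← hT.closure_interior t]
    exact closure_mono ((hY t t.2).trans hYΩ)
  have hb0 : 0 ≤ b := by positivity
  have hadj : ∀ s t : A, (sideGraph vert).Adj s t → ∀ r : A, ∀ x ∈ triangle (vert r), ∀ i,
      |polyField (q s) x i - polyField (q t) x i| ≤ C₁ * b := by
    intro s t hst r x hx i
    obtain ⟨z, hz, hzB⟩ := hT.exists_closedBall_subset_union hst hρ0 (hc s) (hc t)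
    obtain ⟨q'', hq'', hq'''⟩ := hloc (Metric.ball z ρ) z z Metric.isOpen_ball (convex_ball z ρ)
      subset_rfl (Metric.ball_subset_closedBall.trans (Metric.closedBall_subset_closedBall hρH))
      (hreg ▸ interior_maximal (Metric.ball_subset_closedBall.trans
        (hzB.trans (Set.union_subset (hcl s) (hcl t)))) Metric.isOpen_ball)
      (IsConformingFamily.ae_le_of_subset_union (Metric.ball_subset_closedBall.trans hzB)
        (hY s s.2) (hY t t.2))
    rw [closure_ball z hρ0.ne'] at hq'''
    exact hcomp (convex_triangle _) (convex_triangle _) hρ0 (hc s) (hc t) hz (hsub s) (hsub t)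
      hρH hHκ.le (hqS s) (hqS t) hq'' (hq s) (hq t) hq''' x
      (Metric.mem_closedBall.2 (IsConformingFamily.dist_le hdiam hA hn r.2 s.2 hx hz.1)) i
  refine ⟨q ⟨t₀, ht₀⟩, hqS _, fun t ht x hx i => ?_⟩
  refine (abs_sub_le_of_preconnected hA hn (by positivity) hq hadj ⟨t₀, ht₀⟩ ⟨t, ht⟩ hx
    i).trans ?_
  have h1 : b ≤ (C₂ + 1) * (d ^ m * Real.sqrt J + ε) := by
    have : 0 ≤ d ^ m * Real.sqrt J := by positivity
    have : 0 ≤ C₂ * ε := by positivity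
    rw [hb]
    linarith
  calc b + n * (C₁ * b) = (1 + n * C₁) * b := by ring
    _ ≤ (1 + n * C₁) * ((C₂ + 1) * (d ^ m * Real.sqrt J + ε)) := by gcongr
    _ = _ := by ring

/-! ### Sides of triangles -/

theorem mem_openSegment_side_iff (b : AffineBasis (Fin 3) ℝ Plane) {i j k : Fin 3} (hij : i ≠ j)
    (hki : k ≠ i) (hkj : k ≠ j) (z : Plane) :
    z ∈ openSegment ℝ (b i) (b j) ↔ b.coord k z = 0 ∧ b.coord i z ∈ Set.Ioo (0 : ℝ) 1 := by
  rw [openSegment_symm, openSegment_eq_image_lineMap]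
  constructor
  · rintro ⟨s, hs, rfl⟩
    rw [AffineMap.apply_lineMap, AffineMap.apply_lineMap, b.coord_apply_ne hki,
      b.coord_apply_ne hkj, b.coord_apply_ne hij, b.coord_apply_eq]
    simpa [AffineMap.lineMap_apply] using hs
  · rintro ⟨hk, hi⟩
    refine ⟨b.coord i z, hi, b.ext_elem fun l => ?_⟩
    have hsum := b.sum_coord_apply_eq_one z
    rw [sum_coord_third hij hki hkj, hk, add_zero] at hsum
    obtain ⟨k', hki', hkj', hl⟩ := exists_third_index hij
    obtain rfl : k = k' := by
      rcases hl k with h | h | h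
      · exact absurd h hki
      · exact absurd h hkj
      · exact h
    rw [AffineMap.apply_lineMap]
    rcases hl l with rfl | rfl | rfl
    · rw [b.coord_apply_ne hij, b.coord_apply_eq]
      simp [AffineMap.lineMap_apply]
    · rw [b.coord_apply_ne hij.symm, b.coord_apply_eq]
      simp only [AffineMap.lineMap_apply_ring']
      linarith
    · rw [b.coord_apply_ne hki, b.coord_apply_ne hkj, hk]
      simp

/-- An affine function on the line which takes values in `(0, 1)` somewhere in `(0, 1)`, but not
at the end points, takes values in `(0, 1)` only in `(0, 1)`. -/
theorem mem_Ioo_of_affine {g₀ g₁ θ τ : ℝ} (hθ : θ ∈ Set.Ioo (0 : ℝ) 1)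
    (hgθ : g₀ + θ * g₁ ∈ Set.Ioo (0 : ℝ) 1) (hgτ : g₀ + τ * g₁ ∈ Set.Ioo (0 : ℝ) 1)
    (h0 : g₀ ∉ Set.Ioo (0 : ℝ) 1) (h1 : g₀ + g₁ ∉ Set.Ioo (0 : ℝ) 1) :
    τ ∈ Set.Ioo (0 : ℝ) 1 := by
  have hconv : Convex ℝ (Set.Ioo (0 : ℝ) 1) := convex_Ioo 0 1
  constructor
  · by_contra h
    push Not at h
    refine h0 ?_
    have hd : 0 < θ - τ := by linarith [hθ.1]
    have := hconv hgθ hgτ (a := -τ / (θ - τ)) (b := θ / (θ - τ))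
      (div_nonneg (by linarith) hd.le) (div_nonneg hθ.1.le hd.le) (by field_simp; ring)
    convert this using 1
    simp only [smul_eq_mul]
    field_simp
    ring
  · by_contra h
    push Not at h
    refine h1 ?_
    have hd : 0 < τ - θ := by linarith [hθ.2]
    have := hconv hgθ hgτ (a := (τ - 1) / (τ - θ)) (b := (1 - θ) / (τ - θ))
      (div_nonneg (by linarith) hd.le) (div_nonneg (by linarith [hθ.2]) hd.le)
      (by field_simp; ring)
    convert this using 1
    simp only [smul_eq_mul]
    field_simp
    ring

/-- If two points of an open segment lie on a side of a triangle, and the end points of the segment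
are not in the relative interior of the side, then the segment contains the side. -/
theorem openSegment_side_subset (b : AffineBasis (Fin 3) ℝ Plane) {i j k : Fin 3} (hij : i ≠ j)
    (hki : k ≠ i) (hkj : k ≠ j) {p q x y : Plane} (hx : x ∈ openSegment ℝ p q)
    (hy : y ∈ openSegment ℝ p q) (hxy : x ≠ y) (hxT : x ∈ triangle b) (hyT : y ∈ triangle b)
    (hxk : b.coord k x = 0) (hyk : b.coord k y = 0) (hp : p ∉ openSegment ℝ (b i) (b j))
    (hq : q ∉ openSegment ℝ (b i) (b j)) :
    openSegment ℝ (b i) (b j) ⊆ openSegment ℝ p q := by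
  rw [openSegment_eq_image_lineMap ℝ p q] at hx hy
  obtain ⟨s, hs, rfl⟩ := hx
  obtain ⟨t, ht, rfl⟩ := hy
  have hst : s ≠ t := fun h => hxy (by rw [h])
  have hline : ∀ l τ, b.coord l (AffineMap.lineMap p q τ) =
      b.coord l p + τ * (b.coord l q - b.coord l p) := by
    intro l τ
    rw [AffineMap.apply_lineMap, AffineMap.lineMap_apply_ring']
    ring
  -- the whole line lies in the line of the side
  have hk1 : b.coord k q - b.coord k p = 0 := by
    rw [hline] at hxk hyk
    have : (s - t) * (b.coord k q - b.coord k p) = 0 := by linear_combination hxk - hyk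
    exact (mul_eq_zero.1 this).resolve_left (sub_ne_zero.2 hst)
  have hk0 : b.coord k p = 0 := by
    rw [hline, hk1] at hxk
    linarith
  have hk : ∀ τ, b.coord k (AffineMap.lineMap p q τ) = 0 := fun τ => by
    rw [hline, hk1, hk0]; ring
  have hsum : ∀ z, b.coord i z + b.coord j z + b.coord k z = 1 := fun z => by
    rw [← b.sum_coord_apply_eq_one z, sum_coord_third hij hki hkj]
  have hext : ∀ z w, b.coord k z = 0 → b.coord k w = 0 → b.coord i z = b.coord i w → z = w := by
    intro z w hz hw h
    refine b.ext_elem fun l => ?_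
    obtain ⟨k', hki', hkj', hl⟩ := exists_third_index hij
    obtain rfl : k = k' := by
      rcases hl k with h | h | h
      · exact absurd h hki
      · exact absurd h hkj
      · exact h
    rcases hl l with rfl | rfl | rfl
    · exact h
    · have h1 := hsum z
      have h2 := hsum w
      linarith
    · rw [hz, hw]
  set g₁ := b.coord i q - b.coord i p with hg₁
  have hg : g₁ ≠ 0 := by
    intro h0
    refine hxy (hext _ _ (hk s) (hk t) ?_)
    rw [hline, hline, ← hg₁, h0, mul_zero, mul_zero]
  have hnot : ∀ z, b.coord k z = 0 → z ∉ openSegment ℝ (b i) (b j) →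
      b.coord i z ∉ Set.Ioo (0 : ℝ) 1 := fun z hz h h' =>
    h ((mem_openSegment_side_iff b hij hki hkj z).2 ⟨hz, h'⟩)
  have h0 := hnot p hk0 hp
  have h1 := hnot q (by linarith) hq
  have hmid : b.coord i p + (s + t) / 2 * g₁ ∈ Set.Ioo (0 : ℝ) 1 := by
    have a1 := (mem_triangle_iff b _).1 hxT i
    have a2 := (mem_triangle_iff b _).1 hyT i
    have a3 := coord_le_one b hxT i
    have a4 := coord_le_one b hyT i
    rw [hline, ← hg₁] at a1 a2 a3 a4
    have hne : s * g₁ ≠ t * g₁ := fun h => hst (mul_right_cancel₀ hg h)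
    rcases lt_or_gt_of_ne hne with h | h <;> constructor <;> linarith
  intro z hz
  obtain ⟨hzk, hzi⟩ := (mem_openSegment_side_iff b hij hki hkj z).1 hz
  have hτ : b.coord i p + (b.coord i z - b.coord i p) / g₁ * g₁ = b.coord i z := by
    rw [div_mul_cancel₀ _ hg]; ring
  rw [openSegment_eq_image_lineMap]
  refine ⟨(b.coord i z - b.coord i p) / g₁, ?_, hext _ _ (hk _) hzk ?_⟩
  · refine mem_Ioo_of_affine (θ := (s + t) / 2) ⟨?_, ?_⟩ hmid (by rwa [hτ]) h0
      (by rw [hg₁, add_sub_cancel]; exact h1)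
    · linarith [hs.1, ht.1]
    · linarith [hs.2, ht.2]
  · rw [hline, ← hg₁, hτ]

theorem openSegment_infinite {p q : Plane} (h : p ≠ q) : (openSegment ℝ p q).Infinite := by
  rw [openSegment_eq_image_lineMap]
  exact (Set.Ioo_infinite zero_lt_one).image (AffineMap.lineMap_injective ℝ h).injOn

theorem dist_le_of_openSegment_subset {a b p q : Plane}
    (h : openSegment ℝ a b ⊆ openSegment ℝ p q) : dist a b ≤ dist p q := by
  have h1 : segment ℝ a b ⊆ segment ℝ p q := by
    rw [← closure_openSegment, ← closure_openSegment]
    exact closure_mono h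
  have h2 : Metric.diam (segment ℝ p q) = dist p q := by
    rw [← convexHull_pair, convexHull_diam, Metric.diam_pair]
  rw [← h2]
  refine Metric.dist_le_diam_of_mem ?_ (h1 (left_mem_segment ℝ a b)) (h1 (right_mem_segment ℝ a b))
  rw [← convexHull_pair]
  exact isBounded_convexHull.2 (Set.toFinite _).isBounded

namespace IsConformingFamily

variable {τ : Type} {σ : ℝ} {vert : τ → Fin 3 → Plane}

/-- A vertex of a triangle that lies in another triangle is a vertex of the latter. -/
theorem vertex_of_mem (h : IsConformingFamily σ vert) {s t : τ} {p : Plane}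
    (hp : p ∈ Set.range (vert s)) (hpt : p ∈ triangle (vert t)) : p ∈ Set.range (vert t) := by
  rcases eq_or_ne s t with rfl | hst
  · exact hp
  obtain ⟨b, hb⟩ := exists_affineBasis_eq (h.ind s)
  have hmem : p ∈ triangle (vert s) ∩ triangle (vert t) := ⟨subset_convexHull ℝ _ hp, hpt⟩
  rw [h.inter s t hst, ← hb] at hmem
  rw [← hb] at hp
  obtain ⟨l, rfl⟩ := hp
  by_contra hl
  have h0 : b.coord l (b l) = 0 := by
    have hconv : Convex ℝ {y | b.coord l y = 0} :=
      (convex_singleton (0 : ℝ)).affine_preimage (b.coord l)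
    refine convexHull_min ?_ hconv hmem
    rintro _ ⟨⟨k, rfl⟩, hk⟩
    refine b.coord_apply_ne fun e => hl ?_
    rwa [e]
  rw [b.coord_apply_eq] at h0
  exact one_ne_zero h0

theorem notMem_openSegment (h : IsConformingFamily σ vert) {s t : τ} {p : Plane}
    (hp : p ∈ Set.range (vert s)) {i j : Fin 3} (hij : i ≠ j) :
    p ∉ openSegment ℝ (vert t i) (vert t j) := by
  intro hpt
  have h1 : p ∈ triangle (vert t) := (convex_triangle _).openSegment_subset
    (vertex_mem_triangle _ i) (vertex_mem_triangle _ j) hpt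
  obtain ⟨l, rfl⟩ := h.vertex_of_mem hp h1
  obtain ⟨b, hb⟩ := exists_affineBasis_eq (h.ind t)
  rw [← hb] at hpt
  obtain ⟨k, hki, hkj, hk⟩ := exists_third_index hij
  obtain ⟨h2, h3, h4⟩ := (mem_openSegment_side_iff b hij hki hkj _).1 hpt
  rcases hk l with rfl | rfl | rfl
  · rw [b.coord_apply_eq] at h4
    exact lt_irrefl _ h4
  · rw [b.coord_apply_ne hij] at h3
    exact lt_irrefl _ h3
  · rw [b.coord_apply_eq] at h2
    exact one_ne_zero h2

theorem adj_of_mem (h : IsConformingFamily σ vert) {s t : τ} (hst : s ≠ t) {x : Plane}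
    (hs : x ∈ triangle (vert s)) (ht : x ∈ triangle (vert t)) (hx : ∀ r, x ∉ Set.range (vert r)) :
    (sideGraph vert).Adj s t := by
  have hmem : x ∈ triangle (vert s) ∩ triangle (vert t) := ⟨hs, ht⟩
  rw [h.inter s t hst] at hmem
  rcases (Set.range (vert s) ∩ Set.range (vert t)).subsingleton_or_nontrivial with h1 | h1
  · rw [h1.convex.convexHull_eq] at hmem
    exact absurd hmem.1 (hx s)
  · obtain ⟨a, ha, b, hb, hab⟩ := h1
    exact ⟨hst, a, b, hab, ha, hb⟩

end IsConformingFamily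

theorem isPreconnected_ball_diff_singleton (x : Plane) (δ : ℝ) :
    IsPreconnected (Metric.ball x δ \ {x}) := by
  have h1 : IsPreconnected (Metric.sphere (0 : Plane) 1) :=
    isPreconnected_sphere (by
      rw [← Module.finrank_eq_rank, finrank_euclideanSpace_fin]; norm_num) 0 1
  have h2 := (h1.prod (isPreconnected_Ioo (a := (0 : ℝ)) (b := δ))).image
    (fun p : Plane × ℝ => x + p.2 • p.1) (by fun_prop)
  convert h2 using 1
  ext y
  constructor
  · rintro ⟨hy, hyx⟩
    have hn : 0 < ‖y - x‖ := norm_pos_iff.2 (sub_ne_zero.2 hyx)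
    refine ⟨(‖y - x‖⁻¹ • (y - x), ‖y - x‖), ⟨?_, hn, ?_⟩, ?_⟩
    · simp [norm_smul, hn.ne']
    · rw [← dist_eq_norm]; exact hy
    · simp [smul_smul, hn.ne']
  · rintro ⟨⟨v, r⟩, ⟨hv, hr0, hr⟩, rfl⟩
    have hv1 : ‖v‖ = 1 := by simpa using hv
    have hr0' : (0 : ℝ) < r := hr0
    refine ⟨?_, ?_⟩
    · simp only [Metric.mem_ball, dist_eq_norm, add_sub_cancel_left, norm_smul, hv1,
        Real.norm_eq_abs, abs_of_pos hr0', mul_one]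
      exact hr
    · simp only [Set.mem_singleton_iff, add_eq_left, smul_eq_zero, not_or]
      exact ⟨hr0'.ne', fun h => by simp [h] at hv1⟩

/-- A conforming triangulation of the closure of a connected open set is connected through sides. -/
theorem IsConformingFamily.preconnected_induce {τ : Type} [Finite τ] {σ : ℝ}
    {vert : τ → Fin 3 → Plane} (h : IsConformingFamily σ vert) {A : Set τ} {U : Set Plane}
    (hU : IsOpen U) (hc : IsPreconnected U) (hA : U ⊆ ⋃ t ∈ A, triangle (vert t))
    (hA' : ∀ t ∈ A, interior (triangle (vert t)) ⊆ U) :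
    ((sideGraph vert).induce A).Preconnected := by
  intro s₀ t₀
  by_contra hst
  -- the triangles connected with `s₀`; they and the remaining ones cover `U` by two closed sets
  set R : Set τ := {t | ∃ ht : t ∈ A, ((sideGraph vert).induce A).Reachable s₀ ⟨t, ht⟩} with hR
  have hclosed : ∀ B : Set τ, IsClosed (⋃ t ∈ B, triangle (vert t)) := fun B =>
    (Set.toFinite B).isClosed_biUnion fun t _ => isClosed_triangle (vert t)
  have hcov : U ⊆ (⋃ t ∈ R, triangle (vert t)) ∪ ⋃ t ∈ A \ R, triangle (vert t) := by
    intro x hx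
    obtain ⟨t, ht, hxt⟩ := Set.mem_iUnion₂.1 (hA hx)
    by_cases htR : t ∈ R
    · exact Or.inl (Set.mem_biUnion htR hxt)
    · exact Or.inr (Set.mem_biUnion ⟨ht, htR⟩ hxt)
  have hne : ∀ (B : Set τ) (t : τ), t ∈ B → t ∈ A → (U ∩ ⋃ t ∈ B, triangle (vert t)).Nonempty := by
    intro B t ht htA
    obtain ⟨x, hx⟩ := h.interior_nonempty t
    exact ⟨x, hA' t htA hx, Set.mem_biUnion ht (interior_subset hx)⟩
  have hs₀ : s₀.1 ∈ R := ⟨s₀.2, SimpleGraph.Reachable.refl _⟩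
  have ht₀ : t₀.1 ∈ A \ R := ⟨t₀.2, fun ⟨_, hr⟩ => hst hr⟩
  obtain ⟨x, hxU, hxR, hxR'⟩ := isPreconnected_closed_iff.1 hc _ _ (hclosed R) (hclosed (A \ R))
    hcov (hne R s₀ hs₀ s₀.2) (hne (A \ R) t₀ ht₀ t₀.2)
  -- a punctured disc around `x` without vertices
  obtain ⟨δ, hδ, hδU⟩ : ∃ δ > 0, Metric.ball x δ ⊆
      U ∩ ((⋃ t, Set.range (vert t)) \ {x})ᶜ := by
    refine Metric.isOpen_iff.1 (hU.inter ?_) x ⟨hxU, fun hx => hx.2 rfl⟩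
    exact ((Set.finite_iUnion fun t => Set.finite_range (vert t)).sdiff.isClosed).isOpen_compl
  have hpunc : ∀ B : Set τ, B ⊆ A → x ∈ ⋃ t ∈ B, triangle (vert t) →
      ((Metric.ball x δ \ {x}) ∩ ⋃ t ∈ B, triangle (vert t)).Nonempty := by
    intro B hB hx
    obtain ⟨t, ht, hxt⟩ := Set.mem_iUnion₂.1 hx
    rw [← h.closure_interior t] at hxt
    have h1 := mem_closure_iff.1 hxt (Metric.ball x δ) Metric.isOpen_ball (Metric.mem_ball_self hδ)
    obtain ⟨y, ⟨hy1, hy2⟩, hy3⟩ := (dense_compl_singleton x).inter_open_nonempty _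
      (Metric.isOpen_ball.inter isOpen_interior) h1
    exact ⟨y, ⟨hy1, hy3⟩, Set.mem_biUnion ht (interior_subset hy2)⟩
  obtain ⟨y, ⟨hyB, hyx⟩, hyR, hyR'⟩ := isPreconnected_closed_iff.1
    (isPreconnected_ball_diff_singleton x δ) _ _ (hclosed R) (hclosed (A \ R))
    (Set.sdiff_subset.trans (hδU.trans (Set.inter_subset_left.trans hcov)))
    (hpunc R (fun t ht => ht.1) hxR) (hpunc (A \ R) Set.sdiff_subset hxR')
  obtain ⟨s, ⟨hsA, hsR⟩, hys⟩ := Set.mem_iUnion₂.1 hyR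
  obtain ⟨t, ⟨htA, htR⟩, hyt⟩ := Set.mem_iUnion₂.1 hyR'
  have hadj : (sideGraph vert).Adj s t := by
    refine h.adj_of_mem (fun e => htR (e ▸ ⟨hsA, hsR⟩)) hys hyt fun r hr => ?_
    exact (hδU hyB).2 ⟨Set.mem_iUnion.2 ⟨r, hr⟩, hyx⟩
  refine htR ⟨htA, hsR.trans (SimpleGraph.Adj.reachable ?_)⟩
  exact hadj

/-! ### The triangulation of a mesh -/

/-- The triangles `t` with vertices `vert t` form a conforming subdivision of the mesh; the triangle
`t` lies in the element `owner t`, and each element consists of at most `N` triangles. -/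
structure IsSubdivision {Ω : Set Plane} {ι ε : Type} (𝒯 : PolygonalMesh Ω ι ε) (N : ℕ) (σ : ℝ)
    {τ : Type} (vert : τ → Fin 3 → Plane) (owner : τ → ι) : Prop where
  family : IsConformingFamily σ vert
  closure_elt : ∀ K, closure (𝒯.elt K) = ⋃ t ∈ {t | owner t = K}, triangle (vert t)
  endpoint : ∀ e, (∃ t, 𝒯.src e ∈ Set.range (vert t)) ∧ ∃ t, 𝒯.tgt e ∈ Set.range (vert t)
  ncard_le : ∀ K, {t | owner t = K}.ncard ≤ N

theorem exists_isSubdivision {Ω : Set Plane} {ι ε : Type} {𝒯 : PolygonalMesh Ω ι ε} {N : ℕ}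
    {σ : ℝ} (h : 𝒯.ShapeRegular N σ) : ∃ (τ : Type) (_ : Fintype τ) (vert : τ → Fin 3 → Plane)
      (owner : τ → ι), IsSubdivision 𝒯 N σ vert owner := by
  obtain ⟨τ, hτ, vert, owner, h1, h2, h3, h4, h5, h6⟩ := h
  exact ⟨τ, hτ, vert, owner, ⟨h1, fun s t hst => (h2 s t hst).1, fun s t hst => (h2 s t hst).2,
    h6⟩, h3, h4, h5⟩

/-- The edges of an element. -/
def PolygonalMesh.edgesOf {Ω : Set Plane} {ι ε : Type} (𝒯 : PolygonalMesh Ω ι ε) (K : ι) : Set ε :=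
  {e | 𝒯.plus e = K ∨ 𝒯.minus e = some K}

theorem PolygonalMesh.segment_subset_frontier {Ω : Set Plane} {ι ε : Type}
    {𝒯 : PolygonalMesh Ω ι ε} {K : ι} {e : ε} (he : e ∈ 𝒯.edgesOf K) :
    segment ℝ (𝒯.src e) (𝒯.tgt e) ⊆ frontier (𝒯.elt K) := by
  rcases he with rfl | he
  · exact 𝒯.edge_plus e
  · exact (𝒯.edge_minus e K he).2

theorem PolygonalMesh.elt_subset {Ω : Set Plane} (hΩ : IsPolygon Ω) {ι ε : Type}
    (𝒯 : PolygonalMesh Ω ι ε) (K : ι) : 𝒯.elt K ⊆ Ω := by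
  have h : closure (𝒯.elt K) ⊆ closure Ω :=
    𝒯.elt_cover ▸ Set.subset_iUnion (fun K => closure (𝒯.elt K)) K
  exact (𝒯.elt_polygon K).regular.ge.trans ((interior_mono h).trans hΩ.regular.le)

namespace IsSubdivision

variable {Ω : Set Plane} {ι ε : Type} {𝒯 : PolygonalMesh Ω ι ε} {N : ℕ} {σ : ℝ} {τ : Type}
  {vert : τ → Fin 3 → Plane} {owner : τ → ι}

theorem triangle_subset (h : IsSubdivision 𝒯 N σ vert owner) (t : τ) :
    triangle (vert t) ⊆ closure (𝒯.elt (owner t)) := by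
  rw [h.closure_elt]
  exact Set.subset_biUnion_of_mem (u := fun t => triangle (vert t))
    (show t ∈ {s | owner s = owner t} from rfl)

theorem interior_subset (h : IsSubdivision 𝒯 N σ vert owner) (t : τ) :
    interior (triangle (vert t)) ⊆ 𝒯.elt (owner t) := by
  rw [← (𝒯.elt_polygon (owner t)).regular]
  exact interior_mono (h.triangle_subset t)

theorem exists_mem_triangle (h : IsSubdivision 𝒯 N σ vert owner) {K : ι} {x : Plane}
    (hx : x ∈ closure (𝒯.elt K)) : ∃ t, owner t = K ∧ x ∈ triangle (vert t) := by
  rw [h.closure_elt] at hx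
  obtain ⟨t, ht, hxt⟩ := Set.mem_iUnion₂.1 hx
  exact ⟨t, ht, hxt⟩

theorem exists_owner_eq (h : IsSubdivision 𝒯 N σ vert owner) (K : ι) : ∃ t, owner t = K := by
  obtain ⟨x, hx⟩ := (𝒯.elt_polygon K).connected.nonempty
  obtain ⟨t, ht, -⟩ := h.exists_mem_triangle (subset_closure hx)
  exact ⟨t, ht⟩

theorem diam_triangle_le_of_subset (h : IsSubdivision 𝒯 N σ vert owner) {t : τ} {Y : Set Plane}
    (hY : Bornology.IsBounded Y) (ht : 𝒯.elt (owner t) ⊆ Y) :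
    Metric.diam (triangle (vert t)) ≤ Metric.diam Y := by
  rw [← h.family.closure_interior t, Metric.diam_closure]
  exact Metric.diam_mono ((h.interior_subset t).trans ht) hY

/-! ### Edges and sides -/

/-- Each edge of an element contains a side of one of its triangles. -/
theorem exists_side_subset [Finite τ] (h : IsSubdivision 𝒯 N σ vert owner) {K : ι} {e : ε}
    (he : e ∈ 𝒯.edgesOf K) : ∃ t, owner t = K ∧ ∃ i j, i ≠ j ∧
      openSegment ℝ (vert t i) (vert t j) ⊆ openSegment ℝ (𝒯.src e) (𝒯.tgt e) := by
  choose b hb using fun t => exists_affineBasis_eq (h.family.ind t)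
  -- the points of the edge on the side of a triangle opposite to a given vertex; as the edge is
  -- infinite, one of these finitely many sets has two points
  set S : τ × Fin 3 → Set Plane := fun p =>
    {x | x ∈ openSegment ℝ (𝒯.src e) (𝒯.tgt e) ∧ owner p.1 = K ∧ x ∈ triangle (vert p.1) ∧
      (b p.1).coord p.2 x = 0} with hS
  have hcov : openSegment ℝ (𝒯.src e) (𝒯.tgt e) ⊆ ⋃ p, S p := by
    intro x hx
    have hf := PolygonalMesh.segment_subset_frontier he (openSegment_subset_segment ℝ _ _ hx)
    obtain ⟨t, ht, hxt⟩ := h.exists_mem_triangle (frontier_subset_closure hf)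
    have hxi : x ∉ interior (triangle (b t)) := by
      intro hxi
      rw [hb] at hxi
      have := h.interior_subset t hxi
      rw [ht] at this
      rw [(𝒯.elt_polygon K).isOpen.frontier_eq] at hf
      exact hf.2 this
    rw [mem_interior_triangle_iff] at hxi
    push Not at hxi
    obtain ⟨k, hk⟩ := hxi
    have hxb : x ∈ triangle (b t) := by rwa [hb]
    exact Set.mem_iUnion.2 ⟨(t, k), hx, ht, hxt, hk.antisymm ((mem_triangle_iff _ _).1 hxb k)⟩
  obtain ⟨p, hp⟩ : ∃ p, (S p).Nontrivial := by
    by_contra hcon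
    push Not at hcon
    exact openSegment_infinite (𝒯.src_ne_tgt e) ((Set.finite_iUnion fun p =>
      (hcon p).finite).subset hcov)
  obtain ⟨x, ⟨hx, ht, hxt, hxk⟩, y, ⟨hy, -, hyt, hyk⟩, hxy⟩ := hp
  obtain ⟨i, j, hij, hki, hkj⟩ : ∃ i j : Fin 3, i ≠ j ∧ p.2 ≠ i ∧ p.2 ≠ j := by
    generalize p.2 = k
    revert k
    decide
  obtain ⟨⟨s, hs⟩, s', hs'⟩ := h.endpoint e
  have hp1 := h.family.notMem_openSegment (t := p.1) hs hij
  have hp2 := h.family.notMem_openSegment (t := p.1) hs' hij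
  refine ⟨p.1, ht, i, j, hij, ?_⟩
  rw [← hb] at hxt hyt hp1 hp2 ⊢
  exact openSegment_side_subset (b p.1) hij hki hkj hx hy hxy hxt hyt hxk hyk hp1 hp2

theorem ncard_edgesOf_le [Finite τ] (h : IsSubdivision 𝒯 N σ vert owner) (K : ι) :
    (𝒯.edgesOf K).Finite ∧ (𝒯.edgesOf K).ncard ≤ 9 * N := by
  choose t ht i j _ hs using fun e : 𝒯.edgesOf K => h.exists_side_subset e.2
  have hinj : Function.Injective
      (fun e => (⟨t e, ht e⟩, i e, j e) : 𝒯.edgesOf K → {t | owner t = K} × Fin 3 × Fin 3) := by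
    intro e e' hee
    simp only [Prod.mk.injEq, Subtype.mk.injEq] at hee
    by_contra hne
    have h1 := 𝒯.edge_disjoint e e' fun h => hne (Subtype.ext h)
    have h2 := hs e'
    rw [← hee.1, ← hee.2.1, ← hee.2.2] at h2
    obtain ⟨x, hm⟩ : (openSegment ℝ (vert (t e) (i e)) (vert (t e) (j e))).Nonempty :=
      ⟨_, midpoint_mem_openSegment _ _⟩
    exact Set.disjoint_left.1 h1 (hs e hm) (h2 hm)
  have hfin : Finite (𝒯.edgesOf K) := Finite.of_injective _ hinj
  refine ⟨Set.toFinite _, ?_⟩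
  have h1 := Nat.card_le_card_of_injective _ hinj
  rw [Nat.card_prod, Nat.card_prod, Nat.card_coe_set_eq, Nat.card_coe_set_eq, Nat.card_fin] at h1
  have := h.ncard_le K
  omega

/-- The length of an edge of an element is comparable to the diameter of a triangle. -/
theorem exists_diam_le_mul_dist [Finite τ] (h : IsSubdivision 𝒯 N σ vert owner) {K : ι} {e : ε}
    (he : e ∈ 𝒯.edgesOf K) : ∃ t, owner t = K ∧
      Metric.diam (triangle (vert t)) ≤ σ * dist (𝒯.src e) (𝒯.tgt e) := by
  obtain ⟨t, ht, i, j, hij, hs⟩ := h.exists_side_subset he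
  have hσ := h.family.one_le t
  refine ⟨t, ht, (h.family.diam_le_mul_dist t hij).trans ?_⟩
  gcongr
  exact dist_le_of_openSegment_subset hs

theorem preconnected_owner [Finite τ] (h : IsSubdivision 𝒯 N σ vert owner) (K : ι) :
    ((sideGraph vert).induce {t | owner t = K}).Preconnected := by
  refine h.family.preconnected_induce (𝒯.elt_polygon K).isOpen
    (𝒯.elt_polygon K).connected.isPreconnected ?_ ?_
  · rw [← h.closure_elt]
    exact subset_closure
  · rintro t rfl
    exact h.interior_subset t

/-- Neighbouring elements have adjacent triangles. -/
theorem exists_adj_of_minus [Finite τ] (h : IsSubdivision 𝒯 N σ vert owner) {e : ε} {L : ι}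
    (he : 𝒯.minus e = some L) :
    ∃ s t, owner s = 𝒯.plus e ∧ owner t = L ∧ (sideGraph vert).Adj s t := by
  -- a point of the edge which is not a vertex of a triangle
  have hfin : (⋃ t, Set.range (vert t)).Finite :=
    Set.finite_iUnion fun t => Set.finite_range (vert t)
  obtain ⟨x, hx, hxV⟩ := (openSegment_infinite (𝒯.src_ne_tgt e)).exists_notMem_finite hfin
  have hx' := openSegment_subset_segment ℝ _ _ hx
  obtain ⟨s, hs, hxs⟩ := h.exists_mem_triangle (frontier_subset_closure (𝒯.edge_plus e hx'))
  obtain ⟨t, ht, hxt⟩ := h.exists_mem_triangle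
    (frontier_subset_closure ((𝒯.edge_minus e L he).2 hx'))
  refine ⟨s, t, hs, ht, h.family.adj_of_mem ?_ hxs hxt fun r hr =>
    hxV (Set.mem_iUnion.2 ⟨r, hr⟩)⟩
  rintro rfl
  exact (𝒯.edge_minus e L he).1 (ht.symm.trans hs)

theorem exists_adj_of_neighbour [Finite τ] (h : IsSubdivision 𝒯 N σ vert owner) {K L : ι}
    (hKL : 𝒯.neighbourGraph.Adj K L) :
    ∃ s t, owner s = K ∧ owner t = L ∧ (sideGraph vert).Adj s t := by
  rcases ((SimpleGraph.fromRel_adj _ _ _).1 hKL).2 with ⟨e, rfl, he⟩ | ⟨e, rfl, he⟩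
  · exact h.exists_adj_of_minus he
  · obtain ⟨s, t, hs, ht, hst⟩ := h.exists_adj_of_minus he
    exact ⟨t, s, ht, hs, hst.symm⟩

/-- The triangles of an edge-connected set of elements are connected through sides. -/
theorem preconnected_of_connected [Finite τ] (h : IsSubdivision 𝒯 N σ vert owner) {S : Set ι}
    (hS : (𝒯.neighbourGraph.induce S).Preconnected) :
    ((sideGraph vert).induce {t | owner t ∈ S}).Preconnected := by
  have hK : ∀ (s t : τ) (hs : owner s ∈ S) (ht : owner t ∈ S), owner s = owner t →
      ((sideGraph vert).induce {t | owner t ∈ S}).Reachable ⟨s, hs⟩ ⟨t, ht⟩ := by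
    intro s t hs ht hst
    have hle : {r | owner r = owner s} ⊆ {t | owner t ∈ S} := fun r hr =>
      show owner r ∈ S from (show owner r = owner s from hr) ▸ hs
    exact (h.preconnected_owner (owner s) ⟨s, rfl⟩ ⟨t, hst.symm⟩).map
      (SimpleGraph.induceHomOfLE (sideGraph vert) hle).toHom
  have hw : ∀ {K L : S} (p : (𝒯.neighbourGraph.induce S).Walk K L) (s t : τ) (hs : owner s ∈ S)
      (ht : owner t ∈ S), owner s = K → owner t = L →
      ((sideGraph vert).induce {t | owner t ∈ S}).Reachable ⟨s, hs⟩ ⟨t, ht⟩ := by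
    intro K L p
    induction p with
    | nil => exact fun s t hs ht hsK htL => hK s t hs ht (hsK.trans htL.symm)
    | @cons K K' L hadj p ih =>
      intro s t hs ht hsK htL
      obtain ⟨s', t', hs', ht', hst⟩ := h.exists_adj_of_neighbour hadj
      have hs'S : owner s' ∈ S := by rw [hs']; exact K.2
      have ht'S : owner t' ∈ S := by rw [ht']; exact K'.2
      refine (hK s s' hs hs'S (hsK.trans hs'.symm)).trans
        (SimpleGraph.Reachable.trans (v := ⟨t', ht'S⟩) (SimpleGraph.Adj.reachable ?_)
          (ih t' t ht'S ht ht' htL))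
      exact hst
  rintro ⟨s, hs⟩ ⟨t, ht⟩
  obtain ⟨p⟩ := hS ⟨owner s, hs⟩ ⟨owner t, ht⟩
  exact hw p s t hs ht rfl rfl

theorem ncard_owner_mem_le [Finite τ] (h : IsSubdivision 𝒯 N σ vert owner) (S : Finset ι) {M : ℕ}
    (hM : S.card ≤ M) : {t | owner t ∈ (S : Set ι)}.ncard ≤ M * N := by
  classical
  have := Fintype.ofFinite τ
  have h1 : {t | owner t ∈ (S : Set ι)} =
      ((S.biUnion fun K => {t | owner t = K}) : Finset τ) := by
    ext t; simp
  rw [h1, Set.ncard_coe_finset]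
  refine (Finset.card_biUnion_le_card_mul S _ N fun K _ => ?_).trans (Nat.mul_le_mul_right N hM)
  have h2 := h.ncard_le K
  rwa [← Set.ncard_coe_finset, Finset.coe_filter_univ]

/-! ### Overlap of the patches -/

theorem ncard_neighbours_le [Finite τ] (h : IsSubdivision 𝒯 N σ vert owner) (K : ι) :
    {L | 𝒯.neighbourGraph.Adj K L}.Finite ∧ {L | 𝒯.neighbourGraph.Adj K L}.ncard ≤ 9 * N := by
  have hex : ∀ L : {L | 𝒯.neighbourGraph.Adj K L}, ∃ e,
      (𝒯.plus e = K ∧ 𝒯.minus e = some L.1) ∨ (𝒯.plus e = L.1 ∧ 𝒯.minus e = some K) := by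
    intro L
    have hL : 𝒯.neighbourGraph.Adj K L := L.2
    rcases ((SimpleGraph.fromRel_adj _ _ _).1 hL).2 with ⟨e, he⟩ | ⟨e, he⟩
    · exact ⟨e, Or.inl he⟩
    · exact ⟨e, Or.inr he⟩
  choose f hf using hex
  have hne : ∀ L : {L | 𝒯.neighbourGraph.Adj K L}, K ≠ L.1 := fun L =>
    𝒯.neighbourGraph.ne_of_adj L.2
  have hinj : Function.Injective (fun L => ⟨f L, (hf L).imp And.left And.right⟩ :
      {L | 𝒯.neighbourGraph.Adj K L} → 𝒯.edgesOf K) := by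
    intro L L' hL
    replace hL : f L = f L' := congrArg Subtype.val hL
    have h1 := hf L
    have h2 := hf L'
    rw [← hL] at h2
    refine Subtype.ext ?_
    rcases h1 with ⟨h1, h1'⟩ | ⟨h1, h1'⟩ <;> rcases h2 with ⟨h2, h2'⟩ | ⟨h2, h2'⟩
    · exact Option.some.inj (h1'.symm.trans h2')
    · exact absurd (h1.symm.trans h2) (hne L')
    · exact absurd (h2.symm.trans h1) (hne L)
    · exact h1.symm.trans h2
  obtain ⟨hfin, hcard⟩ := h.ncard_edgesOf_le K
  have := hfin.to_subtype
  have := Finite.of_injective _ hinj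
  refine ⟨Set.toFinite _, le_trans ?_ hcard⟩
  have h1 := Nat.card_le_card_of_injective _ hinj
  rwa [Nat.card_coe_set_eq, Nat.card_coe_set_eq] at h1

end IsSubdivision

/-- In a graph of bounded degree, the number of vertices at bounded distance from a vertex is
bounded. -/
theorem exists_finset_of_walk {V : Type} {G : SimpleGraph V} {b : ℕ}
    (hG : ∀ v, {w | G.Adj v w}.Finite ∧ {w | G.Adj v w}.ncard ≤ b) (v : V) (k : ℕ) :
    ∃ R : Finset V, R.card ≤ (1 + b) ^ k ∧ ∀ w, (∃ p : G.Walk w v, p.length ≤ k) → w ∈ R := by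
  classical
  induction k with
  | zero =>
    refine ⟨{v}, by simp, ?_⟩
    rintro w ⟨p, hp⟩
    rw [Finset.mem_singleton]
    exact SimpleGraph.Walk.eq_of_length_eq_zero (Nat.le_zero.1 hp)
  | succ k ih =>
    obtain ⟨R, hR, hRw⟩ := ih
    refine ⟨R.biUnion fun w => insert w (hG w).1.toFinset, ?_, ?_⟩
    · rw [pow_succ]
      refine (Finset.card_biUnion_le_card_mul R _ (1 + b) fun w _ => ?_).trans
        (Nat.mul_le_mul_right _ hR)
      refine (Finset.card_insert_le _ _).trans ?_
      rw [add_comm, ← Set.ncard_eq_toFinset_card _ (hG w).1]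
      exact Nat.add_le_add_left (hG w).2 1
    · rintro w ⟨p, hp⟩
      rw [Finset.mem_biUnion]
      cases p with
      | nil => exact ⟨v, hRw v ⟨SimpleGraph.Walk.nil, by simp⟩, Finset.mem_insert_self _ _⟩
      | @cons _ w' _ hadj p =>
        rw [SimpleGraph.Walk.length_cons] at hp
        refine ⟨w', hRw w' ⟨p, by omega⟩, Finset.mem_insert_of_mem ?_⟩
        rw [Set.Finite.mem_toFinset]
        exact hadj.symm

namespace IsSubdivision

variable {Ω : Set Plane} {ι ε : Type} {𝒯 : PolygonalMesh Ω ι ε} {N : ℕ} {σ : ℝ} {τ : Type}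
  {vert : τ → Fin 3 → Plane} {owner : τ → ι}

open Classical in
/-- Each element belongs to a bounded number of patches. -/
theorem card_patches_le [Finite τ] [Fintype ι] (h : IsSubdivision 𝒯 N σ vert owner)
    (P : Patches 𝒯) {M : ℕ} (hM : ∀ K, (P.patch K).card ≤ M) (L : ι) :
    (Finset.univ.filter fun K => L ∈ P.patch K).card ≤ (1 + 9 * N) ^ M := by
  obtain ⟨R, hR, hRw⟩ := exists_finset_of_walk h.ncard_neighbours_le L M
  refine (Finset.card_le_card fun K hK => hRw K ?_).trans hR
  have hL := (Finset.mem_filter.1 hK).2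
  obtain ⟨p, hp⟩ := exists_walk_length_lt (P.connected K).preconnected
    (n := M) (by rw [Nat.card_coe_set_eq, Set.ncard_coe_finset]; exact hM K)
    ⟨K, P.self_mem K⟩ ⟨L, hL⟩
  exact ⟨p.map (SimpleGraph.Embedding.induce _).toHom,
    (SimpleGraph.Walk.length_map _ _).trans_le hp.le⟩

end IsSubdivision

/-! ### Stability of the reconstruction -/

theorem norm_le_of_abs_le {v : Plane} {a : ℝ} (h : ∀ i, |v i| ≤ a) : ‖v‖ ≤ 2 * a := by
  have ha : 0 ≤ a := (abs_nonneg _).trans (h 0)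
  rw [EuclideanSpace.norm_eq, Real.sqrt_le_left (by positivity), Fin.sum_univ_two,
    Real.norm_eq_abs, Real.norm_eq_abs]
  nlinarith [pow_le_pow_left₀ (abs_nonneg _) (h 0) 2, pow_le_pow_left₀ (abs_nonneg _) (h 1) 2]

namespace Patches

variable {Ω : Set Plane} {ι ε : Type} {𝒯 : PolygonalMesh Ω ι ε} (P : Patches 𝒯)

theorem isOpen_region (K : ι) : IsOpen (P.region K) :=
  isOpen_biUnion fun L _ => (𝒯.elt_polygon L).isOpen

theorem isBounded_region (K : ι) : Bornology.IsBounded (P.region K) :=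
  (Bornology.isBounded_biUnion (P.patch K).finite_toSet).2 fun L _ => (𝒯.elt_polygon L).bounded

theorem elt_subset_region {K L : ι} (hL : L ∈ P.patch K) : 𝒯.elt L ⊆ P.region K :=
  Set.subset_biUnion_of_mem (u := fun L => 𝒯.elt L) hL

theorem node_mem_region {K L : ι} (hL : L ∈ P.patch K) : P.node L ∈ P.region K :=
  P.elt_subset_region hL (P.node_mem L)

theorem stabilityConst_nonneg (m : ℕ) (K : ι) : 0 ≤ P.stabilityConst m K :=
  Real.iSup_nonneg fun _ => div_nonneg (Real.iSup_nonneg fun _ => norm_nonneg _)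
    (Real.iSup_nonneg fun _ => norm_nonneg _)

/-- By unisolvence, nodal values control solenoidal polynomials on the patch. The constant is not
explicit: both sides are seminorms on a finite-dimensional space. -/
theorem exists_stability (m : ℕ) (hA : P.AssumptionA m) (K : ι) : ∃ C : ℝ, 0 ≤ C ∧
    ∀ p ∈ solenoidal m, ∀ B, (∀ L ∈ P.patch K, ‖polyField p (P.node L)‖ ≤ B) →
      ∀ x ∈ P.region K, ‖polyField p x‖ ≤ C * B := by
  set Z := closure (P.region K) with hZ
  have hZc : CompactSpace Z := isCompact_iff_compactSpace.1 (P.isBounded_region K).isCompact_closure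
  set ev : solenoidal m →ₗ[ℝ] (P.patch K → Plane) := LinearMap.pi fun L =>
    (LinearMap.proj (P.node L.1)).comp (polyField.comp (solenoidal m).subtype) with hev
  set R : solenoidal m →ₗ[ℝ] C(Z, Plane) := (restrictPolyField Z).comp (solenoidal m).subtype
    with hR
  have hker : LinearMap.ker ev ≤ LinearMap.ker R := by
    intro p hp
    have h0 : ∀ L ∈ P.patch K, polyField p.1 (P.node L) = 0 := fun L hL =>
      congrFun (LinearMap.mem_ker.1 hp) ⟨L, hL⟩
    have h1 : Set.EqOn (polyField p.1) (fun _ => 0) (P.region K) := hA K p.1 p.2 h0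
    have h2 := h1.closure (continuous_polyField p.1) continuous_const
    refine LinearMap.mem_ker.2 (ContinuousMap.ext fun x => ?_)
    exact h2 x.2
  set g : LinearMap.range ev →L[ℝ] C(Z, Plane) := LinearMap.toContinuousLinearMap
    (((LinearMap.ker ev).liftQ R hker).comp ev.quotKerEquivRange.symm.toLinearMap) with hg
  have hgp : ∀ p, g ⟨ev p, LinearMap.mem_range_self ev p⟩ = R p := by
    intro p
    have : ev.quotKerEquivRange.symm ⟨ev p, LinearMap.mem_range_self ev p⟩ =
        (LinearMap.ker ev).mkQ p := by
      rw [LinearEquiv.symm_apply_eq]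
      rfl
    rw [hg, LinearMap.coe_toContinuousLinearMap', LinearMap.comp_apply, LinearEquiv.coe_coe, this]
    rfl
  refine ⟨‖g‖, g.opNorm_nonneg, fun p hp B hB x hx => ?_⟩
  have hB0 : 0 ≤ B := (norm_nonneg _).trans (hB K (P.self_mem K))
  calc ‖polyField p x‖ = ‖R ⟨p, hp⟩ ⟨x, subset_closure hx⟩‖ := rfl
    _ ≤ ‖R ⟨p, hp⟩‖ := ContinuousMap.norm_coe_le_norm _ _
    _ = ‖g ⟨ev ⟨p, hp⟩, LinearMap.mem_range_self ev _⟩‖ := by rw [hgp]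
    _ ≤ ‖g‖ * ‖ev ⟨p, hp⟩‖ := g.le_opNorm _
    _ ≤ ‖g‖ * B := by
        gcongr
        exact (pi_norm_le_iff_of_nonneg hB0).2 fun L => hB L.1 L.2

theorem norm_polyField_le (m : ℕ) (hA : P.AssumptionA m) (K : ι)
    {p : Fin 2 → MvPolynomial (Fin 2) ℝ} (hp : p ∈ solenoidal m) {B : ℝ}
    (hB : ∀ L ∈ P.patch K, ‖polyField p (P.node L)‖ ≤ B) {x : Plane} (hx : x ∈ P.region K) :
    ‖polyField p x‖ ≤ P.stabilityConst m K * B := by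
  obtain ⟨C, hC0, hC⟩ := P.exists_stability m hA K
  have hne : Nonempty (P.patch K) := ⟨⟨K, P.self_mem K⟩⟩
  have hne' : Nonempty (P.region K) := ⟨⟨x, hx⟩⟩
  have hnode : ∀ q : Fin 2 → MvPolynomial (Fin 2) ℝ, ∀ L ∈ P.patch K,
      ‖polyField q (P.node L)‖ ≤ ⨆ L : P.patch K, ‖polyField q (P.node L.1)‖ := fun q L hL =>
    le_ciSup (f := fun L : P.patch K => ‖polyField q (P.node L.1)‖) (Set.finite_range _).bddAbove
      ⟨L, hL⟩
  have hbdd : BddAbove (Set.range fun q : solenoidal m =>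
      (⨆ x : P.region K, ‖polyField q.1 x.1‖) / ⨆ L : P.patch K, ‖polyField q.1 (P.node L.1)‖) := by
    refine ⟨C, ?_⟩
    rintro _ ⟨q, rfl⟩
    exact div_le_of_le_mul₀ (Real.iSup_nonneg fun _ => norm_nonneg _) hC0
      (ciSup_le fun y => hC q.1 q.2 _ (hnode q.1) y.1 y.2)
  have hsup : (⨆ L : P.patch K, ‖polyField p (P.node L.1)‖) ≤ B := ciSup_le fun L => hB L.1 L.2
  have hx' : ‖polyField p x‖ ≤ ⨆ x : P.region K, ‖polyField p x.1‖ := by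
    refine le_ciSup (f := fun x : P.region K => ‖polyField p x.1‖) ⟨C * B, ?_⟩ ⟨x, hx⟩
    rintro _ ⟨y, rfl⟩
    exact hC p hp B hB y.1 y.2
  -- if all nodal values vanish, the quotient in the definition of the constant is `0 / 0`
  rcases (Real.iSup_nonneg fun L : P.patch K => norm_nonneg (polyField p (P.node L.1))).eq_or_lt
    with h0 | h0
  · have h1 := hA K p hp (fun L hL => norm_le_zero_iff.1 ((hnode p L hL).trans_eq h0.symm)) x hx
    rw [h1, norm_zero]
    exact mul_nonneg (P.stabilityConst_nonneg m K) (h0.symm ▸ hsup)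
  · have h1 : _ ≤ P.stabilityConst m K := le_ciSup hbdd ⟨p, hp⟩
    rw [div_le_iff₀ h0] at h1
    exact hx'.trans (h1.trans (mul_le_mul_of_nonneg_left hsup (P.stabilityConst_nonneg m K)))

theorem localRecon_mem (m : ℕ) (v : ι → Plane) (K : ι) : P.localRecon m v K ∈ solenoidal m :=
  (P.exists_argmin m K v).choose_spec.1

/-- Nodal comparison of the least-squares fit with a competitor. -/
theorem norm_localRecon_sub_le (m : ℕ) (v : ι → Plane) (K : ι)
    {q : Fin 2 → MvPolynomial (Fin 2) ℝ} (hq : q ∈ solenoidal m) {b : ℝ}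
    (hb : ∀ L ∈ P.patch K, ‖v L - polyField q (P.node L)‖ ≤ b) {L : ι} (hL : L ∈ P.patch K) :
    ‖polyField (P.localRecon m v K) (P.node L) - polyField q (P.node L)‖ ≤
      2 * Real.sqrt (P.patch K).card * b := by
  have hb0 : 0 ≤ b := (norm_nonneg _).trans (hb L hL)
  have h1 : P.lsq K v (P.localRecon m v K) ≤ P.lsq K v q :=
    (P.exists_argmin m K v).choose_spec.2 q hq
  have h2 : P.lsq K v q ≤ (P.patch K).card * b ^ 2 := by
    rw [lsq, ← nsmul_eq_mul]
    exact Finset.sum_le_card_nsmul _ _ _ fun L hL => pow_le_pow_left₀ (norm_nonneg _) (hb L hL) 2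
  have h3 : ‖v L - polyField (P.localRecon m v K) (P.node L)‖ ^ 2 ≤
      P.lsq K v (P.localRecon m v K) :=
    Finset.single_le_sum
      (f := fun L => ‖v L - polyField (P.localRecon m v K) (P.node L)‖ ^ 2)
      (fun _ _ => sq_nonneg _) hL
  have h4 : ‖v L - polyField (P.localRecon m v K) (P.node L)‖ ≤
      Real.sqrt (P.patch K).card * b := by
    rw [← Real.sqrt_sq hb0, ← Real.sqrt_mul (Nat.cast_nonneg _)]
    exact Real.le_sqrt_of_sq_le (h3.trans (h1.trans h2))
  have h5 : 1 ≤ Real.sqrt (P.patch K).card := by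
    rw [Real.one_le_sqrt]
    exact_mod_cast Finset.card_pos.2 ⟨L, hL⟩
  have h6 : b ≤ Real.sqrt (P.patch K).card * b := le_mul_of_one_le_left hb0 h5
  have h7 := hb L hL
  calc _ = ‖(v L - polyField q (P.node L)) -
        (v L - polyField (P.localRecon m v K) (P.node L))‖ := by congr 1; abel
    _ ≤ b + Real.sqrt (P.patch K).card * b := (norm_sub_le _ _).trans (add_le_add h7 h4)
    _ ≤ _ := by linarith

theorem le_Lam [Finite ι] (m : ℕ) (K : ι) :
    1 + P.stabilityConst m K * Real.sqrt (P.patch K).card ≤ P.Lam m :=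
  le_ciSup (f := fun K => 1 + P.stabilityConst m K * Real.sqrt (P.patch K).card)
    (Set.finite_range _).bddAbove K

theorem one_le_Lam [Finite ι] (m : ℕ) (K : ι) : 1 ≤ P.Lam m :=
  (le_add_of_nonneg_right (mul_nonneg (P.stabilityConst_nonneg m K) (Real.sqrt_nonneg _))).trans
    (P.le_Lam m K)

/-- Quasi-optimality of the interpolant on the patch in the maximum norm. -/
theorem norm_sub_interpolant_le [Finite ι] (m : ℕ) (hA : P.AssumptionA m) (u : Plane → Plane)
    (K : ι) {q : Fin 2 → MvPolynomial (Fin 2) ℝ} (hq : q ∈ solenoidal m) {b : ℝ}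
    (hb : ∀ x ∈ closure (P.region K), ‖u x - polyField q x‖ ≤ b) {x : Plane}
    (hx : x ∈ closure (P.region K)) :
    ‖u x - P.interpolant m u K x‖ ≤ 2 * P.Lam m * b := by
  have hb0 : 0 ≤ b := (norm_nonneg _).trans (hb x hx)
  set p := P.localRecon m (fun K => u (P.node K)) K with hp
  have hnode : ∀ L ∈ P.patch K, ‖polyField (p - q) (P.node L)‖ ≤
      2 * Real.sqrt (P.patch K).card * b := by
    intro L hL
    rw [map_sub]
    exact P.norm_localRecon_sub_le m _ K hq
      (fun L hL => hb _ (subset_closure (P.node_mem_region hL))) hL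
  have h1 : P.region K ⊆ {y | ‖polyField (p - q) y‖ ≤
      P.stabilityConst m K * (2 * Real.sqrt (P.patch K).card * b)} := fun y hy =>
    P.norm_polyField_le m hA K (Submodule.sub_mem _ (P.localRecon_mem m _ K) hq) hnode hy
  have h2 : ‖polyField (p - q) x‖ ≤
      P.stabilityConst m K * (2 * Real.sqrt (P.patch K).card * b) :=
    closure_minimal h1 (isClosed_le (continuous_polyField _).norm continuous_const) hx
  have h3 : P.interpolant m u K x = polyField p x := rfl
  rw [map_sub, Pi.sub_apply] at h2
  have h4 := P.le_Lam m K
  calc ‖u x - P.interpolant m u K x‖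
      = ‖(u x - polyField q x) - (polyField p x - polyField q x)‖ := by
        rw [h3]; congr 1; abel
    _ ≤ b + P.stabilityConst m K * (2 * Real.sqrt (P.patch K).card * b) :=
        (norm_sub_le _ _).trans (add_le_add (hb x hx) h2)
    _ ≤ 2 * (1 + P.stabilityConst m K * Real.sqrt (P.patch K).card) * b := by linarith
    _ ≤ 2 * P.Lam m * b := by gcongr

end Patches

open Patches in
/-- The maximum norm of the interpolation error on an element. -/
theorem exists_interpolant_bound (m : ℕ) (hm : 1 ≤ m) (N M : ℕ) (σ : ℝ) : ∃ C : ℝ, 0 ≤ C ∧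
    ∀ {Ω : Set Plane} {ι ε τ : Type} [Finite ι] [Finite τ] {𝒯 : PolygonalMesh Ω ι ε}
      {P : Patches 𝒯} {vert : τ → Fin 3 → Plane} {owner : τ → ι} {u : Plane → Plane}
      {G : Fin 2 → ℕ → Plane → ℝ}, IsPolygon Ω → IsSubdivision 𝒯 N σ vert owner →
      (∀ K, (P.patch K).card ≤ M) → P.AssumptionA m → IsSolenoidalSobolev m Ω u G →
      ∀ t : τ, ∀ x ∈ closure (𝒯.elt (owner t)),
        ‖u x - P.interpolant m u (owner t) x‖ ≤ C * P.Lam m * Metric.diam (triangle (vert t)) ^ m *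
          Real.sqrt (∫ x in P.region (owner t), density m G x) := by
  obtain ⟨C, hC0, hC⟩ := exists_approx_union m hm (M * N) σ
  refine ⟨4 * C, by positivity, ?_⟩
  intro Ω ι ε τ _ _ 𝒯 P vert owner u G hΩ hT hM hA hu t x hx
  set K := owner t with hK
  set X := Metric.diam (triangle (vert t)) ^ m *
    Real.sqrt (∫ x in P.region K, density m G x) with hX
  have hΛ := P.one_le_Lam m K
  have hreg : P.region K ⊆ Ω := Set.iUnion₂_subset fun L _ => 𝒯.elt_subset hΩ L
  have hcl : ∀ y ∈ closure (P.region K), ∃ s, owner s ∈ (P.patch K : Set ι) ∧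
      y ∈ triangle (vert s) := by
    intro y hy
    rw [region, Finset.closure_biUnion] at hy
    obtain ⟨L, hL, hyL⟩ := Set.mem_iUnion₂.1 hy
    obtain ⟨s, rfl, hs⟩ := hT.exists_mem_triangle hyL
    exact ⟨s, hL, hs⟩
  have key : ∀ δ > 0, ‖u x - P.interpolant m u K x‖ ≤ 4 * C * P.Lam m * (X + δ) := by
    intro δ hδ
    obtain ⟨q, hq, hqb⟩ := hC (A := {t | owner t ∈ (P.patch K : Set ι)}) (t₀ := t) hT.family
      (Set.toFinite _) (hT.preconnected_of_connected (P.connected K).preconnected)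
      (hT.ncard_owner_mem_le _ (hM K)) hΩ.isOpen hΩ.regular hu (P.isOpen_region K) hreg
      (fun s hs => (hT.interior_subset s).trans (P.elt_subset_region hs)) (P.self_mem K) hδ
    have h1 := P.norm_sub_interpolant_le m hA u K hq (b := 2 * (C * (X + δ))) (fun y hy => by
      obtain ⟨s, hs, hys⟩ := hcl y hy
      exact norm_le_of_abs_le fun i => hqb s hs y hys i)
      (closure_mono (P.elt_subset_region (P.self_mem K)) hx)
    exact h1.trans_eq (by ring)
  have h2 : ‖u x - P.interpolant m u K x‖ ≤ 4 * C * P.Lam m * X := by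
    have hc : Filter.Tendsto (fun δ : ℝ => 4 * C * P.Lam m * (X + δ)) (𝓝[>] 0)
        (𝓝 (4 * C * P.Lam m * (X + 0))) :=
      ((by fun_prop : Continuous fun δ : ℝ => 4 * C * P.Lam m * (X + δ)).tendsto
        0).mono_left nhdsWithin_le_nhds
    rw [add_zero] at hc
    exact ge_of_tendsto hc (Filter.eventually_of_mem self_mem_nhdsWithin key)
  exact h2.trans_eq (by rw [hX]; ring)

/-! ### The broken seminorm of the interpolation error -/

theorem diam_triangle_le_patchSize {Ω : Set Plane} {ι ε τ : Type} [Finite ι]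
    {𝒯 : PolygonalMesh Ω ι ε} {P : Patches 𝒯} {N : ℕ} {σ : ℝ} {vert : τ → Fin 3 → Plane}
    {owner : τ → ι} (hT : IsSubdivision 𝒯 N σ vert owner) (t : τ) :
    Metric.diam (triangle (vert t)) ≤ P.patchSize :=
  (hT.diam_triangle_le_of_subset (P.isBounded_region (owner t))
    (P.elt_subset_region (P.self_mem _))).trans
    (le_ciSup (f := fun K => Metric.diam (P.region K)) (Set.finite_range _).bddAbove (owner t))

theorem diam_triangle_le_meshSize {Ω : Set Plane} {ι ε τ : Type} [Finite ι]
    {𝒯 : PolygonalMesh Ω ι ε} {N : ℕ} {σ : ℝ} {vert : τ → Fin 3 → Plane}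
    {owner : τ → ι} (hT : IsSubdivision 𝒯 N σ vert owner) (t : τ) :
    Metric.diam (triangle (vert t)) ≤ 𝒯.meshSize :=
  (hT.diam_triangle_le_of_subset (𝒯.elt_polygon (owner t)).bounded subset_rfl).trans
    (le_ciSup (f := fun K => Metric.diam (𝒯.elt K)) (Set.finite_range _).bddAbove (owner t))

/-- The first derivatives of the interpolation error on a triangle. -/
theorem exists_triangle_bound (m : ℕ) (hm : 1 ≤ m) (N M : ℕ) (σ : ℝ) : ∃ C : ℝ, 0 ≤ C ∧
    ∀ {Ω : Set Plane} {ι ε τ : Type} [Finite ι] [Finite τ] {𝒯 : PolygonalMesh Ω ι ε}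
      {P : Patches 𝒯} {vert : τ → Fin 3 → Plane} {owner : τ → ι} {u : Plane → Plane}
      {G : Fin 2 → ℕ → Plane → ℝ}, IsPolygon Ω → IsSubdivision 𝒯 N σ vert owner →
      (∀ K, (P.patch K).card ≤ M) → P.AssumptionA m → IsSolenoidalSobolev m Ω u G →
      ∀ (t : τ) (i k : Fin 2) (g : Plane → ℝ),
        IsWeakDeriv (interior (triangle (vert t))) (1 - (i : ℕ)) i
          (fun x => u x k - P.interpolant m u (owner t) x k) g →
        MemLp g 2 (volume.restrict (interior (triangle (vert t)))) →
        ∫ x in interior (triangle (vert t)), g x ^ 2 ≤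
          C * P.Lam m ^ 2 * (Metric.diam (triangle (vert t)) ^ m) ^ 2 *
            ∫ x in P.region (owner t), density m G x := by
  obtain ⟨C₁, hC₁, hsup⟩ := exists_interpolant_bound m hm N M σ
  obtain ⟨C₂, hC₂, hint⟩ := exists_interpolation m hm
  refine ⟨C₂ * (2 * σ) ^ 4 * (C₁ ^ 2 + (σ ^ m) ^ 2), by positivity, ?_⟩
  intro Ω ι ε τ _ _ 𝒯 P vert owner u G hΩ hT hM hA hu t i k g hg hgL
  set D := interior (triangle (vert t)) with hD
  set d := Metric.diam (triangle (vert t)) with hd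
  set J := ∫ x in P.region (owner t), density m G x with hJ
  set p := P.localRecon m (fun K => u (P.node K)) (owner t) with hp
  have hpS : p ∈ solenoidal m := P.localRecon_mem m _ _
  have hσ := hT.family.one_le t
  have hd0 : 0 < d := hT.family.diam_pos t
  have hΛ := P.one_le_Lam m (owner t)
  have hreg : P.region (owner t) ⊆ Ω := Set.iUnion₂_subset fun L _ => 𝒯.elt_subset hΩ L
  have hDR : D ⊆ P.region (owner t) :=
    (hT.interior_subset t).trans (P.elt_subset_region (P.self_mem _))
  have huD := hu.mono hΩ.isOpen.measurableSet (hDR.trans hreg)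
  have hdens : IntegrableOn (density m G) (P.region (owner t)) :=
    (hu.mono hΩ.isOpen.measurableSet hreg).integrableOn_density
  have hJ0 : 0 ≤ J := integral_nonneg fun x => density_nonneg m G x
  obtain ⟨c, r, hr, hc, hdr, hrd⟩ := hT.family.exists_disc t
  have hDb : Bornology.IsBounded D := (isCompact_triangle _).isBounded.subset interior_subset
  have hcont : ContinuousOn (fun x => u x k - P.interpolant m u (owner t) x k) (closure D) := by
    refine ContinuousOn.sub ?_ ?_
    · exact (EuclideanSpace.proj (𝕜 := ℝ) k).continuous.comp_continuousOn huD.cont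
    · exact ((EuclideanSpace.proj (𝕜 := ℝ) k).continuous.comp
        (continuous_polyField p)).continuousOn
  -- the polynomial does not contribute to the derivatives of order `m + 1`
  have hweak : ∀ a ≤ m + 1, IsWeakDeriv D a (m + 1 - a)
      (fun x => u x k - P.interpolant m u (owner t) x k) (G k a) := by
    intro a ha
    have h1 := (huD.weak k a ha).sub
      (isWeakDeriv_mixedDeriv D a (m + 1 - a) (contDiff_eval (p k)))
    rw [mixedDeriv_eval_eq_zero (by omega) (hpS.1 k)] at h1
    simp only [sub_zero] at h1
    exact h1
  -- the triangle contains a disc of radius `r` and lies in the concentric disc of radius `2 σ r`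
  have h1 := hint isOpen_interior (convex_triangle _).interior hr
    (interior_maximal (Metric.ball_subset_closedBall.trans hc) Metric.isOpen_ball)
    (R := 2 * σ * r) (S := C₁ * P.Lam m * d ^ m * Real.sqrt J)
    (fun x hx => Metric.mem_closedBall.2 ((dist_le_diam_triangle (interior_subset hx)
      (hc (Metric.mem_closedBall_self hr.le))).trans hdr))
    (fun x hx => (abs_coord_le (u x - P.interpolant m u (owner t) x) k).trans
      (hsup hΩ hT hM hA hu t x (subset_closure (hT.interior_subset t hx))))
    (integrableOn_of_continuousOn_closure hDb hcont) hg hgL hweak (fun a ha => huD.memLp k a ha)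
  have h2 : ∑ a ∈ Finset.range (m + 2), ∫ x in D, G k a x ^ 2 ≤ J :=
    (huD.sum_integral_le k).trans (setIntegral_mono_set hdens
      (Filter.Eventually.of_forall fun x => density_nonneg m G x) (LE.le.eventuallyLE hDR))
  have h3 : (2 * σ * r) ^ (2 * m) ≤ (σ ^ m) ^ 2 * (d ^ m) ^ 2 := by
    calc (2 * σ * r) ^ (2 * m) ≤ (σ * d) ^ (2 * m) := by
          refine pow_le_pow_left₀ (by positivity) ?_ _
          nlinarith
      _ = _ := by ring
  have h4 : 0 ≤ ∑ a ∈ Finset.range (m + 2), ∫ x in D, G k a x ^ 2 :=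
    Finset.sum_nonneg fun _ _ => integral_nonneg fun _ => sq_nonneg _
  have hq : 2 * σ * r / r = 2 * σ := by field_simp
  rw [hq] at h1
  refine h1.trans ?_
  have h5 : (C₁ * P.Lam m * d ^ m * Real.sqrt J) ^ 2 =
      C₁ ^ 2 * (P.Lam m ^ 2 * (d ^ m) ^ 2 * J) := by
    rw [mul_pow _ (Real.sqrt J), Real.sq_sqrt hJ0]; ring
  have h6 : (2 * σ * r) ^ (2 * m) * ∑ a ∈ Finset.range (m + 2), ∫ x in D, G k a x ^ 2 ≤
      (σ ^ m) ^ 2 * (P.Lam m ^ 2 * (d ^ m) ^ 2 * J) := by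
    calc _ ≤ (σ ^ m) ^ 2 * (d ^ m) ^ 2 * J := by gcongr
      _ = (σ ^ m) ^ 2 * (1 ^ 2 * (d ^ m) ^ 2 * J) := by ring
      _ ≤ _ := by gcongr
  calc _ ≤ C₂ * (2 * σ) ^ 4 * (C₁ ^ 2 * (P.Lam m ^ 2 * (d ^ m) ^ 2 * J) +
        (σ ^ m) ^ 2 * (P.Lam m ^ 2 * (d ^ m) ^ 2 * J)) := by
        rw [h5]; gcongr
    _ = _ := by ring

open Classical in
/-- The integral over an element is bounded by the sum of the integrals over its triangles. -/
theorem IsSubdivision.setIntegral_le_sum {Ω : Set Plane} {ι ε τ : Type} [Fintype τ]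
    {𝒯 : PolygonalMesh Ω ι ε} {N : ℕ} {σ : ℝ} {vert : τ → Fin 3 → Plane}
    {owner : τ → ι} (hT : IsSubdivision 𝒯 N σ vert owner) (K : ι) {f : Plane → ℝ}
    (hf : IntegrableOn f (𝒯.elt K)) (hf0 : ∀ x, 0 ≤ f x) :
    ∫ x in 𝒯.elt K, f x ≤
      ∑ t ∈ Finset.univ.filter (fun t => owner t = K), ∫ x in interior (triangle (vert t)), f x := by
  have hint : ∀ t ∈ Finset.univ.filter (fun t => owner t = K),
      Integrable ((interior (triangle (vert t))).indicator f) := by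
    intro t ht
    obtain rfl := (Finset.mem_filter.1 ht).2
    exact (integrable_indicator_iff isOpen_interior.measurableSet).2
      (hf.mono_set (hT.interior_subset t))
  rw [← integral_indicator (𝒯.elt_polygon K).isOpen.measurableSet]
  simp only [← integral_indicator isOpen_interior.measurableSet]
  rw [← integral_finsetSum _ hint]
  refine integral_mono_ae
    ((integrable_indicator_iff (𝒯.elt_polygon K).isOpen.measurableSet).2 hf)
    (integrable_finsetSum _ hint) ?_
  have hfr : ∀ᵐ x, ∀ t, x ∉ frontier (triangle (vert t)) := ae_all_iff.2 fun t =>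
    measure_eq_zero_iff_ae_notMem.1 (IsConformingFamily.volume_frontier t)
  filter_upwards [hfr] with x hx
  have h0 : ∀ t, 0 ≤ (interior (triangle (vert t))).indicator f x := fun t =>
    Set.indicator_nonneg (fun y _ => hf0 y) x
  by_cases hxK : x ∈ 𝒯.elt K
  · obtain ⟨t, ht, hxt⟩ := hT.exists_mem_triangle (subset_closure hxK)
    have hxi : x ∈ interior (triangle (vert t)) := by
      by_contra h
      refine hx t ?_
      rw [(isClosed_triangle _).frontier_eq]
      exact ⟨hxt, h⟩
    rw [Set.indicator_of_mem hxK, ← Set.indicator_of_mem hxi f]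
    exact Finset.single_le_sum (f := fun t => (interior (triangle (vert t))).indicator f x)
      (fun t _ => h0 t) (Finset.mem_filter.2 ⟨Finset.mem_univ t, ht⟩)
  · rw [Set.indicator_of_notMem hxK]
    exact Finset.sum_nonneg fun t _ => h0 t

theorem memLp_two_of_continuous {D : Set Plane} (hDb : Bornology.IsBounded D) {f : Plane → ℝ}
    (hf : Continuous f) : MemLp f 2 (volume.restrict D) :=
  (memLp_two_iff_integrable_sq hf.aestronglyMeasurable).2
    (integrableOn_of_continuous hDb (hf.pow 2))

/-- The broken seminorm of the interpolation error on an element. -/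
theorem exists_seminormSq_bound (m : ℕ) (hm : 1 ≤ m) (N M : ℕ) (σ h₀ : ℝ) : ∃ C : ℝ,
    ∀ {Ω : Set Plane} {ι ε τ : Type} [Finite ι] [Finite τ] {𝒯 : PolygonalMesh Ω ι ε}
      {P : Patches 𝒯} {vert : τ → Fin 3 → Plane} {owner : τ → ι} {u : Plane → Plane}
      {G : Fin 2 → ℕ → Plane → ℝ}, IsPolygon Ω → IsSubdivision 𝒯 N σ vert owner →
      𝒯.meshSize ≤ h₀ → (∀ K, (P.patch K).card ≤ M) → P.AssumptionA m →
      IsSolenoidalSobolev m Ω u G → MemHVec 1 Ω u → ∀ K : ι,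
        seminormSq 1 (𝒯.elt K) (fun x => u x - P.interpolant m u K x) ≤
          C * (P.Lam m ^ 2 * P.patchSize ^ m * ∫ x in P.region K, density m G x) := by
  obtain ⟨C, hC, htri⟩ := exists_triangle_bound m hm N M σ
  refine ⟨2 * (2 * (N * (C * h₀ ^ m))), ?_⟩
  intro Ω ι ε τ _ _ 𝒯 P vert owner u G hΩ hT hh hM hA hu hu1 K
  have := Fintype.ofFinite τ
  set J := ∫ x in P.region K, density m G x with hJ
  have hJ0 : 0 ≤ J := integral_nonneg fun x => density_nonneg m G x
  set X := C * h₀ ^ m * (P.Lam m ^ 2 * P.patchSize ^ m * J) with hX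
  obtain ⟨t₀, ht₀⟩ := hT.exists_owner_eq K
  have hh0 : 0 ≤ h₀ := (hT.family.diam_pos t₀).le.trans ((diam_triangle_le_meshSize hT t₀).trans hh)
  have hd0 : 0 ≤ P.patchSize :=
    (hT.family.diam_pos t₀).le.trans (diam_triangle_le_patchSize hT t₀)
  have hX0 : 0 ≤ X := by positivity
  have key : ∀ k : Fin 2, ∀ a ∈ Finset.range (1 + 1),
      ∫ x in 𝒯.elt K, weakDeriv (𝒯.elt K) a (1 - a)
        (fun y => (u y - P.interpolant m u K y) k) x ^ 2 ≤ N * X := by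
    intro k a ha
    have ha1 : a ≤ 1 := Nat.lt_succ_iff.1 (Finset.mem_range.1 ha)
    obtain ⟨g, hg, hgL⟩ := hu1 k a (1 - a) (by omega)
    set p := P.localRecon m (fun K => u (P.node K)) K with hp
    have hΩK := 𝒯.elt_subset hΩ K
    have hw : IsWeakDeriv (𝒯.elt K) a (1 - a) (fun y => (u y - P.interpolant m u K y) k)
        (fun x => g x - mixedDeriv a (1 - a)
          (fun x : Plane => MvPolynomial.eval (fun j => x j) (p k)) x) :=
      (hg.mono hΩ.isOpen.measurableSet hΩK).sub
        (isWeakDeriv_mixedDeriv (𝒯.elt K) a (1 - a) (contDiff_eval (p k)))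
    have hwL : MemLp (fun x => g x - mixedDeriv a (1 - a)
          (fun x : Plane => MvPolynomial.eval (fun j => x j) (p k)) x) 2
        (volume.restrict (𝒯.elt K)) :=
      (hgL.mono_measure (Measure.restrict_mono hΩK le_rfl)).sub
        (memLp_two_of_continuous (𝒯.elt_polygon K).bounded
          (continuous_mixedDeriv a (1 - a) (contDiff_eval (p k))))
    set W := weakDeriv (𝒯.elt K) a (1 - a) (fun y => (u y - P.interpolant m u K y) k) with hW
    have hWw : IsWeakDeriv (𝒯.elt K) a (1 - a) (fun y => (u y - P.interpolant m u K y) k) W :=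
      hw.weakDeriv
    have hWL : MemLp W 2 (volume.restrict (𝒯.elt K)) :=
      hwL.ae_eq (hw.ae_eq (𝒯.elt_polygon K).isOpen hWw)
    obtain ⟨i, hi1, hi2⟩ : ∃ i : Fin 2, 1 - (i : ℕ) = a ∧ (i : ℕ) = 1 - a := by
      interval_cases a
      · exact ⟨1, rfl, rfl⟩
      · exact ⟨0, rfl, rfl⟩
    classical
    refine (hT.setIntegral_le_sum K hWL.integrable_sq fun x => sq_nonneg _).trans ?_
    have hcard : (Finset.univ.filter fun t => owner t = K).card ≤ N := by
      have := hT.ncard_le K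
      rwa [← Set.ncard_coe_finset, Finset.coe_filter_univ]
    refine (Finset.sum_le_card_nsmul _ _ X fun t ht => ?_).trans ?_
    · obtain rfl := (Finset.mem_filter.1 ht).2
      have hsub := hT.interior_subset t
      have hmeas := (𝒯.elt_polygon (owner t)).isOpen.measurableSet
      have h1 := htri hΩ hT hM hA hu t i k W (by rw [hi1, hi2]; exact hWw.mono hmeas hsub)
        (hWL.mono_measure (Measure.restrict_mono hsub le_rfl))
      refine h1.trans ?_
      have h2 : (Metric.diam (triangle (vert t)) ^ m) ^ 2 ≤ h₀ ^ m * P.patchSize ^ m := by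
        rw [sq]
        gcongr
        · exact (diam_triangle_le_meshSize hT t).trans hh
        · exact diam_triangle_le_patchSize hT t
      calc _ ≤ C * P.Lam m ^ 2 * (h₀ ^ m * P.patchSize ^ m) * J := by gcongr
        _ = X := by rw [hX]; ring
    · rw [nsmul_eq_mul]
      gcongr
  have h1 : seminormSq 1 (𝒯.elt K) (fun x => u x - P.interpolant m u K x) ≤
      ∑ _k : Fin 2, ∑ _a ∈ Finset.range (1 + 1), N * X :=
    Finset.sum_le_sum fun k _ => Finset.sum_le_sum fun a ha => key k a ha
  refine h1.trans_eq ?_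
  simp only [Finset.sum_const, Finset.card_univ, Fintype.card_fin, Finset.card_range, nsmul_eq_mul]
  rw [hX]
  push_cast
  ring

/-! ### Jumps of the interpolation error -/

section Jumps

variable {Ω : Set Plane} {ι ε : Type} (𝒯 : PolygonalMesh Ω ι ε)

theorem norm_sq_plane (v : Plane) : ‖v‖ ^ 2 = v 0 ^ 2 + v 1 ^ 2 := by
  rw [EuclideanSpace.real_norm_sq_eq, Fin.sum_univ_two]

theorem sum_jumpTensor_sq_le (v : ι → Plane → Plane) (e : ε) (x : Plane) :
    ∑ i, ∑ k, 𝒯.jumpTensor v e x i k ^ 2 ≤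
      match 𝒯.minus e with
      | some j => 2 * (‖v (𝒯.plus e) x‖ ^ 2 + ‖v j x‖ ^ 2)
      | none => 2 * ‖v (𝒯.plus e) x‖ ^ 2 := by
  have hn : 𝒯.normal e 0 ^ 2 + 𝒯.normal e 1 ^ 2 = 1 := by
    rw [← norm_sq_plane, 𝒯.normal_unit, one_pow]
  have h2 : 𝒯.normal e 1 ^ 2 = 1 - 𝒯.normal e 0 ^ 2 := by linarith
  cases h : 𝒯.minus e with
  | some j =>
    simp only [PolygonalMesh.jumpTensor, h, Fin.sum_univ_two, Matrix.of_apply, PiLp.neg_apply,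
      norm_sq_plane]
    have e1 : ∀ a b : ℝ, (a * 𝒯.normal e 0 + b * -𝒯.normal e 0) ^ 2 +
        (a * 𝒯.normal e 1 + b * -𝒯.normal e 1) ^ 2 = (a - b) ^ 2 := fun a b => by
      linear_combination (a - b) ^ 2 * hn
    rw [e1, e1]
    nlinarith [sq_nonneg (v (𝒯.plus e) x 0 + v j x 0), sq_nonneg (v (𝒯.plus e) x 1 + v j x 1)]
  | none =>
    simp only [PolygonalMesh.jumpTensor, h, Fin.sum_univ_two, Matrix.of_apply, norm_sq_plane]
    have e1 : ∀ a : ℝ, (a * 𝒯.normal e 0) ^ 2 + (a * 𝒯.normal e 1) ^ 2 = a ^ 2 := fun a => by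
      linear_combination a ^ 2 * hn
    rw [e1, e1]
    nlinarith [sq_nonneg (v (𝒯.plus e) x 0), sq_nonneg (v (𝒯.plus e) x 1)]

theorem jumpNormal_sq_le (v : ι → Plane → Plane) (e : ε) (x : Plane) :
    𝒯.jumpNormal v e x ^ 2 ≤
      match 𝒯.minus e with
      | some j => 2 * (‖v (𝒯.plus e) x‖ ^ 2 + ‖v j x‖ ^ 2)
      | none => 2 * ‖v (𝒯.plus e) x‖ ^ 2 := by
  have hin : ∀ w : Plane, |inner ℝ w (𝒯.normal e)| ≤ ‖w‖ := fun w => by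
    simpa [𝒯.normal_unit] using abs_real_inner_le_norm w (𝒯.normal e)
  have hsq : ∀ w : Plane, inner ℝ w (𝒯.normal e) ^ 2 ≤ ‖w‖ ^ 2 := fun w =>
    sq_le_sq.2 ((hin w).trans (le_abs_self _))
  have h1 := hsq (v (𝒯.plus e) x)
  cases h : 𝒯.minus e with
  | some j =>
    simp only [PolygonalMesh.jumpNormal, h, inner_neg_right]
    have h2 := hsq (v j x)
    nlinarith [sq_nonneg (inner ℝ (v (𝒯.plus e) x) (𝒯.normal e) +
      inner ℝ (v j x) (𝒯.normal e))]
  | none =>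
    simp only [PolygonalMesh.jumpNormal, h]
    nlinarith [sq_nonneg ‖v (𝒯.plus e) x‖]

theorem edgeIntegral_le {e : ε} {F : Plane → ℝ} {B : ℝ} (hF : ∀ x, 0 ≤ F x)
    (hB : ∀ x ∈ segment ℝ (𝒯.src e) (𝒯.tgt e), F x ≤ B) :
    𝒯.edgeIntegral e F ≤ dist (𝒯.src e) (𝒯.tgt e) * B := by
  refine mul_le_mul_of_nonneg_left ?_ dist_nonneg
  have h := intervalIntegral.norm_integral_le_of_norm_le_const (a := 0) (b := 1) (C := B)
    (f := fun t => F (AffineMap.lineMap (𝒯.src e) (𝒯.tgt e) t)) fun t ht => by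
      rw [Set.uIoc_of_le zero_le_one] at ht
      rw [Real.norm_eq_abs, abs_of_nonneg (hF _)]
      refine hB _ ?_
      rw [segment_eq_image_lineMap]
      exact ⟨t, ⟨ht.1.le, ht.2⟩, rfl⟩
  rw [sub_zero, abs_one, mul_one] at h
  exact (le_abs_self _).trans h

open Classical in
/-- The one or two elements that contribute to the jump on an edge are among those with this edge. -/
theorem le_sum_of_le_match [Fintype ι] {v : ι → Plane → Plane} {e : ε} {X : ι → ℝ}
    (hX : ∀ K, e ∈ 𝒯.edgesOf K → ∀ x ∈ segment ℝ (𝒯.src e) (𝒯.tgt e), ‖v K x‖ ^ 2 ≤ X K)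
    {x : Plane} (hx : x ∈ segment ℝ (𝒯.src e) (𝒯.tgt e)) :
    (match 𝒯.minus e with
      | some j => 2 * (‖v (𝒯.plus e) x‖ ^ 2 + ‖v j x‖ ^ 2)
      | none => 2 * ‖v (𝒯.plus e) x‖ ^ 2) ≤
      2 * ∑ K ∈ Finset.univ.filter (fun K => e ∈ 𝒯.edgesOf K), X K := by
  have h0 : ∀ K ∈ Finset.univ.filter (fun K => e ∈ 𝒯.edgesOf K), 0 ≤ X K := fun K hK =>
    (sq_nonneg _).trans (hX K (Finset.mem_filter.1 hK).2 x hx)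
  have hp : e ∈ 𝒯.edgesOf (𝒯.plus e) := Or.inl rfl
  cases h : 𝒯.minus e with
  | some j =>
    have hj : e ∈ 𝒯.edgesOf j := Or.inr h
    have h1 : ∑ K ∈ {𝒯.plus e, j}, X K ≤
        ∑ K ∈ Finset.univ.filter (fun K => e ∈ 𝒯.edgesOf K), X K := by
      refine Finset.sum_le_sum_of_subset_of_nonneg ?_ fun K hK _ => h0 K hK
      intro K hK
      rw [Finset.mem_insert, Finset.mem_singleton] at hK
      rcases hK with rfl | rfl <;> simp [hp, hj]
    rw [Finset.sum_pair (𝒯.edge_minus e j h).1.symm] at h1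
    have h2 := hX _ hp x hx
    have h3 := hX _ hj x hx
    change 2 * (‖v (𝒯.plus e) x‖ ^ 2 + ‖v j x‖ ^ 2) ≤ _
    linarith
  | none =>
    have h1 : X (𝒯.plus e) ≤ ∑ K ∈ Finset.univ.filter (fun K => e ∈ 𝒯.edgesOf K), X K :=
      Finset.single_le_sum h0 (by simp [hp])
    have h2 := hX _ hp x hx
    change 2 * ‖v (𝒯.plus e) x‖ ^ 2 ≤ _
    linarith

open Classical in
/-- A sum over the edges of contributions of the adjacent elements. -/
theorem sum_edges_le {N : ℕ} {σ : ℝ} {τ : Type} [Finite τ] [Fintype ι] [Fintype ε]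
    {vert : τ → Fin 3 → Plane} {owner : τ → ι} {𝒯 : PolygonalMesh Ω ι ε}
    (hT : IsSubdivision 𝒯 N σ vert owner) {X : ι → ℝ} (hX : ∀ K, 0 ≤ X K) {F : ε → ℝ}
    (hF : ∀ e, F e ≤ 2 * ∑ K ∈ Finset.univ.filter (fun K => e ∈ 𝒯.edgesOf K), X K) :
    ∑ e, F e ≤ 18 * N * ∑ K, X K := by
  calc ∑ e, F e ≤ ∑ e, 2 * ∑ K ∈ Finset.univ.filter (fun K => e ∈ 𝒯.edgesOf K), X K :=
        Finset.sum_le_sum fun e _ => hF e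
    _ = 2 * ∑ K, ∑ e ∈ Finset.univ.filter (fun e => e ∈ 𝒯.edgesOf K), X K := by
        rw [← Finset.mul_sum]
        congr 1
        exact Finset.sum_comm' (by simp)
    _ ≤ 2 * ∑ K, (9 * N : ℕ) * X K := by
        gcongr with K
        rw [Finset.sum_const, nsmul_eq_mul]
        refine mul_le_mul_of_nonneg_right ?_ (hX K)
        have h := (hT.ncard_edgesOf_le K).2
        have h' : (Finset.univ.filter fun e => e ∈ 𝒯.edgesOf K).card = (𝒯.edgesOf K).ncard := by
          rw [← Set.ncard_coe_finset]
          congr 1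
          ext e
          simp
        rw [← h'] at h
        exact_mod_cast h
    _ = 18 * N * ∑ K, X K := by
        rw [← Finset.mul_sum]
        push_cast
        ring

end Jumps

/-- The jump terms of the interpolation error. The length of an edge is bounded from below by the
diameter of a triangle at that edge, so that the negative powers of the lengths are absorbed by the
powers of that diameter in the maximum norm estimate. -/
theorem exists_jump_bound (m : ℕ) (hm : 1 ≤ m) (N M : ℕ) (σ h₀ : ℝ) : ∃ C : ℝ,
    ∀ {Ω : Set Plane} {ι ε τ : Type} [Fintype ι] [Fintype ε] [Finite τ]
      {𝒯 : PolygonalMesh Ω ι ε}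
      {P : Patches 𝒯} {vert : τ → Fin 3 → Plane} {owner : τ → ι} {u : Plane → Plane}
      {G : Fin 2 → ℕ → Plane → ℝ}, IsPolygon Ω → IsSubdivision 𝒯 N σ vert owner →
      𝒯.meshSize ≤ h₀ → (∀ K, (P.patch K).card ≤ M) → P.AssumptionA m →
      IsSolenoidalSobolev m Ω u G →
        𝒯.starSq (fun K x => u x - P.interpolant m u K x) +
          𝒯.diamondSq m (fun K x => u x - P.interpolant m u K x) ≤
          C * ∑ K, P.Lam m ^ 2 * P.patchSize ^ m * ∫ x in P.region K, density m G x := by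
  obtain ⟨C, hC, hsup⟩ := exists_interpolant_bound m hm N M σ
  refine ⟨18 * N * (C ^ 2 * h₀ ^ m) + 18 * N * (C ^ 2 * σ ^ m), ?_⟩
  intro Ω ι ε τ _ _ _ 𝒯 P vert owner u G hΩ hT hh hM hA hu
  classical
  set v : ι → Plane → Plane := fun K x => u x - P.interpolant m u K x with hv
  set Y : ι → ℝ := fun K => P.Lam m ^ 2 * P.patchSize ^ m * ∫ x in P.region K, density m G x
    with hY
  have hJ0 : ∀ K, 0 ≤ ∫ x in P.region K, density m G x := fun K =>
    integral_nonneg fun x => density_nonneg m G x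
  have hd0 : 0 ≤ P.patchSize := Real.iSup_nonneg fun K => Metric.diam_nonneg
  have hh0 : 0 ≤ h₀ := (Real.iSup_nonneg fun K => Metric.diam_nonneg).trans hh
  have hY0 : ∀ K, 0 ≤ Y K := fun K => mul_nonneg (by positivity) (hJ0 K)
  have hσ : ∀ _ : ε, 1 ≤ σ := fun e => by
    obtain ⟨t, -⟩ := hT.exists_owner_eq (𝒯.plus e)
    exact hT.family.one_le t
  -- the maximum norm estimate with a triangle whose diameter is controlled by the edge
  have hpt : ∀ e K, e ∈ 𝒯.edgesOf K → ∃ δ, 0 ≤ δ ∧ δ ≤ h₀ ∧ δ ≤ P.patchSize ∧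
      δ ≤ σ * dist (𝒯.src e) (𝒯.tgt e) ∧ ∀ x ∈ segment ℝ (𝒯.src e) (𝒯.tgt e),
        ‖v K x‖ ^ 2 ≤ C ^ 2 * P.Lam m ^ 2 * (δ ^ m * δ ^ m) *
          ∫ x in P.region K, density m G x := by
    intro e K he
    obtain ⟨t, rfl, ht⟩ := hT.exists_diam_le_mul_dist he
    refine ⟨_, Metric.diam_nonneg, (diam_triangle_le_meshSize hT t).trans hh,
      diam_triangle_le_patchSize hT t, ht, fun x hx => ?_⟩
    have h1 := hsup hΩ hT hM hA hu t x
      (frontier_subset_closure (PolygonalMesh.segment_subset_frontier he hx))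
    refine (pow_le_pow_left₀ (norm_nonneg _) h1 2).trans_eq ?_
    rw [mul_pow _ (Real.sqrt _), Real.sq_sqrt (hJ0 _)]
    ring
  have hlen : ∀ e, 0 < dist (𝒯.src e) (𝒯.tgt e) := fun e => dist_pos.2 (𝒯.src_ne_tgt e)
  have hstar : 𝒯.starSq v ≤ 18 * N * ∑ K, C ^ 2 * h₀ ^ m * Y K := by
    refine sum_edges_le hT (fun K => mul_nonneg (by positivity) (hY0 K)) fun e => ?_
    have hX : ∀ K, e ∈ 𝒯.edgesOf K → ∀ x ∈ segment ℝ (𝒯.src e) (𝒯.tgt e),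
        ‖v K x‖ ^ 2 ≤ C ^ 2 * h₀ ^ m * Y K := by
      intro K he x hx
      obtain ⟨δ, hδ0, hδ1, hδ2, -, hb⟩ := hpt e K he
      refine (hb x hx).trans ?_
      have := hJ0 K
      calc _ ≤ C ^ 2 * P.Lam m ^ 2 * (h₀ ^ m * P.patchSize ^ m) *
            ∫ x in P.region K, density m G x := by gcongr
        _ = _ := by rw [hY]; ring
    have h1 := edgeIntegral_le 𝒯 (e := e)
      (F := fun x => ∑ i, ∑ k, 𝒯.jumpTensor v e x i k ^ 2)
      (fun x => Finset.sum_nonneg fun _ _ => Finset.sum_nonneg fun _ _ => sq_nonneg _)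
      (fun x hx => (sum_jumpTensor_sq_le 𝒯 v e x).trans (le_sum_of_le_match 𝒯 hX hx))
    rw [inv_mul_le_iff₀ (hlen e)]
    exact h1
  have hdiamond : 𝒯.diamondSq m v ≤ 18 * N * ∑ K, C ^ 2 * σ ^ m * Y K := by
    refine sum_edges_le hT (fun K => ?_) fun e => ?_
    · obtain ⟨t, -⟩ := hT.exists_owner_eq K
      have := hT.family.one_le t
      exact mul_nonneg (by positivity) (hY0 K)
    have hσ1 := hσ e
    set ℓ := dist (𝒯.src e) (𝒯.tgt e) with hℓ
    have hℓ0 : 0 < ℓ := hlen e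
    have hX : ∀ K, e ∈ 𝒯.edgesOf K → ∀ x ∈ segment ℝ (𝒯.src e) (𝒯.tgt e),
        ‖v K x‖ ^ 2 ≤ ℓ ^ m * (C ^ 2 * σ ^ m * Y K) := by
      intro K he x hx
      obtain ⟨δ, hδ0, -, hδ2, hδ3, hb⟩ := hpt e K he
      refine (hb x hx).trans ?_
      have := hJ0 K
      calc _ ≤ C ^ 2 * P.Lam m ^ 2 * ((σ * ℓ) ^ m * P.patchSize ^ m) *
            ∫ x in P.region K, density m G x := by gcongr
        _ = _ := by rw [hY]; ring
    have h1 := edgeIntegral_le 𝒯 (e := e) (F := fun x => 𝒯.jumpNormal v e x ^ 2)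
      (fun x => sq_nonneg _)
      (fun x hx => (jumpNormal_sq_le 𝒯 v e x).trans (le_sum_of_le_match 𝒯 hX hx))
    rw [inv_mul_le_iff₀ (by positivity)]
    refine h1.trans_eq ?_
    rw [← Finset.mul_sum]
    ring
  have hmul : ∀ c : ℝ, ∑ K, c * Y K = c * ∑ K, Y K := fun c => (Finset.mul_sum _ _ _).symm
  rw [hmul] at hstar hdiamond
  change _ ≤ _ * ∑ K, Y K
  linarith

/-! ### The energy norm of the interpolation error -/

/-- The patches overlap boundedly often, hence so do the local energies. -/
theorem sum_region_le {Ω : Set Plane} {ι ε τ : Type} [Fintype ι] [Finite τ]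
    {𝒯 : PolygonalMesh Ω ι ε} {P : Patches 𝒯} {N M : ℕ} {σ : ℝ} {vert : τ → Fin 3 → Plane}
    {owner : τ → ι} (hΩ : IsPolygon Ω) (hT : IsSubdivision 𝒯 N σ vert owner)
    (hM : ∀ K, (P.patch K).card ≤ M) {m : ℕ} {u : Plane → Plane} {G : Fin 2 → ℕ → Plane → ℝ}
    (hu : IsSolenoidalSobolev m Ω u G) :
    ∑ K, ∫ x in P.region K, density m G x ≤ ((1 + 9 * N) ^ M : ℕ) * ∫ x in Ω, density m G x := by
  classical
  have hmeas : ∀ K, MeasurableSet (𝒯.elt K) := fun K => (𝒯.elt_polygon K).isOpen.measurableSet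
  have hint : ∀ K, IntegrableOn (density m G) (𝒯.elt K) := fun K =>
    (hu.mono hΩ.isOpen.measurableSet (𝒯.elt_subset hΩ K)).integrableOn_density
  have hsplit : ∀ S : Finset ι, ∫ x in ⋃ L ∈ S, 𝒯.elt L, density m G x =
      ∑ L ∈ S, ∫ x in 𝒯.elt L, density m G x := fun S =>
    integral_biUnion_finset S (fun L _ => hmeas L)
      (fun K _ L _ hKL => 𝒯.elt_disjoint K L hKL) fun L _ => hint L
  calc ∑ K, ∫ x in P.region K, density m G x
      = ∑ K, ∑ L ∈ P.patch K, ∫ x in 𝒯.elt L, density m G x :=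
        Finset.sum_congr rfl fun K _ => hsplit (P.patch K)
    _ = ∑ L, ∑ K ∈ Finset.univ.filter (fun K => L ∈ P.patch K), ∫ x in 𝒯.elt L, density m G x :=
        Finset.sum_comm' (by simp)
    _ ≤ ∑ L, ((1 + 9 * N) ^ M : ℕ) * ∫ x in 𝒯.elt L, density m G x := by
        refine Finset.sum_le_sum fun L _ => ?_
        rw [Finset.sum_const, nsmul_eq_mul]
        refine mul_le_mul_of_nonneg_right ?_ (integral_nonneg fun x => density_nonneg m G x)
        exact_mod_cast hT.card_patches_le P hM L
    _ = ((1 + 9 * N) ^ M : ℕ) * ∫ x in ⋃ L ∈ Finset.univ, 𝒯.elt L, density m G x := by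
        rw [hsplit, Finset.mul_sum]
    _ ≤ _ := by
        refine mul_le_mul_of_nonneg_left (setIntegral_mono_set hu.integrableOn_density
          (Filter.Eventually.of_forall fun x => density_nonneg m G x)
          (LE.le.eventuallyLE ?_)) (Nat.cast_nonneg _)
        exact Set.iUnion₂_subset fun L _ => 𝒯.elt_subset hΩ L

theorem isSolenoidalSobolev_of_memHVec {m : ℕ} {Ω : Set Plane} (hΩ : IsOpen Ω)
    {u : Plane → Plane} (hu : MemHVec (m + 1) Ω u) (hc : ContinuousOn u (closure Ω))
    (hdiv : IsWeaklySolenoidal Ω u) : IsSolenoidalSobolev m Ω u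
      fun i a => weakDeriv Ω a (m + 1 - a) fun x => u x i where
  cont := hc
  weak i a ha := by
    obtain ⟨g, hg, -⟩ := hu i a (m + 1 - a) (by omega)
    exact hg.weakDeriv
  memLp i a ha := by
    obtain ⟨g, hg, hgL⟩ := hu i a (m + 1 - a) (by omega)
    exact hgL.ae_eq (hg.ae_eq hΩ hg.weakDeriv)
  solenoidal := hdiv

theorem sqrt_energy_eq {D Λ d s : ℝ} (m : ℕ) (hΛ : 0 ≤ Λ) (hd : 0 ≤ d)
    (hs : 0 ≤ s) :
    Real.sqrt (D * (Λ ^ 2 * d ^ m * s)) =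
      Real.sqrt D * (Λ * d ^ ((m : ℝ) / 2)) * Real.sqrt s := by
  have h1 : (d ^ ((m : ℝ) / 2)) ^ 2 = d ^ m := by
    rw [← Real.rpow_natCast, ← Real.rpow_mul hd]
    rw [← Real.rpow_natCast d m]
    congr 1
    push_cast
    ring
  have h2 : D * (Λ ^ 2 * d ^ m * s) = D * (s * (Λ * d ^ ((m : ℝ) / 2)) ^ 2) := by
    rw [mul_pow, h1]; ring
  have h3 : 0 ≤ Λ * d ^ ((m : ℝ) / 2) := mul_nonneg hΛ (Real.rpow_nonneg hd _)
  rw [h2, ← mul_assoc, Real.sqrt_mul' _ (sq_nonneg _), Real.sqrt_sq h3, Real.sqrt_mul' _ hs]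
  ring

/-- The interpolation error in the energy norm. -/
theorem exists_energyNorm_bound (m : ℕ) (hm : 1 ≤ m) (N M : ℕ) (σ h₀ : ℝ) : ∃ C : ℝ, 0 ≤ C ∧
    ∀ {Ω : Set Plane} {ι ε : Type} [Fintype ι] [Fintype ε] {𝒯 : PolygonalMesh Ω ι ε}
      {P : Patches 𝒯} {u : Plane → Plane}, IsPolygon Ω → 𝒯.ShapeRegular N σ → 𝒯.meshSize ≤ h₀ →
      (∀ K, (P.patch K).card ≤ M) → P.AssumptionA m → MemHVec (m + 1) Ω u →
      ContinuousOn u (closure Ω) → IsWeaklySolenoidal Ω u →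
        𝒯.energyNorm m (fun K x => u x - P.interpolant m u K x) ≤
          C * (P.Lam m * P.patchSize ^ ((m : ℝ) / 2)) * hSeminorm (m + 1) Ω u := by
  obtain ⟨C₁, hbroken⟩ := exists_seminormSq_bound m hm N M σ h₀
  obtain ⟨C₂, hjump⟩ := exists_jump_bound m hm N M σ h₀
  refine ⟨Real.sqrt (|C₁ + C₂| * ((1 + 9 * N) ^ M : ℕ)), Real.sqrt_nonneg _, ?_⟩
  intro Ω ι ε _ _ 𝒯 P u hΩ hreg hh hM hA hu hc hdiv
  obtain ⟨τ, _, vert, owner, hT⟩ := exists_isSubdivision hreg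
  have huS := isSolenoidalSobolev_of_memHVec hΩ.isOpen hu hc hdiv
  have hu1 : MemHVec 1 Ω u := fun i a b hab => hu i a b (by omega)
  set G : Fin 2 → ℕ → Plane → ℝ := fun i a => weakDeriv Ω a (m + 1 - a) fun x => u x i with hG
  have hS : ∫ x in Ω, density m G x = seminormSq (m + 1) Ω u := huS.integral_density
  have hS0 : 0 ≤ seminormSq (m + 1) Ω u :=
    hS ▸ integral_nonneg fun x => density_nonneg m G x
  have hd0 : 0 ≤ P.patchSize := Real.iSup_nonneg fun K => Metric.diam_nonneg
  have hΛ0 : 0 ≤ P.Lam m := Real.iSup_nonneg fun K =>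
    add_nonneg zero_le_one (mul_nonneg (P.stabilityConst_nonneg m K) (Real.sqrt_nonneg _))
  have h1 : 𝒯.brokenSq (fun K x => u x - P.interpolant m u K x) ≤
      C₁ * ∑ K, P.Lam m ^ 2 * P.patchSize ^ m * ∫ x in P.region K, density m G x := by
    rw [Finset.mul_sum]
    exact Finset.sum_le_sum fun K _ => hbroken hΩ hT hh hM hA huS hu1 K
  have h2 := hjump hΩ hT hh hM hA huS
  have h3 := sum_region_le hΩ hT hM huS
  have h4 : 0 ≤ ∑ K, ∫ x in P.region K, density m G x :=
    Finset.sum_nonneg fun K _ => integral_nonneg fun x => density_nonneg m G x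
  rw [← Finset.mul_sum] at h1 h2
  rw [hSeminorm, ← sqrt_energy_eq m hΛ0 hd0 hS0]
  refine Real.sqrt_le_sqrt ?_
  calc _ ≤ (C₁ + C₂) * (P.Lam m ^ 2 * P.patchSize ^ m *
        ∑ K, ∫ x in P.region K, density m G x) := by linarith
    _ ≤ |C₁ + C₂| * (P.Lam m ^ 2 * P.patchSize ^ m *
        (((1 + 9 * N) ^ M : ℕ) * seminormSq (m + 1) Ω u)) := by
        rw [← hS]
        gcongr
        exact le_abs_self _
    _ = _ := by ring

end StokesDG

end

theorem mainTheorem4 (m : ℕ) (hm : 1 ≤ m) (N M : ℕ) (σ h₀ : ℝ) :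
    ∃ C : ℝ, ∀ (Ω : Set StokesDG.Plane) (_ : StokesDG.IsPolygon Ω)
      (ι ε : Type) [Fintype ι] [Fintype ε] (𝒯 : StokesDG.PolygonalMesh Ω ι ε)
      (P : StokesDG.Patches 𝒯),
      𝒯.ShapeRegular N σ → 𝒯.meshSize ≤ h₀ → (∀ K, (P.patch K).card ≤ M) → P.AssumptionA m →
      ∀ (f g u : StokesDG.Plane → StokesDG.Plane) (p : StokesDG.Plane → ℝ),
        StokesDG.IsStokesSolution Ω f g u p →
        StokesDG.MemHVec (m + 1) Ω u → ContinuousOn u (closure Ω) →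
        P.interpolant m u ∈ P.Vh m ∧
        𝒯.energyNorm m (fun K x => u x - P.interpolant m u K x) ≤
          C * (𝒯.meshSize ^ ((m : ℝ) / 2) + P.Lam m * P.patchSize ^ ((m : ℝ) / 2)) *
            StokesDG.hSeminorm (m + 1) Ω u := by
  obtain ⟨C, hC, hbound⟩ := StokesDG.exists_energyNorm_bound m hm N M σ h₀
  refine ⟨C, ?_⟩
  intro Ω hΩ ι ε _ _ 𝒯 P hreg hh hM hA f g u p hu hreg' hcont
  refine ⟨⟨_, rfl⟩, (hbound hΩ hreg hh hM hA hreg' hcont hu.div_free).trans ?_⟩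
  have h1 : 0 ≤ 𝒯.meshSize ^ ((m : ℝ) / 2) :=
    Real.rpow_nonneg (Real.iSup_nonneg fun _ => Metric.diam_nonneg) _
  have h2 : 0 ≤ StokesDG.hSeminorm (m + 1) Ω u := Real.sqrt_nonneg _
  gcongr
  exact le_add_of_nonneg_left h1
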